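/- Let $(M,J,\omega)$ be a toric Kähler manifold of complex dimension $n$: $M$ is a compact connected complex manifold with a smooth Kähler form $\omega$ and a holomorphic action of $(\mathbb C^*)^n$ having an open dense orbit $M_{\mathrm o}=(\mathbb C^*)^n\cdot o$ on which it acts freely, and the real torus $(S^1)^n$ preserves $\omega$ and acts in a Hamiltonian fashion. Let $\dot\varphi_0\in C^3(M)$ be a real-valued $(S^1)^n$-invariant function, and let $X$ be its Hamiltonian vector field, $\omega(X,\cdot)=d\dot\varphi_0$. For $T>0$ put $S_T=\{\tau=s+\sqrt{-1}\,t:\ 0\le s\le T,\ t\in\mathbb R\}$. When, for every $z\in M$, the Hamiltonian orbit $t\mapsto\exp(tX).z$ has a (necessarily unique) extension to a holomorphic map $\tau\mapsto f_\tau(z)$, $S_T\to M$, with $f_{\sqrt{-1}t}(z)=\exp(tX).z$, the maps $f_\tau:M\to M$, $\tau\in S_T$, are called the Moser maps. The Cauchy problem for the homogeneous complex Monge–Ampère equation with data $(\omega,\dot\varphi_0)$ is called $T$-good if these extensions exist for all $z\in M$ and all $f_\tau$, $\tau\in S_T$, are $C^1$. Use logarithmic coordinates $x+\sqrt{-1}\theta\mapsto(e^{x_1+\sqrt{-1}\theta_1},\dots,e^{x_n+\sqrt{-1}\theta_n})\cdot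 o$ on $M_{\mathrm o}$. An open-orbit potential of $\omega$ is a smooth strictly convex function $\psi_0$ on $\mathbb R^n$ with $\omega|_{M_{\mathrm o}}=2\sqrt{-1}\,\partial\bar\partial\,\psi_0(x)=\sum_j dy_j\wedge d\theta_j$, where $y=\nabla\psi_0(x)$. Then: (i) The Cauchy problem is $T$-good for every $T>0$. Moreover, for every $z\in M$ there is $a\in\mathbb R^n$ such that $f_\tau(z)=(e^{-\tau a_1},\dots,e^{-\tau a_n})\cdot z$ for all $\tau$ in the closed right half-plane. Open-orbit potentials $\psi_0$ exist, and for any of them, at the point of $M_{\mathrm o}$ with logarithmic coordinates $x+\sqrt{-1}\theta$, the map $f_\tau$ is given by the affine expression $x+\sqrt{-1}\theta\mapsto x+\sqrt{-1}\theta-\tau\,(\nabla^2\psi_0(x))^{-1}\nabla_x\dot\varphi_0(x)$. (ii) For any open-orbit potential $\psi_0$ and any $s\ge0$, the Moser map $f_s$ is invertible, in the sense that it is a $C^1$ diffeomorphism of $M$, if and only if $s<T^{\mathrm{cvx}}_{\mathrm{span}}$, where $$T^{\mathrm{cvx}}_{\mathrm{span}}:=\sup\{a>0:\ \psi_0^\star-a\,\dot\varphi_0\circ(\nabla\psi_0)^{-1}\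 \text{is convex on } \nabla\psi_0(\mathbb R^n)\}\in[0,\infty],$$ $\dot\varphi_0$ is regarded as a function of $x\in\mathbb R^n$, and $\psi_0^\star$ is the Legendre transform of $\psi_0$. -/

import Mathlib

open scoped Manifold ContDiff

noncomputable section

namespace ToricMoser

/-- The model space `ℂⁿ` of complex `n`-dimensional manifolds. -/
abbrev CSpace (n : ℕ) : Type := EuclideanSpace ℂ (Fin n)

/-- Euclidean `ℝⁿ`. -/
abbrev RSpace (n : ℕ) : Type := EuclideanSpace ℝ (Fin n)

/-- The complex torus `(ℂ*)ⁿ`. -/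
abbrev CTorus (n : ℕ) : Type := Fin n → ℂˣ

/-- The exponential map `ℂⁿ → (ℂ*)ⁿ`, `ζ ↦ (e^{ζ₁}, …, e^{ζₙ})`. It is a surjective holomorphic
covering; the imaginary vectors map onto the real torus `(S¹)ⁿ`. -/
def torusExp {n : ℕ} (ζ : CSpace n) : CTorus n :=
  fun j => Units.mk0 (Complex.exp (ζ j)) (Complex.exp_ne_zero _)

/-- The vector `x + i θ` of `ℂⁿ`. -/
def cvec {n : ℕ} (x θ : RSpace n) : CSpace n :=
  WithLp.toLp 2 fun j => (x j : ℂ) + Complex.I * (θ j : ℂ)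

/-- The real part of a vector of `ℂⁿ`. -/
def revec {n : ℕ} (ζ : CSpace n) : RSpace n :=
  WithLp.toLp 2 fun j => (ζ j).re

section Kaehler

variable {n : ℕ} {M : Type*} [TopologicalSpace M] [ChartedSpace (CSpace n) M]

/-- (Not necessarily continuous) fields of real alternating two-forms on the complex
manifold `M`. -/
abbrev TwoForm (n : ℕ) (M : Type*) [TopologicalSpace M] [ChartedSpace (CSpace n) M] :=
  (x : M) → (TangentSpace 𝓘(ℝ, CSpace n) x) [⋀^Fin 2]→L[ℝ] ℝ

/-- The almost complex structure of a complex manifold. The tangent space at `x` is identified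
with `ℂⁿ` through a holomorphic chart, so `J` is multiplication by `i`. -/
def J {x : M} (v : TangentSpace 𝓘(ℝ, CSpace n) x) : TangentSpace 𝓘(ℝ, CSpace n) x :=
  (Complex.I • (show CSpace n from v) : CSpace n)

/-- The coordinate expression (pull-back under the inverse of a chart) of a two-form. -/
def TwoForm.inChart (Ω : TwoForm n M) (e : OpenPartialHomeomorph M (CSpace n)) :
    CSpace n → (CSpace n) [⋀^Fin 2]→L[ℝ] ℝ :=
  fun y => (Ω (e.symm y)).compContinuousLinearMap
    (mfderiv 𝓘(ℝ, CSpace n) 𝓘(ℝ, CSpace n) e.symm y)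

/-- `Ω` is a Kähler form: smooth, closed, `J`-invariant (of type `(1,1)`) and positive. -/
structure IsKaehlerForm (Ω : TwoForm n M) : Prop where
  smooth : ∀ e ∈ atlas (CSpace n) M, ContDiffOn ℝ ∞ (Ω.inChart e) e.target
  closed : ∀ e ∈ atlas (CSpace n) M, ∀ y ∈ e.target, extDeriv (Ω.inChart e) y = 0
  invariant : ∀ (x : M) (v w : TangentSpace 𝓘(ℝ, CSpace n) x), Ω x ![J v, J w] = Ω x ![v, w]
  positive : ∀ (x : M) (v : TangentSpace 𝓘(ℝ, CSpace n) x), v ≠ 0 → 0 < Ω x ![v, J v]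

/-- `γ` is the orbit of `z` under the Hamiltonian flow of `H`: it starts at `z` and solves
`γ' = X ∘ γ`, where the vector field `X` is given by `Ω(X, ·) = dH`. -/
structure IsHamiltonianOrbit (Ω : TwoForm n M) (H : M → ℝ) (z : M) (γ : ℝ → M) : Prop where
  start : γ 0 = z
  differentiable : MDifferentiable 𝓘(ℝ, ℝ) 𝓘(ℝ, CSpace n) γ
  velocity : ∀ (t : ℝ) (w : TangentSpace 𝓘(ℝ, CSpace n) (γ t)),
    Ω (γ t) ![mfderiv 𝓘(ℝ, ℝ) 𝓘(ℝ, CSpace n) γ t (1 : ℝ), w]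
      = mfderiv 𝓘(ℝ, CSpace n) 𝓘(ℝ, ℝ) H (γ t) w

/-- The closed strip `S_T = [0,T] × ℝ`, with complex coordinate `τ = s + i t`. -/
def strip (T : ℝ) : Set ℂ := {τ | 0 ≤ τ.re ∧ τ.re ≤ T}

/-- `f_τ`, `τ ∈ S_T`, are the Moser maps of `(Ω, H)`: for every `z` the curve `τ ↦ f_τ(z)` is a
holomorphic map of the strip `S_T` into `M` which extends the Hamiltonian orbit
`t ↦ f_{it}(z)` of `z`. -/
structure IsMoserFamily (Ω : TwoForm n M) (H : M → ℝ) (T : ℝ) (f : ℂ → M → M) : Prop where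
  orbit : ∀ z, IsHamiltonianOrbit Ω H z (fun t : ℝ => f (Complex.I * t) z)
  holomorphic : ∀ z, MDifferentiableOn 𝓘(ℂ, ℂ) 𝓘(ℂ, CSpace n) (fun τ => f τ z) (strip T)

/-- The Cauchy problem with data `(Ω, H)` is `T`-good: all Hamiltonian orbits extend
holomorphically to the strip `S_T`, and the resulting Moser maps are continuously differentiable
maps of `M`. -/
def IsTGood (Ω : TwoForm n M) (H : M → ℝ) (T : ℝ) : Prop :=
  ∃ f : ℂ → M → M, IsMoserFamily Ω H T f ∧
    ∀ τ ∈ strip T, ContMDiff 𝓘(ℝ, CSpace n) 𝓘(ℝ, CSpace n) 1 (f τ)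

end Kaehler

section Toric

variable {n : ℕ} {M : Type*} [TopologicalSpace M] [ChartedSpace (CSpace n) M]
  [MulAction (CTorus n) M]

/-- A function on `M` is torus-invariant if it is invariant under `(S¹)ⁿ`. -/
def IsTorusInvariant (H : M → ℝ) : Prop :=
  ∀ (θ : RSpace n) (z : M), H (torusExp (cvec 0 θ) • z) = H z

/-- The fundamental vector field `∂/∂θ_j` of the `j`-th circle of the real torus. -/
def angleField (j : Fin n) (z : M) : TangentSpace 𝓘(ℝ, CSpace n) z :=
  (show CSpace n from mfderiv 𝓘(ℝ, ℝ) 𝓘(ℝ, CSpace n)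
    (fun t : ℝ => torusExp (cvec 0 (t • EuclideanSpace.single j (1 : ℝ))) • z) 0 (1 : ℝ))

/-- The parametrization of the orbit of `o` by logarithmic coordinates:
`x + i θ ↦ (e^{x₁ + i θ₁}, …, e^{xₙ + i θₙ}) • o`. -/
def logParam (o : M) (ζ : CSpace n) : M := torusExp ζ • o

/-- `(M, Ω)`, with the given action of `(ℂ*)ⁿ`, is a toric Kähler manifold, and `o` is a point of
its open orbit: the action is holomorphic, the orbit of `o` is open and dense and `(ℂ*)ⁿ` acts
freely on it, and the real torus `(S¹)ⁿ` acts in a Hamiltonian fashion by isometries of the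
Kähler form `Ω`. -/
structure IsToricKaehler (Ω : TwoForm n M) (o : M) : Prop where
  kaehler : IsKaehlerForm Ω
  holomorphic : ContMDiff (𝓘(ℂ, CSpace n).prod 𝓘(ℂ, CSpace n)) 𝓘(ℂ, CSpace n) ω
    (fun p : CSpace n × M => torusExp p.1 • p.2)
  free : Function.Injective (fun g : CTorus n => g • o)
  isOpen_orbit : IsOpen (MulAction.orbit (CTorus n) o)
  dense_orbit : Dense (MulAction.orbit (CTorus n) o)
  isometric : ∀ (θ : RSpace n) (z : M) (v w : TangentSpace 𝓘(ℝ, CSpace n) z),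
    Ω (torusExp (cvec 0 θ) • z)
      ![mfderiv 𝓘(ℝ, CSpace n) 𝓘(ℝ, CSpace n) (fun p : M => torusExp (cvec 0 θ) • p) z v,
        mfderiv 𝓘(ℝ, CSpace n) 𝓘(ℝ, CSpace n) (fun p : M => torusExp (cvec 0 θ) • p) z w]
      = Ω z ![v, w]
  hamiltonian : ∃ μ : Fin n → M → ℝ, ∀ j, ContMDiff 𝓘(ℝ, CSpace n) 𝓘(ℝ, ℝ) ∞ (μ j) ∧
    ∀ (z : M) (v : TangentSpace 𝓘(ℝ, CSpace n) z),
      Ω z ![angleField j z, v] = - mfderiv 𝓘(ℝ, CSpace n) 𝓘(ℝ, ℝ) (μ j) z v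

/-- The real two-form `√-1 ∂∂̄ u` of a function `u` on `ℂⁿ`, through the real second derivative
of `u`. -/
def iddbar (u : CSpace n → ℝ) (ζ v w : CSpace n) : ℝ :=
  (fderiv ℝ (fderiv ℝ u) ζ w (Complex.I • v) - fderiv ℝ (fderiv ℝ u) ζ v (Complex.I • w)) / 2

/-- `ψ` is an open-orbit Kähler potential of `Ω`: a smooth strictly convex function on `ℝⁿ` with
`Ω = 2√-1 ∂∂̄ ψ(x)` in the logarithmic coordinates `x + i θ` of the open orbit. Equivalently
`Ω = ∑ ψ_{jk} dx_j ∧ dθ_k = ∑ dy_j ∧ dθ_j` with `y = ∇ψ(x)`. -/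
structure IsOpenOrbitPotential (Ω : TwoForm n M) (o : M) (ψ : RSpace n → ℝ) : Prop where
  smooth : ContDiff ℝ ∞ ψ
  strictConvex : StrictConvexOn ℝ Set.univ ψ
  potential : ∀ ζ v w : CSpace n,
    Ω (logParam o ζ)
      ![mfderiv 𝓘(ℝ, CSpace n) 𝓘(ℝ, CSpace n) (logParam o) ζ v,
        mfderiv 𝓘(ℝ, CSpace n) 𝓘(ℝ, CSpace n) (logParam o) ζ w]
      = 2 * iddbar (fun η => ψ (revec η)) ζ v w

/-- A torus-invariant function on `M`, restricted to the open orbit, as a function of the real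
logarithmic coordinate `x ∈ ℝⁿ`. -/
def onOpenOrbit (o : M) (H : M → ℝ) (x : RSpace n) : ℝ := H (logParam o (cvec x 0))

/-- The vector `(∇²ψ)⁻¹ ∇_x h` at `x`. -/
def hessianInvGrad (ψ h : RSpace n → ℝ) (x : RSpace n) : RSpace n :=
  (fderiv ℝ (gradient ψ) x).inverse (gradient h x)

/-- The Legendre transform `ψ*(y) = sup_x (⟨x, y⟩ - ψ(x))`. (The supremum is finite, and attained,
for the `y` in the image of `∇ψ` if `ψ` is convex; only such `y` are used.) -/
def legendre (ψ : RSpace n → ℝ) (y : RSpace n) : ℝ := ⨆ x : RSpace n, (inner ℝ x y - ψ x)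

/-- The convex lifespan: the supremum, in `[0, ∞]`, of all `s > 0` for which
`ψ* - s h ∘ (∇ψ)⁻¹` is convex on the image of `∇ψ`, i.e. on the interior of the polytope. -/
def convexLifespan (ψ h : RSpace n → ℝ) : ENNReal :=
  sSup (ENNReal.ofReal '' {s : ℝ | 0 < s ∧
    ConvexOn ℝ (Set.range (gradient ψ))
      (fun y => legendre ψ y - s * h (Function.invFun (gradient ψ) y))})

end Toric

end ToricMoser

end

noncomputable section

open Set Filter Topology
open scoped Manifold ContDiff

set_option linter.unusedSectionVars false

namespace ToricMoser

/-! ### A complex manifold viewed as a real analytic manifold -/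

section RealStructure

variable {E : Type*} [NormedAddCommGroup E] [NormedSpace ℂ E]
  {F : Type*} [NormedAddCommGroup F] [NormedSpace ℂ F]
  {M : Type*} [TopologicalSpace M] [ChartedSpace E M]
  {N : Type*} [TopologicalSpace N] [ChartedSpace F N]

/-! On the open orbit the problem is one about convex functions of x. Orbits of the real torus are
isotropic and ω is J-invariant, so in logarithmic coordinates ω is the Hessian of a potential ψ,
obtained by integrating the moment map. There i times the Hamiltonian field X is the fundamental
field of the real vector α(x) = (∇²ψ)⁻¹∇h. Since α does not depend on θ, it is constant along each
Hamiltonian orbit, so this orbit is t ↦ exp(-itα)·z and τ ↦ exp(-τα)·z is its holomorphic extension.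
Uniqueness follows from uniqueness for the flow (`IsHamiltonianOrbit.unique`) and an identity
theorem on the strip (`eqOn_strip`).

The difficulty lies at the boundary of the open orbit. First, α must extend to a continuous map a :
M → ℝⁿ which still generates iX (`exists_velocity`). Averaging chart components against characters
of the compact stabilizer of z gives holomorphic coordinates near z in which the infinitesimal
stabilizer acts diagonally. Transversally to the stabilizer algebra, a solves a linear system with
C¹ coefficients. Along it, a is seen only through functions which are real multiples of a coordinate
u_l; a C¹ function of this kind has a quotient by u_l with a limit at u_l = 0
(`exists_tendsto_div_of_im_eq_zero`).

Second, f_τ must be C¹, although only the continuity of a has been obtained. On the open orbit df_τ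
= d(exp(-τa)) ∘ (1 - τN), and the Leibniz rule for iX expresses N through derivatives of smooth
enough chart data and the values of a. Thus the right side is continuous on all of M. The complement
of the open orbit is locally the zero set of an analytic determinant, and a continuous candidate for
the derivative extends across such a set (`hasStrictFDerivAt_of_analytic_exception`).

For the lifespan, the gradient of ψ* - s h∘(∇ψ)⁻¹ at ∇ψ(x) is x - sα(x). Convexity therefore means
that q_s(v) = ⟨(1 - sDα)v, ∇²ψ v⟩ is nonnegative. If q_{s'} ≥ 0 for some s' > s, then q_s ≥ (1 -
s/s') q_0 because q is affine in s. This bound passes by density to M, so f_s is a local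
diffeomorphism. It is injective on the open orbit by monotonicity, injective on M by density, and
its image is open and closed.

Conversely, if f_s is a diffeomorphism then 1 - sDα is invertible everywhere, so definiteness of q_s
spreads from one point to all of ℝⁿ. Such a point is the minimum of a suitable proper function
(`exists_shiftForm_pos`). The extension of q_s to M is semidefinite by density and nondegenerate,
hence positive definite, and compactness of M leaves room for some s' > s. -/

theorem contDiffGroupoid_complex_le_real :
    contDiffGroupoid ω 𝓘(ℂ, E) ≤ contDiffGroupoid ω 𝓘(ℝ, E) := by
  intro e he
  have he := mem_groupoid_of_pregroupoid.mp he
  refine mem_groupoid_of_pregroupoid.mpr ?_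
  simp only [contDiffPregroupoid, modelWithCornersSelf_coe,
    modelWithCornersSelf_coe_symm, Function.comp_id, Function.id_comp, preimage_id, range_id,
    inter_univ] at he ⊢
  exact ⟨he.1.restrict_scalars ℝ, he.2.restrict_scalars ℝ⟩

theorem isManifold_real [h : IsManifold 𝓘(ℂ, E) ω M] : IsManifold 𝓘(ℝ, E) ω M :=
  { hasGroupoid_of_le h.toHasGroupoid contDiffGroupoid_complex_le_real with }

theorem hasMFDerivAt_real {g : M → N} {x : M} {L : E →L[ℂ] F}
    (h : HasMFDerivAt 𝓘(ℂ, E) 𝓘(ℂ, F) g x L) :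
    HasMFDerivAt 𝓘(ℝ, E) 𝓘(ℝ, F) g x (L.restrictScalars ℝ) := by
  refine ⟨h.1, ?_⟩
  exact HasFDerivWithinAt.restrictScalars ℝ h.2

theorem contMDiffAt_real {m : WithTop ℕ∞} {g : M → N} {x : M}
    (h : ContMDiffAt 𝓘(ℂ, E) 𝓘(ℂ, F) m g x) : ContMDiffAt 𝓘(ℝ, E) 𝓘(ℝ, F) m g x := by
  rw [contMDiffAt_iff] at h ⊢
  exact ⟨h.1, h.2.restrict_scalars ℝ⟩

end RealStructure

/-! ### Derivatives of maps into M through charts -/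

section Charts

variable {n : ℕ} {M : Type*} [TopologicalSpace M] [ChartedSpace (CSpace n) M]
  [IsManifold 𝓘(ℂ, CSpace n) ω M]

/-- The preferred chart at a point of `M`. -/
abbrev ch (n : ℕ) {M : Type*} [TopologicalSpace M] [ChartedSpace (CSpace n) M] (z : M) : OpenPartialHomeomorph M (CSpace n) := chartAt (CSpace n) z

theorem chart_mdifferentiable (z : M) :
    (ch n z).MDifferentiable 𝓘(ℝ, CSpace n) 𝓘(ℝ, CSpace n) := by
  have : IsManifold 𝓘(ℝ, CSpace n) ω M := isManifold_real
  have : IsManifold 𝓘(ℝ, CSpace n) 1 M := .of_le (n := ω) le_top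
  exact mdifferentiable_chart z

theorem chart_mdifferentiable_complex (z : M) :
    (ch n z).MDifferentiable 𝓘(ℂ, CSpace n) 𝓘(ℂ, CSpace n) := by
  have : IsManifold 𝓘(ℂ, CSpace n) 1 M := .of_le (n := ω) le_top
  exact mdifferentiable_chart z

/-- The derivative of a map into `M`, through its expression in a chart. -/
theorem mfderiv_eq_symm_chart {E' : Type*} [NormedAddCommGroup E'] [NormedSpace ℝ E']
    {g : E' → M} {p : E'} (z : M) (hg : MDifferentiableAt 𝓘(ℝ, E') 𝓘(ℝ, CSpace n) g p)
    (hp : g p ∈ (ch n z).source) (v : E') :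
    mfderiv 𝓘(ℝ, E') 𝓘(ℝ, CSpace n) g p v =
      mfderiv 𝓘(ℝ, CSpace n) 𝓘(ℝ, CSpace n) (ch n z).symm (ch n z (g p))
        (fderiv ℝ (ch n z ∘ g) p v : CSpace n) := by
  have he := chart_mdifferentiable (n := n) z
  have h1 : mfderiv 𝓘(ℝ, E') 𝓘(ℝ, CSpace n) (ch n z ∘ g) p =
      (mfderiv 𝓘(ℝ, CSpace n) 𝓘(ℝ, CSpace n) (ch n z) (g p)).comp
        (mfderiv 𝓘(ℝ, E') 𝓘(ℝ, CSpace n) g p) :=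
    mfderiv_comp p (he.mdifferentiableAt hp) hg
  rw [← mfderiv_eq_fderiv, h1]
  have h2 := he.symm_comp_deriv hp
  exact (DFunLike.congr_fun h2 (mfderiv 𝓘(ℝ, E') 𝓘(ℝ, CSpace n) g p v)).symm

theorem mdifferentiableAt_iff_chart {E' : Type*} [NormedAddCommGroup E'] [NormedSpace ℝ E']
    {g : E' → M} {p : E'} (z : M) (hp : g p ∈ (ch n z).source) :
    MDifferentiableAt 𝓘(ℝ, E') 𝓘(ℝ, CSpace n) g p ↔
      ContinuousAt g p ∧ DifferentiableAt ℝ (ch n z ∘ g) p := by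
  have he := chart_mdifferentiable (n := n) z
  constructor
  · intro h
    refine ⟨h.continuousAt, ?_⟩
    exact ((he.mdifferentiableAt hp).comp p h).differentiableAt
  · rintro ⟨hc, hd⟩
    have h1 : MDifferentiableAt 𝓘(ℝ, E') 𝓘(ℝ, CSpace n) ((ch n z).symm ∘ (ch n z ∘ g)) p :=
      (he.mdifferentiableAt_symm ((ch n z).map_source hp)).comp p hd.mdifferentiableAt
    refine h1.congr_of_eventuallyEq ?_
    filter_upwards [hc.eventually ((ch n z).open_source.mem_nhds hp)] with q hq
    exact ((ch n z).left_inv hq).symm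

theorem mdifferentiableAt_complex_iff_chart {E' : Type*} [NormedAddCommGroup E'] [NormedSpace ℂ E']
    {g : E' → M} {p : E'} (z : M) (hp : g p ∈ (ch n z).source) :
    MDifferentiableAt 𝓘(ℂ, E') 𝓘(ℂ, CSpace n) g p ↔
      ContinuousAt g p ∧ DifferentiableAt ℂ (ch n z ∘ g) p := by
  have he := chart_mdifferentiable_complex (n := n) z
  constructor
  · intro h
    refine ⟨h.continuousAt, ?_⟩
    exact ((he.mdifferentiableAt hp).comp p h).differentiableAt
  · rintro ⟨hc, hd⟩
    have h1 : MDifferentiableAt 𝓘(ℂ, E') 𝓘(ℂ, CSpace n) ((ch n z).symm ∘ (ch n z ∘ g)) p :=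
      (he.mdifferentiableAt_symm ((ch n z).map_source hp)).comp p hd.mdifferentiableAt
    refine h1.congr_of_eventuallyEq ?_
    filter_upwards [hc.eventually ((ch n z).open_source.mem_nhds hp)] with q hq
    exact ((ch n z).left_inv hq).symm

theorem mdifferentiableWithinAt_complex_chart {E' : Type*} [NormedAddCommGroup E']
    [NormedSpace ℂ E'] {g : E' → M} {s : Set E'} {p : E'} (z : M) (hp : g p ∈ (ch n z).source)
    (h : MDifferentiableWithinAt 𝓘(ℂ, E') 𝓘(ℂ, CSpace n) g s p) :
    DifferentiableWithinAt ℂ (ch n z ∘ g) s p :=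
  (((chart_mdifferentiable_complex z).mdifferentiableAt hp).comp_mdifferentiableWithinAt p
    h).differentiableWithinAt

/-- The derivatives of inverse charts are complex linear. -/
theorem mfderiv_symm_chart_I_smul (z : M) {y : CSpace n} (hy : y ∈ (ch n z).target) (v : CSpace n) :
    mfderiv 𝓘(ℝ, CSpace n) 𝓘(ℝ, CSpace n) (ch n z).symm y (Complex.I • v : CSpace n) =
      J (mfderiv 𝓘(ℝ, CSpace n) 𝓘(ℝ, CSpace n) (ch n z).symm y v) := by
  have h := ((chart_mdifferentiable_complex z).mdifferentiableAt_symm hy).hasMFDerivAt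
  have h2 := (hasMFDerivAt_real h).mfderiv
  rw [h2]
  exact (mfderiv 𝓘(ℂ, CSpace n) 𝓘(ℂ, CSpace n) (ch n z).symm y).map_smul Complex.I v

theorem mfderiv_symm_chart_injective (z : M) {y : CSpace n} (hy : y ∈ (ch n z).target) :
    Function.Injective (mfderiv 𝓘(ℝ, CSpace n) 𝓘(ℝ, CSpace n) (ch n z).symm y) :=
  (chart_mdifferentiable z).symm.mfderiv_injective hy

end Charts

/-! ### Two-forms in charts -/

section FormInChart

variable {n : ℕ} {M : Type*} [TopologicalSpace M] [ChartedSpace (CSpace n) M]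

theorem update_vec_zero {α : Type*} (v w x : α) : Function.update ![v, w] 0 x = ![x, w] := by
  ext i
  fin_cases i <;> rfl

theorem update_vec_one {α : Type*} (v w x : α) : Function.update ![v, w] 1 x = ![v, x] := by
  ext i
  fin_cases i <;> rfl

/-- Alternating two-forms as bilinear forms. -/
def alternatingToBilinear (f : (CSpace n) [⋀^Fin 2]→L[ℝ] ℝ) : CSpace n →L[ℝ] CSpace n →L[ℝ] ℝ :=
  LinearMap.toContinuousLinearMap (LinearMap.comp
    (LinearMap.toContinuousLinearMap (𝕜 := ℝ) (E := CSpace n) (F' := ℝ)).toLinearMap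
      (LinearMap.mk₂ ℝ (fun v w : CSpace n => f ![v, w])
        (fun v v' w => by
          have := f.map_update_add ![v, w] 0 v v'
          simpa only [update_vec_zero, update_vec_one] using this)
        (fun c v w => by
          have := f.map_update_smul ![v, w] 0 c v
          simpa only [update_vec_zero, update_vec_one] using this)
        (fun v w w' => by
          have := f.map_update_add ![v, w] 1 w w'
          simpa only [update_vec_zero, update_vec_one] using this)
        (fun c v w => by
          have := f.map_update_smul ![v, w] 1 c w
          simpa only [update_vec_zero, update_vec_one] using this)))

theorem alternatingToBilinear_apply (f : (CSpace n) [⋀^Fin 2]→L[ℝ] ℝ) (v w : CSpace n) :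
    alternatingToBilinear f v w = f ![v, w] := by
  rfl

/-- The expression of a two-form in the preferred chart at `z`, as a bilinear form. -/
def formChart (Ω : TwoForm n M) (z : M) (y : CSpace n) : CSpace n →L[ℝ] CSpace n →L[ℝ] ℝ :=
  alternatingToBilinear (Ω.inChart (ch n z) y)

theorem formChart_apply (Ω : TwoForm n M) (z : M) (y v w : CSpace n) :
    formChart Ω z y v w = Ω ((ch n z).symm y)
      ![mfderiv 𝓘(ℝ, CSpace n) 𝓘(ℝ, CSpace n) (ch n z).symm y v,
        mfderiv 𝓘(ℝ, CSpace n) 𝓘(ℝ, CSpace n) (ch n z).symm y w] := by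
  rw [formChart, alternatingToBilinear_apply, TwoForm.inChart]
  change Ω ((ch n z).symm y) _ = _
  congr 1
  ext i
  fin_cases i <;> rfl

theorem formChart_self (Ω : TwoForm n M) (z : M) (y v : CSpace n) : formChart Ω z y v v = 0 := by
  rw [formChart_apply]
  exact (Ω _).map_eq_zero_of_eq _ (i := 0) (j := 1) rfl (by decide)

theorem IsKaehlerForm.contDiffOn_formChart {Ω : TwoForm n M} (hΩ : IsKaehlerForm Ω) (z : M) :
    ContDiffOn ℝ ∞ (formChart Ω z) (ch n z).target := by
  rw [contDiffOn_clm_apply]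
  intro v
  rw [contDiffOn_clm_apply]
  intro w
  exact (ContinuousAlternatingMap.apply ℝ (CSpace n) ℝ ![v, w]).contDiff.comp_contDiffOn
    (hΩ.smooth _ (chart_mem_atlas _ z))

variable [IsManifold 𝓘(ℂ, CSpace n) ω M]

theorem IsKaehlerForm.formChart_pos {Ω : TwoForm n M} (hΩ : IsKaehlerForm Ω) (z : M)
    {y : CSpace n} (hy : y ∈ (ch n z).target) {v : CSpace n} (hv : v ≠ 0) :
    0 < formChart Ω z y v (Complex.I • v) := by
  rw [formChart_apply, mfderiv_symm_chart_I_smul z hy]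
  refine hΩ.positive _ _ fun h => hv ?_
  exact mfderiv_symm_chart_injective z hy (h.trans (map_zero _).symm)

/-- A two-form on the derivatives of a map into `M`, through its expression in a chart. -/
theorem form_mfderiv (Ω : TwoForm n M) {E' : Type*} [NormedAddCommGroup E'] [NormedSpace ℝ E']
    {g : E' → M} {p : E'} (z : M) (hg : MDifferentiableAt 𝓘(ℝ, E') 𝓘(ℝ, CSpace n) g p)
    (hp : g p ∈ (ch n z).source) (v w : E') :
    Ω (g p) ![mfderiv 𝓘(ℝ, E') 𝓘(ℝ, CSpace n) g p v, mfderiv 𝓘(ℝ, E') 𝓘(ℝ, CSpace n) g p w] =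
      formChart Ω z (ch n z (g p)) (fderiv ℝ (ch n z ∘ g) p v) (fderiv ℝ (ch n z ∘ g) p w) := by
  rw [formChart_apply, mfderiv_eq_symm_chart z hg hp, mfderiv_eq_symm_chart z hg hp,
    (ch n z).left_inv hp]

end FormInChart

/-! ### The holomorphic action of ℂⁿ through the exponential map -/

section Action

variable {n : ℕ} {M : Type*} [MulAction (CTorus n) M]

theorem torusExp_add (ζ η : CSpace n) : torusExp (ζ + η) = torusExp ζ * torusExp η := by
  ext j
  simp [torusExp, Complex.exp_add]

theorem torusExp_zero : torusExp (0 : CSpace n) = 1 := by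
  ext j
  simp [torusExp]

theorem torusExp_surjective : Function.Surjective (torusExp (n := n)) := by
  intro g
  refine ⟨WithLp.toLp 2 fun j => Complex.log (g j), ?_⟩
  ext j
  simp [torusExp, Complex.exp_log]

theorem torusExp_eq_one_iff {ζ : CSpace n} :
    torusExp ζ = 1 ↔ ∀ j, ∃ k : ℤ, ζ j = k * (2 * Real.pi * Complex.I) := by
  simp only [funext_iff, torusExp, Units.ext_iff, Units.val_mk0, Pi.one_apply, Units.val_one,
    Complex.exp_eq_one_iff]

/-- The holomorphic action of `ℂⁿ` through the exponential map of the torus. -/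
def act (ζ : CSpace n) (z : M) : M := torusExp ζ • z

theorem act_add (ζ η : CSpace n) (z : M) : act (ζ + η) z = act ζ (act η z) := by
  rw [act, act, act, torusExp_add, mul_smul]

theorem act_zero (z : M) : act (0 : CSpace n) z = z := by
  rw [act, torusExp_zero, one_smul]

theorem act_comm (ζ η : CSpace n) (z : M) : act ζ (act η z) = act η (act ζ z) := by
  rw [← act_add, add_comm, act_add]

theorem act_neg_act (ζ : CSpace n) (z : M) : act (-ζ) (act ζ z) = z := by
  rw [← act_add, neg_add_cancel, act_zero]

theorem act_injective (ζ : CSpace n) : Function.Injective (act (M := M) ζ) :=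
  Function.LeftInverse.injective (act_neg_act ζ)

theorem act_mem_orbit_iff (o : M) (ζ : CSpace n) (z : M) :
    act ζ z ∈ MulAction.orbit (CTorus n) o ↔ z ∈ MulAction.orbit (CTorus n) o := by
  rw [← MulAction.orbit_eq_iff, ← MulAction.orbit_eq_iff, act, MulAction.orbit_smul]

theorem logParam_eq_act (o : M) (ζ : CSpace n) : logParam o ζ = act ζ o := rfl

theorem act_logParam (o : M) (ζ η : CSpace n) : act ζ (logParam o η) = logParam o (ζ + η) := by
  rw [logParam_eq_act, logParam_eq_act, act_add]

theorem range_logParam (o : M) : range (logParam (n := n) o) = MulAction.orbit (CTorus n) o := by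
  ext z
  constructor
  · rintro ⟨ζ, rfl⟩
    exact ⟨torusExp ζ, rfl⟩
  · rintro ⟨g, rfl⟩
    obtain ⟨ζ, rfl⟩ := torusExp_surjective g
    exact ⟨ζ, rfl⟩

variable [TopologicalSpace M] [ChartedSpace (CSpace n) M]
variable {Ω : TwoForm n M} {o : M}

theorem IsToricKaehler.contMDiff_act (hM : IsToricKaehler Ω o) :
    ContMDiff (𝓘(ℂ, CSpace n).prod 𝓘(ℂ, CSpace n)) 𝓘(ℂ, CSpace n) ω
      (fun p : CSpace n × M => act p.1 p.2) := hM.holomorphic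

theorem IsToricKaehler.continuous_act (hM : IsToricKaehler Ω o) :
    Continuous (fun p : CSpace n × M => act p.1 p.2) := hM.contMDiff_act.continuous

theorem IsToricKaehler.continuous_act_right (hM : IsToricKaehler Ω o) (ζ : CSpace n) :
    Continuous (act (M := M) ζ) := hM.continuous_act.comp (Continuous.prodMk_right ζ)

theorem IsToricKaehler.continuous_act_left (hM : IsToricKaehler Ω o) (z : M) :
    Continuous (fun ζ : CSpace n => act ζ z) := hM.continuous_act.comp (Continuous.prodMk_left z)

theorem IsToricKaehler.contMDiff_logParam (hM : IsToricKaehler Ω o) :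
    ContMDiff 𝓘(ℂ, CSpace n) 𝓘(ℂ, CSpace n) ω (logParam (n := n) o) :=
  hM.contMDiff_act.comp (contMDiff_id.prodMk contMDiff_const)

/-- The action in the preferred charts at `z` and `z'`. -/
def actChart (n : ℕ) {M : Type*} [TopologicalSpace M] [ChartedSpace (CSpace n) M]
    [MulAction (CTorus n) M] (z z' : M) (p : CSpace n × CSpace n) : CSpace n :=
  ch n z' (act p.1 ((ch n z).symm p.2))

variable [IsManifold 𝓘(ℂ, CSpace n) ω M]

theorem IsToricKaehler.contDiffAt_actChart (hM : IsToricKaehler Ω o) (z z' : M)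
    {p : CSpace n × CSpace n} (h1 : p.2 ∈ (ch n z).target)
    (h2 : act p.1 ((ch n z).symm p.2) ∈ (ch n z').source) :
    ContDiffAt ℂ ω (actChart n z z') p := by
  rw [← contMDiffAt_iff_contDiffAt]
  have hz' : ContMDiffAt 𝓘(ℂ, CSpace n) 𝓘(ℂ, CSpace n) ω (ch n z')
      (act p.1 ((ch n z).symm p.2)) :=
    contMDiffAt_of_mem_maximalAtlas (IsManifold.chart_mem_maximalAtlas z') h2
  have hz : ContMDiffAt 𝓘(ℂ, CSpace n) 𝓘(ℂ, CSpace n) ω (ch n z).symm p.2 :=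
    contMDiffAt_symm_of_mem_maximalAtlas (IsManifold.chart_mem_maximalAtlas z) h1
  have h3 : ContMDiffAt 𝓘(ℂ, CSpace n × CSpace n) (𝓘(ℂ, CSpace n).prod 𝓘(ℂ, CSpace n)) ω
      (fun q : CSpace n × CSpace n => (q.1, (ch n z).symm q.2)) p :=
    contDiff_fst.contMDiff.contMDiffAt.prodMk (hz.comp p contDiff_snd.contMDiff.contMDiffAt)
  exact hz'.comp p ((hM.contMDiff_act _).comp p h3)

end Action

/-! ### Fundamental vector fields and the open orbit -/

section Fundamental

variable {n : ℕ} {M : Type*} [TopologicalSpace M] [ChartedSpace (CSpace n) M]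
  [MulAction (CTorus n) M] [IsManifold 𝓘(ℂ, CSpace n) ω M] {Ω : TwoForm n M} {o : M}

/-- The value at `y` of the fundamental vector fields of the action, in the preferred chart at `z`. -/
def fund (n : ℕ) {M : Type*} [TopologicalSpace M] [ChartedSpace (CSpace n) M]
    [MulAction (CTorus n) M] (z : M) (y : CSpace n) : CSpace n →L[ℂ] CSpace n :=
  (fderiv ℂ (actChart n z z) (0, y)).comp (ContinuousLinearMap.inl ℂ _ _)

theorem IsToricKaehler.contDiffOn_fund (hM : IsToricKaehler Ω o) (z : M) :
    ContDiffOn ℂ ω (fund n z) (ch n z).target := by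
  intro y hy
  have h := hM.contDiffAt_actChart z z (p := (0, y)) hy
    (by rw [act_zero]; exact (ch n z).map_target hy)
  have h1 : ContDiffAt ℂ ω (fderiv ℂ (actChart n z z)) (0, y) := h.fderiv_right (by simp)
  have h2 : ContDiffAt ℂ ω (fun y' : CSpace n => fderiv ℂ (actChart n z z) (0, y')) y :=
    h1.comp y (contDiffAt_const.prodMk contDiffAt_id)
  exact (h2.clm_comp contDiffAt_const).contDiffWithinAt

theorem IsToricKaehler.hasStrictFDerivAt_act_zero (hM : IsToricKaehler Ω o) (z : M) {p : M}
    (hp : p ∈ (ch n z).source) :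
    HasStrictFDerivAt (fun ζ : CSpace n => ch n z (act ζ p)) (fund n z (ch n z p)) 0 := by
  have h := hM.contDiffAt_actChart z z (p := (0, ch n z p)) ((ch n z).map_source hp)
    (by rw [act_zero, (ch n z).left_inv hp]; exact hp)
  have h1 := (h.hasStrictFDerivAt (by simp)).comp (0 : CSpace n)
    ((hasStrictFDerivAt_id (𝕜 := ℂ) (0 : CSpace n)).prodMk (hasStrictFDerivAt_const (ch n z p) _))
  refine (h1.congr_of_eventuallyEq (.of_forall fun ζ => ?_))
  simp [actChart, (ch n z).left_inv hp]

/-- Writing exp(η)p = exp(η - ζ)(exp(ζ)p) moves the derivative at ζ to the derivative at 0 at the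
new point. -/
theorem IsToricKaehler.hasStrictFDerivAt_act (hM : IsToricKaehler Ω o) (z : M) {p : M}
    {ζ : CSpace n} (hp : act ζ p ∈ (ch n z).source) :
    HasStrictFDerivAt (fun ζ : CSpace n => ch n z (act ζ p)) (fund n z (ch n z (act ζ p))) ζ := by
  have h := hM.hasStrictFDerivAt_act_zero z hp
  have h1 : HasStrictFDerivAt (fun η : CSpace n => η - ζ) (ContinuousLinearMap.id ℂ _) ζ :=
    (hasStrictFDerivAt_id ζ).sub_const ζ
  have h2 := HasStrictFDerivAt.comp (f := fun η : CSpace n => η - ζ) ζ (by rwa [sub_self]) h1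
  refine h2.congr_of_eventuallyEq (.of_forall fun η => ?_)
  simp [← act_add]

/-- The group is commutative, so its elements carry each fundamental field to itself. -/
theorem IsToricKaehler.fderiv_actChart_fund (hM : IsToricKaehler Ω o) (z z' : M) {p : M}
    {ζ : CSpace n} (hp : p ∈ (ch n z).source) (hp' : act ζ p ∈ (ch n z').source) (ξ : CSpace n) :
    fderiv ℂ (actChart n z z') (ζ, ch n z p) (0, fund n z (ch n z p) ξ) =
      fund n z' (ch n z' (act ζ p)) ξ := by
  have h := hM.contDiffAt_actChart z z' (p := (ζ, ch n z p)) ((ch n z).map_source hp)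
    (by simpa [(ch n z).left_inv hp] using hp')
  have h0 : HasFDerivAt (actChart n z z') (fderiv ℂ (actChart n z z') (ζ, ch n z p))
      (ζ, ch n z (act (0 : CSpace n) p)) := by
    rw [act_zero]
    exact (h.differentiableAt (by simp)).hasFDerivAt
  have h1 := h0.comp (0 : CSpace n) ((hasFDerivAt_const (𝕜 := ℂ) ζ (0 : CSpace n)).prodMk
    (hM.hasStrictFDerivAt_act_zero z hp).hasFDerivAt)
  have h2 : HasFDerivAt (fun η : CSpace n => ch n z' (act η (act ζ p)))
      (fund n z' (ch n z' (act ζ p))) 0 := (hM.hasStrictFDerivAt_act_zero z' hp').hasFDerivAt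
  have h3 : (fun η : CSpace n => ch n z' (act η (act ζ p))) =ᶠ[𝓝 0]
      (actChart n z z') ∘ fun η => (ζ, ch n z (act η p)) := by
    have hc : ContinuousAt (fun η : CSpace n => act η p) 0 :=
      (hM.continuous_act_left p).continuousAt
    filter_upwards [hc.eventually ((ch n z).open_source.mem_nhds (by simpa [act_zero] using hp))] with η hη
    simp only [Function.comp, actChart, (ch n z).left_inv hη]
    rw [act_comm]
  have h4 := h2.unique (h1.congr_of_eventuallyEq h3)
  rw [h4]
  simp

theorem IsToricKaehler.hasStrictFDerivAt_logParam (hM : IsToricKaehler Ω o) (z : M)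
    {ζ : CSpace n} (hζ : logParam o ζ ∈ (ch n z).source) :
    HasStrictFDerivAt (ch n z ∘ logParam o) (fund n z (ch n z (logParam o ζ))) ζ :=
  hM.hasStrictFDerivAt_act z hζ

/-- The common zeros of fundamental vector fields are fixed points. -/
theorem IsToricKaehler.act_smul_eq_of_fund_eq_zero [T2Space M] (hM : IsToricKaehler Ω o) (z : M) {p : M}
    (hp : p ∈ (ch n z).source) {ξ : CSpace n} (h : fund n z (ch n z p) ξ = 0) (t : ℂ) :
    act (t • ξ) p = p := by
  have hc : Continuous (fun t : ℂ => act (t • ξ) p) :=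
    (hM.continuous_act_left p).comp (continuous_id.smul continuous_const)
  have hnhds : (fun t : ℂ => act (t • ξ) p) ⁻¹' (ch n z).source ∈ 𝓝 (0 : ℂ) :=
    hc.continuousAt.preimage_mem_nhds ((ch n z).open_source.mem_nhds (by simpa [act_zero] using hp))
  obtain ⟨r, hr, hball⟩ := Metric.mem_nhds_iff.1 hnhds
  have hder : ∀ t ∈ Metric.ball (0 : ℂ) r,
      HasFDerivAt (fun t : ℂ => ch n z (act (t • ξ) p)) (0 : ℂ →L[ℂ] CSpace n) t := by
    intro t ht
    have h1 := (hM.hasStrictFDerivAt_act z (hball ht)).hasFDerivAt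
    have h2 := h1.comp t (((ContinuousLinearMap.id ℂ ℂ).smulRight ξ).hasFDerivAt)
    refine h2.congr_fderiv ?_
    ext
    -- Invariance transports the zero of the field at p along the orbit, so the curve has derivative
    -- zero.
    have h3 := hM.fderiv_actChart_fund z z hp (hball ht) ξ
    rw [h, Prod.mk_zero_zero, map_zero] at h3
    simp [← h3]
  have hloc : ∀ t ∈ Metric.ball (0 : ℂ) r, act (t • ξ) p = p := by
    intro t ht
    have h1 := (convex_ball (0 : ℂ) r).is_const_of_fderivWithin_eq_zero (𝕜 := ℂ)
      (f := fun t : ℂ => ch n z (act (t • ξ) p))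
      (fun t ht => (hder t ht).differentiableAt.differentiableWithinAt)
      (fun t ht => by
        rw [fderivWithin_of_isOpen Metric.isOpen_ball ht]; exact (hder t ht).fderiv)
      ht (Metric.mem_ball_self hr)
    have h2 := (ch n z).injOn (hball ht) (hball (Metric.mem_ball_self hr)) h1
    simpa [act_zero] using h2
  -- The local statement holds for times of norm less than r; a general time t is N steps of length
  -- t / N.
  obtain ⟨N, hN⟩ := exists_nat_gt (‖t‖ / r)
  have hN0 : (0 : ℝ) < N := lt_of_le_of_lt (by positivity) hN
  have hs : act ((t / N) • ξ) p = p := hloc _ (by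
    rw [mem_ball_zero_iff, norm_div, Complex.norm_natCast, div_lt_iff₀ hN0]
    rwa [div_lt_iff₀ hr, mul_comm] at hN)
  have hk : ∀ k : ℕ, act ((k * (t / N)) • ξ) p = p := by
    intro k
    induction k with
    | zero => simp [act_zero]
    | succ k ih =>
      rw [Nat.cast_succ, add_mul, one_mul, add_smul, act_add, hs, ih]
  have := hk N
  rwa [mul_div_cancel₀ _ (by exact_mod_cast hN0.ne')] at this

theorem eq_zero_of_torusExp_smul_eq_one {ξ : CSpace n}
    (h : ∀ t : ℂ, torusExp (t • ξ) = 1) : ξ = 0 := by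
  ext j
  have h1 : ∀ t : ℂ, Complex.exp (t * ξ j) = 1 := fun t => by
    have := congrArg Units.val (congrFun (h t) j)
    simpa [torusExp] using this
  by_contra hj
  -- At this time the exponential would be e, whose norm is not 1.
  have h2 := h1 ((ξ j)⁻¹)
  rw [inv_mul_cancel₀ hj] at h2
  have h3 := congrArg norm h2
  rw [Complex.norm_exp, norm_one, Complex.one_re, Real.exp_eq_one_iff] at h3
  exact one_ne_zero h3

/-- A kernel vector generates a one-parameter group fixing p, and freeness makes that group trivial.
-/
theorem IsToricKaehler.fund_injective [T2Space M] (hM : IsToricKaehler Ω o) (z : M) {p : M}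
    (hp : p ∈ (ch n z).source) (ho : p ∈ MulAction.orbit (CTorus n) o) :
    Function.Injective (fund n z (ch n z p)) := by
  rw [injective_iff_map_eq_zero]
  intro ξ hξ
  obtain ⟨g, rfl⟩ := ho
  refine eq_zero_of_torusExp_smul_eq_one fun t => ?_
  have h := hM.act_smul_eq_of_fund_eq_zero z hp hξ t
  have h2 : (torusExp (t • ξ) * g) • o = g • o := by rw [mul_smul]; exact h
  simpa using hM.free h2

/-- By the inverse function theorem the orbit of p fills a neighbourhood of p, so it meets the dense
orbit of o, and orbits are disjoint or equal. -/
theorem IsToricKaehler.mem_orbit_of_fund_injective (hM : IsToricKaehler Ω o) (z : M) {p : M}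
    (hp : p ∈ (ch n z).source) (h : Function.Injective (fund n z (ch n z p))) :
    p ∈ MulAction.orbit (CTorus n) o := by
  let A : CSpace n ≃L[ℂ] CSpace n :=
    (LinearEquiv.ofInjectiveEndo (fund n z (ch n z p)).toLinearMap h).toContinuousLinearEquiv
  have hA : HasStrictFDerivAt (fun ζ : CSpace n => ch n z (act ζ p))
      (A : CSpace n →L[ℂ] CSpace n) 0 := hM.hasStrictFDerivAt_act_zero z hp
  have hmap := hA.map_nhds_eq_of_equiv
  rw [act_zero] at hmap
  have hcl : ∃ᶠ y in 𝓝 (ch n z p), (ch n z).symm y ∈ MulAction.orbit (CTorus n) o := by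
    rw [← (ch n z).map_nhds_eq hp, frequently_map]
    have h1 : ∃ᶠ q in 𝓝 p, q ∈ MulAction.orbit (CTorus n) o :=
      mem_closure_iff_frequently.1 (hM.dense_orbit p)
    refine (h1.and_eventually ((ch n z).open_source.mem_nhds hp)).mono ?_
    rintro q ⟨hq, hq2⟩
    rwa [(ch n z).left_inv hq2]
  rw [← hmap, frequently_map] at hcl
  have hc : ∀ᶠ η in 𝓝 (0 : CSpace n), act η p ∈ (ch n z).source :=
    (hM.continuous_act_left p).continuousAt.eventually
      ((ch n z).open_source.mem_nhds (by simpa [act_zero] using hp))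
  obtain ⟨ζ, hζ, hζ2⟩ := (hcl.and_eventually hc).exists
  rw [(ch n z).left_inv hζ2, act_mem_orbit_iff] at hζ
  exact hζ

end Fundamental

/-! ### Real and imaginary parts of vectors of ℂⁿ -/

section Vectors

variable {n : ℕ}

/-- The inclusion of `ℝⁿ` into `ℂⁿ`. -/
def rc : RSpace n →L[ℝ] CSpace n :=
  LinearMap.toContinuousLinearMap
    { toFun := fun a => cvec a 0
      map_add' := fun a b => by ext j; simp [cvec]
      map_smul' := fun c a => by ext j; simp [cvec] }

/-- The real part, as a continuous linear map. -/
def reL : CSpace n →L[ℝ] RSpace n :=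
  LinearMap.toContinuousLinearMap
    { toFun := revec
      map_add' := fun a b => by ext j; simp [revec]
      map_smul' := fun c a => by ext j; simp [revec] }

/-- The imaginary part, as a continuous linear map. -/
def imL : CSpace n →L[ℝ] RSpace n :=
  LinearMap.toContinuousLinearMap
    { toFun := fun ζ => WithLp.toLp 2 fun j => (ζ j).im
      map_add' := fun a b => by ext j; simp
      map_smul' := fun c a => by ext j; simp }

theorem rc_apply (a : RSpace n) (j : Fin n) : rc a j = (a j : ℂ) := by
  change cvec a 0 j = _
  simp [cvec]

theorem reL_apply (ζ : CSpace n) (j : Fin n) : reL ζ j = (ζ j).re := rfl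

theorem imL_apply (ζ : CSpace n) (j : Fin n) : imL ζ j = (ζ j).im := rfl

theorem cvec_eq (x θ : RSpace n) : cvec x θ = rc x + Complex.I • rc θ := by
  ext j
  simp [cvec, rc_apply]

theorem cvec_zero_left (θ : RSpace n) : cvec 0 θ = Complex.I • rc θ := by
  rw [cvec_eq, map_zero, zero_add]

@[simp] theorem reL_rc (a : RSpace n) : reL (rc a) = a := by
  ext j
  simp [reL_apply, rc_apply]

@[simp] theorem imL_rc (a : RSpace n) : imL (rc a) = 0 := by
  ext j
  simp [imL_apply, rc_apply]

@[simp] theorem reL_I_smul (ζ : CSpace n) : reL (Complex.I • ζ) = -imL ζ := by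
  ext j
  simp [reL_apply, imL_apply]

@[simp] theorem imL_I_smul (ζ : CSpace n) : imL (Complex.I • ζ) = reL ζ := by
  ext j
  simp [reL_apply, imL_apply]

theorem rc_re_add_I_smul_rc_im (ζ : CSpace n) : rc (reL ζ) + Complex.I • rc (imL ζ) = ζ := by
  ext j
  simp [reL_apply, imL_apply, rc_apply, mul_comm Complex.I]

theorem I_smul_I_smul (v : CSpace n) : Complex.I • Complex.I • v = -v := by
  rw [smul_smul, Complex.I_mul_I, neg_one_smul]

end Vectors

/-! ### Hessians on ℝⁿ and the form of a potential -/

section Hessian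

variable {n : ℕ} {ψ : RSpace n → ℝ}

/-- The Hessian of a function on `ℝⁿ`, as an endomorphism. -/
def hess (ψ : RSpace n → ℝ) (x : RSpace n) : RSpace n →L[ℝ] RSpace n := fderiv ℝ (gradient ψ) x

theorem contDiff_gradient {m k : WithTop ℕ∞} (h : ContDiff ℝ k ψ) (hmk : m + 1 ≤ k) :
    ContDiff ℝ m (gradient ψ) :=
  (InnerProductSpace.toDual ℝ (RSpace n)).symm.contDiff.comp (h.fderiv_right hmk)

theorem fderiv_eq_inner_gradient (ψ : RSpace n → ℝ) (x v : RSpace n) :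
    fderiv ℝ ψ x v = inner ℝ (gradient ψ x) v := (inner_gradient_left ..).symm

theorem inner_hess (h : ContDiff ℝ 2 ψ) (x v w : RSpace n) :
    inner ℝ (hess ψ x v) w = fderiv ℝ (fderiv ℝ ψ) x v w := by
  have hd : DifferentiableAt ℝ (fderiv ℝ ψ) x :=
    (h.fderiv_right (m := 1) (by norm_num)).differentiable (by norm_num) x
  have hg : HasFDerivAt (gradient ψ) (hess ψ x) x :=
    ((contDiff_gradient (m := 1) h (by norm_num)).differentiable (by norm_num) x).hasFDerivAt
  have h1 := hg.inner ℝ (hasFDerivAt_const w x)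
  have h2 := hd.hasFDerivAt.clm_apply (hasFDerivAt_const w x)
  have h3 : (fun y => inner ℝ (gradient ψ y) w) = fun y => fderiv ℝ ψ y w :=
    funext fun y => (fderiv_eq_inner_gradient ψ y w).symm
  rw [h3] at h1
  simpa using DFunLike.congr_fun (h1.unique h2) v

theorem hess_symm (h : ContDiff ℝ 2 ψ) (x v w : RSpace n) :
    inner ℝ (hess ψ x v) w = inner ℝ (hess ψ x w) v := by
  rw [inner_hess h, inner_hess h]
  exact (h.contDiffAt.isSymmSndFDerivAt (by simp)) v w

theorem hasFDerivAt_gradient (h : ContDiff ℝ 2 ψ) (x : RSpace n) :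
    HasFDerivAt (gradient ψ) (hess ψ x) x :=
  ((contDiff_gradient (m := 1) h (by norm_num)).differentiable (by norm_num) x).hasFDerivAt

theorem contDiff_hess {m k : WithTop ℕ∞} (h : ContDiff ℝ k ψ) (hmk : m + 1 + 1 ≤ k) :
    ContDiff ℝ m (hess ψ) :=
  (contDiff_gradient h hmk).fderiv_right le_rfl

/-- The function depends on the real part only, so its second derivative factors through `reL`; what
remains is ∑ ψ_{jk} dx_j ∧ dθ_k. -/
theorem two_mul_iddbar (h : ContDiff ℝ 2 ψ) (ζ v w : CSpace n) :
    2 * iddbar (fun η => ψ (revec η)) ζ v w =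
      inner ℝ (hess ψ (reL ζ) (reL v)) (imL w) - inner ℝ (hess ψ (reL ζ) (reL w)) (imL v) := by
  have h1 : fderiv ℝ (fun η : CSpace n => ψ (revec η)) =
      fun η => ((fderiv ℝ ψ) (reL η)).comp reL := by
    ext1 η
    exact ((h.differentiable (by norm_num) (reL η)).hasFDerivAt.comp η reL.hasFDerivAt).fderiv
  have hd : Differentiable ℝ (fderiv ℝ ψ) :=
    (h.fderiv_right (m := 1) (by norm_num)).differentiable (by norm_num)
  have h2 : ∀ v w, fderiv ℝ (fderiv ℝ (fun η : CSpace n => ψ (revec η))) ζ v w =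
      fderiv ℝ (fderiv ℝ ψ) (reL ζ) (reL v) (reL w) := by
    intro v w
    rw [h1]
    have h3 := ((hd (reL ζ)).hasFDerivAt.comp ζ reL.hasFDerivAt).clm_comp
      (hasFDerivAt_const (reL : CSpace n →L[ℝ] RSpace n) ζ)
    have h4 : fderiv ℝ (fun η : CSpace n => (fderiv ℝ ψ (reL η)).comp reL) ζ = _ := h3.fderiv
    rw [h4]
    simp
  rw [iddbar, h2, h2, ← inner_hess h, ← inner_hess h, reL_I_smul, reL_I_smul, inner_neg_right,
    inner_neg_right]
  ring

theorem strictConvexOn_of_hess_pos (h : ContDiff ℝ 2 ψ)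
    (hpos : ∀ x v, v ≠ 0 → 0 < inner ℝ (hess ψ x v) v) : StrictConvexOn ℝ univ ψ := by
  refine ⟨convex_univ, fun x _ y _ hxy a b ha hb hab => ?_⟩
  have hline : ∀ t : ℝ, HasDerivAt (fun t : ℝ => x + t • (y - x)) (y - x) t := fun t => by
    simpa using ((hasDerivAt_id t).smul_const (y - x)).const_add x
  have h1 : ∀ t : ℝ, HasDerivAt (fun t : ℝ => ψ (x + t • (y - x)))
      (inner ℝ (gradient ψ (x + t • (y - x))) (y - x)) t := fun t => by
    rw [← fderiv_eq_inner_gradient]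
    exact (h.differentiable (by norm_num) _).hasFDerivAt.comp_hasDerivAt t (hline t)
  have h2 : ∀ t : ℝ, HasDerivAt (fun t : ℝ => inner ℝ (gradient ψ (x + t • (y - x))) (y - x))
      (inner ℝ (hess ψ (x + t • (y - x)) (y - x)) (y - x)) t := fun t => by
    have := ((hasFDerivAt_gradient h _).comp_hasDerivAt t (hline t)).inner ℝ
      (hasDerivAt_const t (y - x))
    simpa using this
  have hf1 : deriv (fun t : ℝ => ψ (x + t • (y - x))) =
      fun t => inner ℝ (gradient ψ (x + t • (y - x))) (y - x) := funext fun t => (h1 t).deriv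
  have hconv : StrictConvexOn ℝ univ (fun t : ℝ => ψ (x + t • (y - x))) := by
    refine strictConvexOn_univ_of_deriv2_pos
      (continuous_iff_continuousAt.2 fun t => (h1 t).continuousAt) fun t => ?_
    rw [Function.iterate_succ, Function.iterate_one, Function.comp, hf1, (h2 t).deriv]
    exact hpos _ _ (sub_ne_zero.2 hxy.symm)
  have h3 := hconv.2 (mem_univ (0 : ℝ)) (mem_univ (1 : ℝ)) zero_ne_one ha hb hab
  have h4 : x + b • (y - x) = a • x + b • y := by
    rw [← eq_sub_iff_add_eq] at hab
    rw [hab]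
    module
  simpa [h4] using h3

end Hessian

/-! ### The Kähler form in logarithmic coordinates -/

section OrbitForm

variable {n : ℕ} {M : Type*} [TopologicalSpace M] [ChartedSpace (CSpace n) M]
  [MulAction (CTorus n) M]

/-- The pull-back of a two-form to the logarithmic coordinates of the open orbit. -/
def orbForm (Ω : TwoForm n M) (o : M) (ζ : CSpace n) : CSpace n →L[ℝ] CSpace n →L[ℝ] ℝ :=
  (formChart Ω (logParam o ζ) (ch n (logParam o ζ) (logParam o ζ))).bilinearComp
    ((fund n (logParam o ζ) (ch n (logParam o ζ) (logParam o ζ))).restrictScalars ℝ)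
    ((fund n (logParam o ζ) (ch n (logParam o ζ) (logParam o ζ))).restrictScalars ℝ)

/-- The pull-back of a two-form under a map into `M`. -/
def pullForm (Ω : TwoForm n M) {E' : Type*} [NormedAddCommGroup E'] [NormedSpace ℝ E']
    (g : E' → M) (p v w : E') : ℝ :=
  Ω (g p) ![mfderiv 𝓘(ℝ, E') 𝓘(ℝ, CSpace n) g p v, mfderiv 𝓘(ℝ, E') 𝓘(ℝ, CSpace n) g p w]

variable [IsManifold 𝓘(ℂ, CSpace n) ω M] {Ω : TwoForm n M} {o : M}

theorem IsKaehlerForm.formChart_I_I (hΩ : IsKaehlerForm Ω) (z : M)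
    {y : CSpace n} (hy : y ∈ (ch n z).target) (v w : CSpace n) :
    formChart Ω z y (Complex.I • v) (Complex.I • w) = formChart Ω z y v w := by
  rw [formChart_apply, formChart_apply, mfderiv_symm_chart_I_smul z hy,
    mfderiv_symm_chart_I_smul z hy]
  exact hΩ.invariant _ _ _

/-- The point y is kept separate and all vectors are read in `CSpace n`, so that the base point can
be replaced without a mismatch of tangent space types. -/
theorem mfderiv_eq_symm_chart_of_eq {E' : Type*} [NormedAddCommGroup E'] [NormedSpace ℝ E']
    {g : E' → M} {p : E'} (z : M) (hg : MDifferentiableAt 𝓘(ℝ, E') 𝓘(ℝ, CSpace n) g p)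
    (hp : g p ∈ (ch n z).source) {y : CSpace n} (hy : ch n z (g p) = y) (v : E') :
    (mfderiv 𝓘(ℝ, E') 𝓘(ℝ, CSpace n) g p v : CSpace n) =
      (mfderiv 𝓘(ℝ, CSpace n) 𝓘(ℝ, CSpace n) (ch n z).symm y
        (fderiv ℝ (ch n z ∘ g) p v : CSpace n) : CSpace n) := by
  subst hy
  exact mfderiv_eq_symm_chart z hg hp v

theorem IsToricKaehler.mdifferentiable_logParam (hM : IsToricKaehler Ω o) :
    MDifferentiable 𝓘(ℝ, CSpace n) 𝓘(ℝ, CSpace n) (logParam (n := n) o) := fun ζ =>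
  (contMDiffAt_real (hM.contMDiff_logParam ζ)).mdifferentiableAt (by simp)

theorem IsToricKaehler.contMDiff_act_right (hM : IsToricKaehler Ω o) (ζ : CSpace n) :
    ContMDiff 𝓘(ℂ, CSpace n) 𝓘(ℂ, CSpace n) ω (act (M := M) ζ) :=
  hM.contMDiff_act.comp (contMDiff_const.prodMk contMDiff_id)

theorem IsToricKaehler.mdifferentiable_act_right (hM : IsToricKaehler Ω o) (ζ : CSpace n) :
    MDifferentiable 𝓘(ℝ, CSpace n) 𝓘(ℝ, CSpace n) (act (M := M) ζ) := fun z =>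
  (contMDiffAt_real (hM.contMDiff_act_right ζ z)).mdifferentiableAt (by simp)

theorem IsToricKaehler.fderiv_logParam (hM : IsToricKaehler Ω o) (z : M)
    {ζ : CSpace n} (hζ : logParam o ζ ∈ (ch n z).source) :
    fderiv ℝ (ch n z ∘ logParam o) ζ =
      (fund n z (ch n z (logParam o ζ))).restrictScalars ℝ :=
  ((hM.hasStrictFDerivAt_logParam z hζ).hasFDerivAt.restrictScalars ℝ).fderiv

theorem IsToricKaehler.pullForm_logParam (hM : IsToricKaehler Ω o) (z : M)
    {ζ : CSpace n} (hζ : logParam o ζ ∈ (ch n z).source) (v w : CSpace n) :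
    pullForm Ω (logParam o) ζ v w = formChart Ω z (ch n z (logParam o ζ))
      (fund n z (ch n z (logParam o ζ)) v) (fund n z (ch n z (logParam o ζ)) w) := by
  rw [pullForm, form_mfderiv Ω z (hM.mdifferentiable_logParam ζ) hζ, hM.fderiv_logParam z hζ]
  rfl

theorem IsToricKaehler.orbForm_eq_pullForm (hM : IsToricKaehler Ω o) (ζ v w : CSpace n) :
    orbForm Ω o ζ v w = pullForm Ω (logParam o) ζ v w :=
  (hM.pullForm_logParam (logParam o ζ) (mem_chart_source _ _) v w).symm

theorem IsToricKaehler.orbForm_eq_formChart (hM : IsToricKaehler Ω o) (z : M)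
    {ζ : CSpace n} (hζ : logParam o ζ ∈ (ch n z).source) (v w : CSpace n) :
    orbForm Ω o ζ v w = formChart Ω z (ch n z (logParam o ζ))
      (fund n z (ch n z (logParam o ζ)) v) (fund n z (ch n z (logParam o ζ)) w) := by
  rw [hM.orbForm_eq_pullForm, hM.pullForm_logParam z hζ]

theorem IsToricKaehler.orbForm_I_I (hM : IsToricKaehler Ω o) (ζ v w : CSpace n) :
    orbForm Ω o ζ (Complex.I • v) (Complex.I • w) = orbForm Ω o ζ v w := by
  have h := mem_chart_source (CSpace n) (logParam o ζ)
  rw [hM.orbForm_eq_formChart _ h, hM.orbForm_eq_formChart _ h, (fund n _ _).map_smul, (fund n _ _).map_smul,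
    hM.kaehler.formChart_I_I _ ((ch n _).map_source h)]

theorem logParam_mem_orbit (o : M) (ζ : CSpace n) :
    logParam o ζ ∈ MulAction.orbit (CTorus n) o := ⟨torusExp ζ, rfl⟩

theorem IsToricKaehler.orbForm_pos [T2Space M] (hM : IsToricKaehler Ω o) (ζ : CSpace n)
    {v : CSpace n} (hv : v ≠ 0) : 0 < orbForm Ω o ζ v (Complex.I • v) := by
  have h := mem_chart_source (CSpace n) (logParam o ζ)
  rw [hM.orbForm_eq_formChart _ h, (fund n _ _).map_smul]
  refine hM.kaehler.formChart_pos _ ((ch n _).map_source h) fun h0 => hv ?_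
  exact hM.fund_injective _ h (logParam_mem_orbit o ζ) (h0.trans (map_zero _).symm)

theorem orbForm_self (ζ v : CSpace n) : orbForm Ω o ζ v v = 0 :=
  formChart_self _ _ _ _

theorem orbForm_neg_swap (ζ v w : CSpace n) : orbForm Ω o ζ v w = -orbForm Ω o ζ w v := by
  have h := orbForm_self (Ω := Ω) (o := o) ζ (v + w)
  simp only [map_add, add_apply, orbForm_self] at h
  linarith

/-- An imaginary translation of logarithmic coordinates is the action of an element of the real
torus, which is an isometry of the form. -/
theorem IsToricKaehler.orbForm_add_imag (hM : IsToricKaehler Ω o) (ζ : CSpace n) (θ : RSpace n)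
    (v w : CSpace n) : orbForm Ω o (ζ + cvec 0 θ) v w = orbForm Ω o ζ v w := by
  rw [hM.orbForm_eq_pullForm, hM.orbForm_eq_pullForm]
  have h1 : pullForm Ω (logParam o ∘ fun η => η + cvec 0 θ) ζ v w =
      pullForm Ω (logParam o) (ζ + cvec 0 θ) v w := by
    have hs : HasMFDerivAt 𝓘(ℝ, CSpace n) 𝓘(ℝ, CSpace n) (fun η : CSpace n => η + cvec 0 θ) ζ
        (ContinuousLinearMap.id ℝ (CSpace n)) :=
      ((hasFDerivAt_id ζ).add_const (cvec 0 θ)).hasMFDerivAt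
    have h2 := ((hM.mdifferentiable_logParam (ζ + cvec 0 θ)).hasMFDerivAt.comp ζ hs).mfderiv
    rw [pullForm, h2]
    rfl
  have h3 : (logParam o ∘ fun η => η + cvec 0 θ) = act (cvec 0 θ) ∘ logParam o := by
    ext1 η
    simp only [Function.comp]
    rw [act_logParam, add_comm]
  have h4 : pullForm Ω (act (cvec 0 θ) ∘ logParam o) ζ v w = pullForm Ω (logParam o) ζ v w := by
    have h2 := ((hM.mdifferentiable_act_right (cvec 0 θ) _).hasMFDerivAt.comp ζ
      (hM.mdifferentiable_logParam ζ).hasMFDerivAt).mfderiv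
    rw [pullForm, h2]
    exact hM.isometric θ (logParam o ζ) _ _
  rw [← h1, h3, h4]

theorem IsToricKaehler.angleField_eq (hM : IsToricKaehler Ω o) (z : M) {y : CSpace n}
    (hy : y ∈ (ch n z).target) (j : Fin n) :
    (angleField j ((ch n z).symm y) : CSpace n) =
      (mfderiv 𝓘(ℝ, CSpace n) 𝓘(ℝ, CSpace n) (ch n z).symm y
        (fund n z y (Complex.I • rc (EuclideanSpace.single j (1 : ℝ))) : CSpace n) : CSpace n) := by
  set p := (ch n z).symm y with hp
  have hps : p ∈ (ch n z).source := (ch n z).map_target hy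
  let c : ℝ →L[ℝ] CSpace n :=
    (ContinuousLinearMap.id ℝ ℝ).smulRight (Complex.I • rc (EuclideanSpace.single j (1 : ℝ)))
  have hc : ∀ t : ℝ, cvec 0 (t • EuclideanSpace.single j (1 : ℝ)) = c t := fun t => by
    rw [cvec_zero_left, map_smul, smul_comm]
    rfl
  have hfun : (fun t : ℝ => torusExp (cvec 0 (t • EuclideanSpace.single j (1 : ℝ))) • p) =
      fun t => act (c t) p := by
    ext1 t
    rw [hc]
    rfl
  have h0 : act (c 0) p = p := by rw [map_zero, act_zero]
  have hF : HasFDerivAt (fun t : ℝ => ch n z (act (c t) p))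
      (((fund n z y).restrictScalars ℝ).comp c) 0 := by
    have h1 := hM.hasStrictFDerivAt_act_zero z hps
    rw [hp, (ch n z).right_inv hy, ← hp] at h1
    have h2 : HasFDerivAt (fun ζ : CSpace n => ch n z (act ζ p))
        ((fund n z y).restrictScalars ℝ) (c 0) := by
      rw [map_zero]
      exact h1.hasFDerivAt.restrictScalars ℝ
    exact h2.comp (0 : ℝ) c.hasFDerivAt
  have hmd : MDifferentiableAt 𝓘(ℝ, ℝ) 𝓘(ℝ, CSpace n) (fun t : ℝ => act (c t) p) 0 := by
    rw [mdifferentiableAt_iff_chart z (by simpa only [h0] using hps)]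
    exact ⟨((hM.continuous_act_left p).comp c.continuous).continuousAt, hF.differentiableAt⟩
  have h := mfderiv_eq_symm_chart_of_eq z hmd (by simpa only [h0] using hps)
    (y := y) (by rw [h0, hp, (ch n z).right_inv hy]) (1 : ℝ)
  rw [show fderiv ℝ (ch n z ∘ fun t : ℝ => act (c t) p) 0 = _ from hF.fderiv] at h
  change (mfderiv 𝓘(ℝ, ℝ) 𝓘(ℝ, CSpace n)
    (fun t : ℝ => torusExp (cvec 0 (t • EuclideanSpace.single j (1 : ℝ))) • p) 0 (1 : ℝ) :
      CSpace n) = _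
  rw [hfun]
  refine h.trans ?_
  simp [c]
  rfl

end OrbitForm

/-! ### Moment map, isotropy of torus orbits and existence of potentials -/

section MomentMap

variable {n : ℕ} {M : Type*} [TopologicalSpace M] [ChartedSpace (CSpace n) M]
  [MulAction (CTorus n) M] [IsManifold 𝓘(ℂ, CSpace n) ω M] {Ω : TwoForm n M} {o : M}

/-- The differential of a moment map in a chart. -/
theorem IsToricKaehler.fderiv_moment_chart (hM : IsToricKaehler Ω o) {j : Fin n} {μ : M → ℝ}
    (hμ : ContMDiff 𝓘(ℝ, CSpace n) 𝓘(ℝ, ℝ) ∞ μ)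
    (hμΩ : ∀ (z : M) (v : TangentSpace 𝓘(ℝ, CSpace n) z),
      Ω z ![angleField j z, v] = - mfderiv 𝓘(ℝ, CSpace n) 𝓘(ℝ, ℝ) μ z v)
    (z : M) {y : CSpace n} (hy : y ∈ (ch n z).target) (v : CSpace n) :
    fderiv ℝ (μ ∘ (ch n z).symm) y v =
      -formChart Ω z y (fund n z y (Complex.I • rc (EuclideanSpace.single j (1 : ℝ)))) v := by
  have h1 : fderiv ℝ (μ ∘ (ch n z).symm) y =
      (mfderiv 𝓘(ℝ, CSpace n) 𝓘(ℝ, ℝ) μ ((ch n z).symm y)).comp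
        (mfderiv 𝓘(ℝ, CSpace n) 𝓘(ℝ, CSpace n) (ch n z).symm y) := by
    rw [← mfderiv_eq_fderiv]
    exact mfderiv_comp y (hμ.mdifferentiable (by simp) _)
      ((chart_mdifferentiable (n := n) z).mdifferentiableAt_symm hy)
  have h2 := hμΩ ((ch n z).symm y) (mfderiv 𝓘(ℝ, CSpace n) 𝓘(ℝ, CSpace n) (ch n z).symm y v)
  rw [h1, formChart_apply]
  have h3 := hM.angleField_eq z hy j
  rw [eq_neg_iff_add_eq_zero, add_comm, ← eq_neg_iff_add_eq_zero]
  refine Eq.trans ?_ h2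
  congr 2
  exact h3.symm

theorem IsToricKaehler.hasFDerivAt_comp_logParam (hM : IsToricKaehler Ω o) (z : M) {H : M → ℝ}
    {ζ : CSpace n} (hζ : logParam o ζ ∈ (ch n z).source)
    (hd : DifferentiableAt ℝ (H ∘ (ch n z).symm) (ch n z (logParam o ζ))) :
    HasFDerivAt (H ∘ logParam o)
      ((fderiv ℝ (H ∘ (ch n z).symm) (ch n z (logParam o ζ))).comp
        ((fund n z (ch n z (logParam o ζ))).restrictScalars ℝ)) ζ := by
  have h2 := hd.hasFDerivAt.comp ζ
    ((hM.hasStrictFDerivAt_logParam z hζ).hasFDerivAt.restrictScalars ℝ)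
  refine h2.congr_of_eventuallyEq ?_
  filter_upwards [(hM.mdifferentiable_logParam ζ).continuousAt.eventually
    ((ch n z).open_source.mem_nhds hζ)] with η hη
  simp [(ch n z).left_inv hη]

theorem contDiffAt_comp_chart_symm {m : WithTop ℕ∞} {H : M → ℝ}
    (hH : ContMDiff 𝓘(ℝ, CSpace n) 𝓘(ℝ, ℝ) m H) (z : M) {y : CSpace n}
    (hy : y ∈ (ch n z).target) : ContDiffAt ℝ m (H ∘ (ch n z).symm) y := by
  rw [← contMDiffAt_iff_contDiffAt]
  have : IsManifold 𝓘(ℝ, CSpace n) ω M := isManifold_real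
  have hz : ContMDiffAt 𝓘(ℝ, CSpace n) 𝓘(ℝ, CSpace n) ω (ch n z).symm y :=
    contMDiffAt_symm_of_mem_maximalAtlas (IsManifold.chart_mem_maximalAtlas z) hy
  exact (hH _).comp y (hz.of_le le_top)

theorem IsToricKaehler.contDiff_comp_logParam (hM : IsToricKaehler Ω o) {m : WithTop ℕ∞} {H : M → ℝ}
    (hH : ContMDiff 𝓘(ℝ, CSpace n) 𝓘(ℝ, ℝ) m H) : ContDiff ℝ m (H ∘ logParam (n := n) o) := by
  rw [← contMDiff_iff_contDiff]
  intro ζ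
  exact (hH _).comp ζ ((contMDiffAt_real (hM.contMDiff_logParam ζ)).of_le le_top)

theorem IsToricKaehler.fderiv_moment_logParam (hM : IsToricKaehler Ω o) {j : Fin n} {μ : M → ℝ}
    (hμ : ContMDiff 𝓘(ℝ, CSpace n) 𝓘(ℝ, ℝ) ∞ μ)
    (hμΩ : ∀ (z : M) (v : TangentSpace 𝓘(ℝ, CSpace n) z),
      Ω z ![angleField j z, v] = - mfderiv 𝓘(ℝ, CSpace n) 𝓘(ℝ, ℝ) μ z v)
    (ζ v : CSpace n) :
    fderiv ℝ (μ ∘ logParam o) ζ v =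
      -orbForm Ω o ζ (Complex.I • rc (EuclideanSpace.single j (1 : ℝ))) v := by
  have h := mem_chart_source (CSpace n) (logParam o ζ)
  rw [hM.orbForm_eq_formChart _ h, (hM.hasFDerivAt_comp_logParam _ h
    ((contDiffAt_comp_chart_symm hμ _ ((ch n _).map_source h)).differentiableAt (by simp))).fderiv,
    ← hM.fderiv_moment_chart hμ hμΩ _ ((ch n _).map_source h)]
  rfl

theorem logParam_add_two_pi (o : M) (ζ : CSpace n) (k : Fin n) :
    logParam o (ζ + (2 * Real.pi) • Complex.I • rc (EuclideanSpace.single k (1 : ℝ))) =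
      logParam o ζ := by
  rw [logParam, logParam, torusExp_add]
  have : torusExp ((2 * Real.pi) • Complex.I • rc (EuclideanSpace.single k (1 : ℝ))) =
      (1 : CTorus n) := by
    rw [torusExp_eq_one_iff]
    intro j
    by_cases hjk : j = k
    · exact ⟨1, by simp [rc_apply, hjk]⟩
    · exact ⟨0, by simp [rc_apply, hjk]⟩
  rw [this, mul_one]

theorem eq_sum_single (a : RSpace n) :
    a = ∑ j, a j • EuclideanSpace.single j (1 : ℝ) := by
  ext i
  simp [Finset.sum_apply, Pi.single_apply]

theorem I_smul_rc_eq_sum (a : RSpace n) :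
    Complex.I • rc a = ∑ j, a j • Complex.I • rc (EuclideanSpace.single j (1 : ℝ)) := by
  conv_lhs => rw [eq_sum_single a]
  simp only [map_sum, map_smul, Finset.smul_sum]
  exact Finset.sum_congr rfl fun j _ => smul_comm _ _ _

/-- The orbits of the real torus are isotropic. -/
theorem IsToricKaehler.orbForm_imag_imag (hM : IsToricKaehler Ω o) (ζ : CSpace n) (a b : RSpace n) :
    orbForm Ω o ζ (Complex.I • rc a) (Complex.I • rc b) = 0 := by
  obtain ⟨μ, hμ⟩ := hM.hamiltonian
  have key : ∀ j k : Fin n, orbForm Ω o ζ (Complex.I • rc (EuclideanSpace.single j (1 : ℝ)))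
      (Complex.I • rc (EuclideanSpace.single k (1 : ℝ))) = 0 := by
    intro j k
    set ek := Complex.I • rc (EuclideanSpace.single k (1 : ℝ)) with hek
    set c := orbForm Ω o ζ (Complex.I • rc (EuclideanSpace.single j (1 : ℝ))) ek with hc
    -- Torus invariance makes the derivative of μ_j along the k-th circle the constant -c. Since μ_j
    -- returns to its value after time 2π, c = 0.
    have hd : ∀ t : ℝ, HasDerivAt (fun t : ℝ => (μ j ∘ logParam o) (ζ + t • ek)) (-c) t := by
      intro t
      have h1 : HasDerivAt (fun t : ℝ => ζ + t • ek) ek t := by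
        simpa using ((hasDerivAt_id t).smul_const ek).const_add ζ
      have h2 := ((hM.contDiff_comp_logParam (hμ j).1).differentiable (by simp)
        (ζ + t • ek)).hasFDerivAt.comp_hasDerivAt t h1
      rw [hM.fderiv_moment_logParam (hμ j).1 (hμ j).2] at h2
      have h3 : t • ek = cvec 0 (t • EuclideanSpace.single k (1 : ℝ)) := by
        rw [cvec_zero_left, map_smul, smul_comm]
      rwa [h3, hM.orbForm_add_imag, ← hc] at h2
    have h4 : ∀ t : ℝ, HasDerivAt
        (fun t : ℝ => (μ j ∘ logParam o) (ζ + t • ek) + t * c) 0 t := fun t => by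
      have := (hd t).fun_add ((hasDerivAt_id' t).mul_const c)
      rwa [one_mul, neg_add_cancel] at this
    have h5 := is_const_of_deriv_eq_zero (fun t => (h4 t).differentiableAt)
      (fun t => (h4 t).deriv) 0 (2 * Real.pi)
    simp only [Function.comp, hek, logParam_add_two_pi] at h5
    simpa [Real.pi_ne_zero] using h5
  rw [I_smul_rc_eq_sum a, I_smul_rc_eq_sum b]
  simp only [map_sum, map_smul, sum_apply, smul_apply, key, smul_zero, Finset.sum_const_zero]

/-- J-invariance turns two real directions into two directions tangent to an isotropic torus orbit.
-/
theorem IsToricKaehler.orbForm_real_real (hM : IsToricKaehler Ω o) (ζ : CSpace n) (a b : RSpace n) :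
    orbForm Ω o ζ (rc a) (rc b) = 0 := by
  rw [← hM.orbForm_I_I, hM.orbForm_imag_imag]

/-- Since real-real and imaginary-imaginary blocks vanish and the form is invariant under imaginary
translations, only the mixed block at real points survives. -/
theorem IsToricKaehler.orbForm_eq (hM : IsToricKaehler Ω o) (ζ v w : CSpace n) :
    orbForm Ω o ζ v w = orbForm Ω o (rc (reL ζ)) (rc (reL v)) (Complex.I • rc (imL w)) -
      orbForm Ω o (rc (reL ζ)) (rc (reL w)) (Complex.I • rc (imL v)) := by
  have h : orbForm Ω o ζ v w = orbForm Ω o (rc (reL ζ)) v w := by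
    conv_lhs => rw [← rc_re_add_I_smul_rc_im ζ, ← cvec_zero_left, hM.orbForm_add_imag]
  rw [h]
  conv_lhs => rw [← rc_re_add_I_smul_rc_im v, ← rc_re_add_I_smul_rc_im w]
  simp only [map_add, add_apply, hM.orbForm_real_real, hM.orbForm_imag_imag]
  rw [orbForm_neg_swap _ (Complex.I • rc (imL v))]
  ring

/-- J-invariance combined with antisymmetry. This symmetry of the mixed block is the integrability
condition for the potential. -/
theorem IsToricKaehler.orbForm_real_imag_symm (hM : IsToricKaehler Ω o) (ζ : CSpace n)
    (a b : RSpace n) :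
    orbForm Ω o ζ (rc a) (Complex.I • rc b) = orbForm Ω o ζ (rc b) (Complex.I • rc a) := by
  rw [← hM.orbForm_I_I, I_smul_I_smul, map_neg, orbForm_neg_swap, neg_neg]

/-- The moment map on the open orbit, in logarithmic coordinates. -/
def momentLog (μ : Fin n → M → ℝ) (o : M) (x : RSpace n) : RSpace n :=
  WithLp.toLp 2 fun j => μ j (logParam o (rc x))

theorem IsToricKaehler.contDiff_momentLog (hM : IsToricKaehler Ω o) {μ : Fin n → M → ℝ}
    (hμ : ∀ j, ContMDiff 𝓘(ℝ, CSpace n) 𝓘(ℝ, ℝ) ∞ (μ j)) : ContDiff ℝ ∞ (momentLog (n := n) μ o) := by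
  rw [contDiff_euclidean]
  intro j
  exact (hM.contDiff_comp_logParam (hμ j)).comp rc.contDiff

theorem IsToricKaehler.inner_fderiv_momentLog (hM : IsToricKaehler Ω o) {μ : Fin n → M → ℝ}
    (hμ : ∀ j, ContMDiff 𝓘(ℝ, CSpace n) 𝓘(ℝ, ℝ) ∞ (μ j) ∧
      ∀ (z : M) (v : TangentSpace 𝓘(ℝ, CSpace n) z),
      Ω z ![angleField j z, v] = - mfderiv 𝓘(ℝ, CSpace n) 𝓘(ℝ, ℝ) (μ j) z v)
    (x v w : RSpace n) :
    inner ℝ (fderiv ℝ (momentLog μ o) x v) w =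
      orbForm Ω o (rc x) (rc v) (Complex.I • rc w) := by
  have hj : ∀ j, fderiv ℝ (momentLog μ o) x v j =
      orbForm Ω o (rc x) (rc v) (Complex.I • rc (EuclideanSpace.single j (1 : ℝ))) := by
    intro j
    have h1 := ((hM.contDiff_momentLog fun j => (hμ j).1).differentiable (by simp) x).hasFDerivAt
    have h2 := (hasFDerivWithinAt_euclidean.1 h1.hasFDerivWithinAt) j |>.hasFDerivAt Filter.univ_mem
    have h3 := ((hM.contDiff_comp_logParam (hμ j).1).differentiable (by simp)
        (rc x)).hasFDerivAt.comp x rc.hasFDerivAt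
    have h4 := DFunLike.congr_fun (h2.unique h3) v
    have h5 := hM.fderiv_moment_logParam (hμ j).1 (hμ j).2 (rc x) (rc v)
    rw [orbForm_neg_swap, ← h5]
    exact h4
  rw [I_smul_rc_eq_sum w]
  simp only [map_sum, map_smul, ← hj, PiLp.inner_apply]
  rfl

/-- Open-orbit potentials exist. -/
theorem IsToricKaehler.exists_potential [T2Space M] (hM : IsToricKaehler Ω o) :
    ∃ ψ : RSpace n → ℝ, IsOpenOrbitPotential Ω o ψ := by
  obtain ⟨μ, hμ⟩ := hM.hamiltonian
  have hm := hM.contDiff_momentLog fun j => (hμ j).1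
  have hd : Differentiable ℝ fun x => innerSL ℝ (momentLog μ o x) :=
    (innerSL ℝ).differentiable.comp (hm.differentiable (by simp))
  have hfd : ∀ x v w, fderiv ℝ (fun x => innerSL ℝ (momentLog μ o x)) x v w =
      orbForm Ω o (rc x) (rc v) (Complex.I • rc w) := by
    intro x v w
    rw [← hM.inner_fderiv_momentLog hμ]
    have h1 : HasFDerivAt (fun x => innerSL ℝ (momentLog μ o x))
        ((innerSL ℝ).comp (fderiv ℝ (momentLog μ o) x)) x :=
      (innerSL ℝ).hasFDerivAt.comp x (hm.differentiable (by simp) x).hasFDerivAt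
    rw [h1.fderiv]
    rfl
  -- The moment map, read as a one-form on ℝⁿ, is closed by the symmetry of the mixed block, hence
  -- exact; a primitive is the potential.
  obtain ⟨ψ, hψ⟩ := convex_univ.exists_forall_hasFDerivAt_of_fderiv_symmetric isOpen_univ
    hd.differentiableOn (fun x _ v w => by rw [hfd, hfd, hM.orbForm_real_imag_symm])
  have hgrad : gradient ψ = momentLog μ o := by
    ext1 x
    refine HasGradientAt.gradient ?_
    rw [hasGradientAt_iff_hasFDerivAt]
    exact hψ x (mem_univ x)
  have hsmooth : ContDiff ℝ ∞ ψ := by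
    rw [contDiff_infty_iff_fderiv]
    refine ⟨fun x => (hψ x (mem_univ x)).differentiableAt, ?_⟩
    have : fderiv ℝ ψ = fun x => innerSL ℝ (momentLog μ o x) :=
      funext fun x => (hψ x (mem_univ x)).fderiv
    rw [this]
    exact (innerSL ℝ).contDiff.comp hm
  have hh : ∀ x v w, inner ℝ (hess ψ x v) w = orbForm Ω o (rc x) (rc v) (Complex.I • rc w) := by
    intro x v w
    rw [← hM.inner_fderiv_momentLog hμ, hess, hgrad]
  have h2 : ContDiff ℝ 2 ψ := hsmooth.of_le (WithTop.coe_le_coe.2 le_top)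
  refine ⟨ψ, hsmooth, strictConvexOn_of_hess_pos h2 fun x v hv => ?_, fun ζ v w => ?_⟩
  · rw [hh]
    refine hM.orbForm_pos _ fun h => hv ?_
    rw [← reL_rc v, h, map_zero]
  · rw [two_mul_iddbar h2, hh, hh, ← hM.orbForm_eq, hM.orbForm_eq_pullForm]
    rfl

namespace IsOpenOrbitPotential

variable {ψ : RSpace n → ℝ}

theorem contDiff_two (hψ : IsOpenOrbitPotential Ω o ψ) : ContDiff ℝ 2 ψ :=
  hψ.smooth.of_le (WithTop.coe_le_coe.2 le_top)

theorem orbForm_eq_hess (hψ : IsOpenOrbitPotential Ω o ψ) (hM : IsToricKaehler Ω o)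
    (ζ v w : CSpace n) :
    orbForm Ω o ζ v w = inner ℝ (hess ψ (reL ζ) (reL v)) (imL w) -
      inner ℝ (hess ψ (reL ζ) (reL w)) (imL v) := by
  rw [← two_mul_iddbar hψ.contDiff_two, hM.orbForm_eq_pullForm]
  exact hψ.potential ζ v w

theorem inner_hess_eq (hψ : IsOpenOrbitPotential Ω o ψ) (hM : IsToricKaehler Ω o)
    (x v w : RSpace n) :
    inner ℝ (hess ψ x v) w = orbForm Ω o (rc x) (rc v) (Complex.I • rc w) := by
  rw [hψ.orbForm_eq_hess hM]
  simp

theorem inner_hess_pos [T2Space M] (hψ : IsOpenOrbitPotential Ω o ψ) (hM : IsToricKaehler Ω o)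
    (x : RSpace n) {v : RSpace n} (hv : v ≠ 0) : 0 < inner ℝ (hess ψ x v) v := by
  rw [hψ.inner_hess_eq hM]
  refine hM.orbForm_pos _ fun h => hv ?_
  rw [← reL_rc v, h, map_zero]

/-- The gradient and the moment map have the same derivative, so they differ by a constant, and the
moment map is bounded on the compact manifold. The bound serves the properness estimate in
`exists_shiftForm_pos`. -/
theorem exists_gradient_bound [CompactSpace M] (hψ : IsOpenOrbitPotential Ω o ψ)
    (hM : IsToricKaehler Ω o) : ∃ C, ∀ x, ‖gradient ψ x‖ ≤ C := by
  obtain ⟨μ, hμ⟩ := hM.hamiltonian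
  have hm := hM.contDiff_momentLog fun j => (hμ j).1
  have hdm : Differentiable ℝ (momentLog μ o) := hm.differentiable (by simp)
  have hgd : ∀ x, HasFDerivAt (gradient ψ) (hess ψ x) x := hasFDerivAt_gradient hψ.contDiff_two
  have hz : ∀ x, HasFDerivAt (fun x => gradient ψ x - momentLog μ o x)
      (0 : RSpace n →L[ℝ] RSpace n) x := by
    intro x
    refine ((hgd x).fun_sub (hdm x).hasFDerivAt).congr_fderiv ?_
    ext1 v
    refine ext_inner_right ℝ fun w => ?_
    rw [sub_apply, inner_sub_left, hψ.inner_hess_eq hM, hM.inner_fderiv_momentLog hμ]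
    simp
  have hconst := is_const_of_fderiv_eq_zero (fun x => (hz x).differentiableAt)
    (fun x => (hz x).fderiv)
  let P : M → RSpace n := fun z => WithLp.toLp 2 fun j => μ j z
  have hP : Continuous P :=
    (PiLp.continuous_toLp 2 _).comp (continuous_pi fun j => (hμ j).1.continuous)
  obtain ⟨C, hC⟩ := (isCompact_range hP).isBounded.exists_norm_le
  refine ⟨C + ‖gradient ψ 0 - momentLog μ o 0‖, fun x => ?_⟩
  have h1 : gradient ψ x = momentLog μ o x + (gradient ψ 0 - momentLog μ o 0) := by
    rw [← hconst x 0]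
    abel
  rw [h1]
  exact (norm_add_le _ _).trans (by gcongr; exact hC _ ⟨_, rfl⟩)

end IsOpenOrbitPotential

end MomentMap

/-! ### The Hamiltonian vector field in charts and on the open orbit -/

section HamiltonianField

variable {n : ℕ} {M : Type*} [TopologicalSpace M] [ChartedSpace (CSpace n) M]
  [MulAction (CTorus n) M] [IsManifold 𝓘(ℂ, CSpace n) ω M] {Ω : TwoForm n M} {o : M}

theorem IsKaehlerForm.formChart_injective (hΩ : IsKaehlerForm Ω) (z : M) {y : CSpace n}
    (hy : y ∈ (ch n z).target) : Function.Injective (formChart Ω z y) := by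
  rw [injective_iff_map_eq_zero]
  intro v hv
  by_contra h
  have := hΩ.formChart_pos z hy h
  rw [hv] at this
  simp at this

theorem IsKaehlerForm.exists_equiv_formChart (hΩ : IsKaehlerForm Ω) (z : M) {y : CSpace n}
    (hy : y ∈ (ch n z).target) :
    ∃ B : CSpace n ≃L[ℝ] (CSpace n →L[ℝ] ℝ), (B : CSpace n →L[ℝ] (CSpace n →L[ℝ] ℝ)) =
      formChart Ω z y := by
  have hdim : Module.finrank ℝ (CSpace n) = Module.finrank ℝ (CSpace n →L[ℝ] ℝ) := by
    rw [← Subspace.dual_finrank_eq (K := ℝ) (V := CSpace n)]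
    exact LinearEquiv.finrank_eq (LinearMap.toContinuousLinearMap (𝕜 := ℝ) (E := CSpace n))
  refine ⟨(LinearMap.linearEquivOfInjective (formChart Ω z y).toLinearMap
    (hΩ.formChart_injective z hy) hdim).toContinuousLinearEquiv, ?_⟩
  ext v w
  rfl

/-- The Hamiltonian vector field of `H` in the preferred chart at `z`. -/
def hamChart (Ω : TwoForm n M) (H : M → ℝ) (z : M) (y : CSpace n) : CSpace n :=
  (formChart Ω z y).inverse (fderiv ℝ (H ∘ (ch n z).symm) y)

theorem IsKaehlerForm.formChart_hamChart (hΩ : IsKaehlerForm Ω) (H : M → ℝ) (z : M)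
    {y : CSpace n} (hy : y ∈ (ch n z).target) :
    formChart Ω z y (hamChart Ω H z y) = fderiv ℝ (H ∘ (ch n z).symm) y := by
  obtain ⟨B, hB⟩ := hΩ.exists_equiv_formChart z hy
  rw [hamChart, ← hB, ContinuousLinearMap.inverse_equiv]
  exact B.apply_symm_apply _

theorem IsKaehlerForm.eq_hamChart (hΩ : IsKaehlerForm Ω) (H : M → ℝ) (z : M)
    {y : CSpace n} (hy : y ∈ (ch n z).target) {v : CSpace n}
    (hv : formChart Ω z y v = fderiv ℝ (H ∘ (ch n z).symm) y) : v = hamChart Ω H z y :=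
  hΩ.formChart_injective z hy (hv.trans (hΩ.formChart_hamChart H z hy).symm)

theorem IsKaehlerForm.contDiffOn_hamChart (hΩ : IsKaehlerForm Ω) {H : M → ℝ}
    (hH : ContMDiff 𝓘(ℝ, CSpace n) 𝓘(ℝ, ℝ) 3 H) (z : M) :
    ContDiffOn ℝ 2 (hamChart Ω H z) (ch n z).target := by
  intro y hy
  obtain ⟨B, hB⟩ := hΩ.exists_equiv_formChart z hy
  have h1 : ContDiffAt ℝ 2 (formChart Ω z) y :=
    ((hΩ.contDiffOn_formChart z).contDiffAt ((ch n z).open_target.mem_nhds hy)).of_le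
      (WithTop.coe_le_coe.2 le_top)
  have h2 : ContDiffAt ℝ 2 (fun y => (formChart Ω z y).inverse) y := by
    have := contDiffAt_map_inverse (𝕜 := ℝ) (n := 2) B
    rw [hB] at this
    exact this.comp y h1
  have h3 : ContDiffAt ℝ 2 (fderiv ℝ (H ∘ (ch n z).symm)) y :=
    (contDiffAt_comp_chart_symm hH z hy).fderiv_right (by norm_num)
  exact (h2.clm_apply h3).contDiffWithinAt

/-- The vector field `i X`, for the Hamiltonian vector field `X` of `H`, in a chart. -/
def gradChart (Ω : TwoForm n M) (H : M → ℝ) (z : M) (y : CSpace n) : CSpace n :=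
  Complex.I • hamChart Ω H z y

theorem IsKaehlerForm.contDiffOn_gradChart (hΩ : IsKaehlerForm Ω) {H : M → ℝ}
    (hH : ContMDiff 𝓘(ℝ, CSpace n) 𝓘(ℝ, ℝ) 3 H) (z : M) :
    ContDiffOn ℝ 2 (gradChart Ω H z) (ch n z).target :=
  (hΩ.contDiffOn_hamChart hH z).const_smul Complex.I

theorem hamChart_eq (Ω : TwoForm n M) (H : M → ℝ) (z : M) (y : CSpace n) :
    hamChart Ω H z y = -(Complex.I • gradChart Ω H z y) := by
  rw [gradChart, I_smul_I_smul, neg_neg]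

theorem comp_logParam_eq {H : M → ℝ} (hinv : IsTorusInvariant (n := n) H) (ζ : CSpace n) :
    H (logParam o ζ) = onOpenOrbit o H (reL ζ) := by
  have h : logParam o ζ = act (cvec 0 (imL ζ)) (logParam o (rc (reL ζ))) := by
    rw [act_logParam, cvec_zero_left, add_comm, rc_re_add_I_smul_rc_im]
  rw [h]
  exact hinv _ _

theorem IsToricKaehler.contDiff_onOpenOrbit (hM : IsToricKaehler Ω o) {m : WithTop ℕ∞} {H : M → ℝ}
    (hH : ContMDiff 𝓘(ℝ, CSpace n) 𝓘(ℝ, ℝ) m H) : ContDiff ℝ m (onOpenOrbit (n := n) o H) :=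
  (hM.contDiff_comp_logParam hH).comp rc.contDiff

namespace IsOpenOrbitPotential

variable {ψ : RSpace n → ℝ}

theorem exists_equiv_hess [T2Space M] (hψ : IsOpenOrbitPotential Ω o ψ) (hM : IsToricKaehler Ω o)
    (x : RSpace n) :
    ∃ B : RSpace n ≃L[ℝ] RSpace n, (B : RSpace n →L[ℝ] RSpace n) = hess ψ x := by
  have hinj : Function.Injective (hess ψ x) := by
    rw [injective_iff_map_eq_zero]
    intro v hv
    by_contra h
    have := hψ.inner_hess_pos hM x h
    rw [hv] at this
    simp at this
  refine ⟨(LinearEquiv.ofInjectiveEndo (hess ψ x).toLinearMap hinj).toContinuousLinearEquiv, ?_⟩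
  ext v
  rfl

theorem hess_hessianInvGrad [T2Space M] (hψ : IsOpenOrbitPotential Ω o ψ)
    (hM : IsToricKaehler Ω o) (h : RSpace n → ℝ) (x : RSpace n) :
    hess ψ x (hessianInvGrad ψ h x) = gradient h x := by
  obtain ⟨B, hB⟩ := hψ.exists_equiv_hess hM x
  change _ = fderiv ℝ (gradient ψ) x at hB
  rw [hessianInvGrad, hess, ← hB, ContinuousLinearMap.inverse_equiv]
  exact B.apply_symm_apply _

theorem contDiff_hessianInvGrad [T2Space M] (hψ : IsOpenOrbitPotential Ω o ψ)
    (hM : IsToricKaehler Ω o) {h : RSpace n → ℝ} (hh : ContDiff ℝ 3 h) :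
    ContDiff ℝ 2 (hessianInvGrad ψ h) := by
  rw [contDiff_iff_contDiffAt]
  intro x
  obtain ⟨B, hB⟩ := hψ.exists_equiv_hess hM x
  have h1 : ContDiffAt ℝ 2 (hess ψ) x :=
    ((contDiff_hess (m := 2) (k := 4) (hψ.smooth.of_le (WithTop.coe_le_coe.2 le_top))
      (by norm_num)).contDiffAt)
  have h2 : ContDiffAt ℝ 2 (fun x => (hess ψ x).inverse) x := by
    have := contDiffAt_map_inverse (𝕜 := ℝ) (n := 2) B
    rw [hB] at this
    exact this.comp x h1
  exact h2.clm_apply (contDiff_gradient hh (by norm_num)).contDiffAt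

/-- On the open orbit, `i X` is the fundamental vector field of `(∇²ψ)⁻¹ ∇h`. -/
theorem gradChart_eq [T2Space M] (hψ : IsOpenOrbitPotential Ω o ψ) (hM : IsToricKaehler Ω o)
    {H : M → ℝ} (hH : ContMDiff 𝓘(ℝ, CSpace n) 𝓘(ℝ, ℝ) 3 H)
    (hinv : IsTorusInvariant (n := n) H) (z : M) {ζ : CSpace n}
    (hζ : logParam o ζ ∈ (ch n z).source) :
    gradChart Ω H z (ch n z (logParam o ζ)) = fund n z (ch n z (logParam o ζ))
      (rc (hessianInvGrad ψ (onOpenOrbit o H) (reL ζ))) := by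
  have hy := (ch n z).map_source hζ
  set y := ch n z (logParam o ζ) with hy_def
  set a := hessianInvGrad ψ (onOpenOrbit o H) (reL ζ) with ha
  have hinj := hM.fund_injective z hζ (logParam_mem_orbit o ζ)
  have hsurj : Function.Surjective (fund n z y) :=
    (LinearMap.injective_iff_surjective (f := (fund n z y).toLinearMap)).1 hinj
  -- By nondegeneracy it suffices to pair with an arbitrary vector. On the open orbit every vector
  -- is fundamental, so the claim becomes ∇²ψ a = ∇h in logarithmic coordinates.
  have key : -(fund n z y (Complex.I • rc a)) = hamChart Ω H z y := by
    refine hM.kaehler.eq_hamChart H z hy ?_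
    ext1 v
    obtain ⟨w, rfl⟩ := hsurj v
    rw [map_neg, neg_apply, ← hM.orbForm_eq_formChart z hζ, hψ.orbForm_eq_hess hM]
    have h1 := hM.hasFDerivAt_comp_logParam z hζ
      ((contDiffAt_comp_chart_symm hH z hy).differentiableAt (by norm_num))
    have h2 : H ∘ logParam o = onOpenOrbit o H ∘ reL := funext fun η => comp_logParam_eq hinv η
    rw [h2] at h1
    have h3 := (((hM.contDiff_onOpenOrbit hH).differentiable (by norm_num)
      (reL ζ)).hasFDerivAt.comp ζ reL.hasFDerivAt)
    have h4 := DFunLike.congr_fun (h1.unique h3) w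
    have h5 : fderiv ℝ (H ∘ (ch n z).symm) y (fund n z y w) =
        fderiv ℝ (onOpenOrbit o H) (reL ζ) (reL w) := h4
    rw [h5, fderiv_eq_inner_gradient, ← hψ.hess_hessianInvGrad hM, hess_symm hψ.contDiff_two,
      hess_symm hψ.contDiff_two]
    simpa [ha] using hess_symm hψ.contDiff_two _ _ _
  rw [gradChart, ← key, (fund n z y).map_smul, smul_neg, I_smul_I_smul, neg_neg]

end IsOpenOrbitPotential
end HamiltonianField

/-! ### Integrals of analytic families over a compact parameter space -/

section ParametricIntegral

open MeasureTheory

variable {K : Type*} [TopologicalSpace K] [CompactSpace K] [SecondCountableTopology K]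
  [MeasurableSpace K] [BorelSpace K] (μ : Measure K) [IsFiniteMeasure μ]
  {R : Type} [NormedAddCommGroup R] [NormedSpace ℂ R]
  {E : Type} [NormedAddCommGroup E] [NormedSpace ℂ E]

/-- A family of functions on an open set, which locally is the pull-back of an analytic function
under a continuous map of the parameter. -/
def IsAnalyticFamily (R : Type) [NormedAddCommGroup R] [NormedSpace ℂ R]
    {G : Type} [NormedAddCommGroup G] [NormedSpace ℂ G] (U : Set E) (f : K → E → G) : Prop :=
  ∀ t₀, ∀ y₀ ∈ U, ∃ (ϑ : K → R) (g : R × E → G), ContinuousAt ϑ t₀ ∧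
    ContDiffAt ℂ ω g (ϑ t₀, y₀) ∧ ∀ᶠ p in 𝓝 (t₀, y₀), f p.1 p.2 = g (ϑ p.1, p.2)

variable {U : Set E} {G : Type} [NormedAddCommGroup G] [NormedSpace ℂ G] {f : K → E → G}

theorem IsAnalyticFamily.continuousAt (h : IsAnalyticFamily R U f) (t : K) {y : E} (hy : y ∈ U) :
    ContinuousAt (fun p : K × E => f p.1 p.2) (t, y) := by
  obtain ⟨ϑ, g, hϑ, hg, hfg⟩ := h t y hy
  refine ContinuousAt.congr ?_ (hfg.mono fun p hp => hp.symm)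
  have h1 : ContinuousAt (fun p : K × E => (ϑ p.1, p.2)) (t, y) :=
    (ContinuousAt.comp (x := (t, y)) (f := Prod.fst) hϑ continuousAt_fst).prodMk continuousAt_snd
  exact ContinuousAt.comp (x := (t, y)) (g := g) hg.continuousAt h1

theorem IsAnalyticFamily.differentiableAt (h : IsAnalyticFamily R U f) (t : K) {y : E}
    (hy : y ∈ U) : DifferentiableAt ℂ (f t) y := by
  obtain ⟨ϑ, g, hϑ, hg, hfg⟩ := h t y hy
  have h1 : DifferentiableAt ℂ (fun y' => g (ϑ t, y')) y :=
    (hg.differentiableAt (by simp)).comp y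
      ((differentiableAt_const _).prodMk differentiableAt_id)
  refine h1.congr_of_eventuallyEq ?_
  have h2 : Tendsto (fun y' : E => (t, y')) (𝓝 y) (𝓝 (t, y)) :=
    (Continuous.prodMk_right t).continuousAt
  exact h2.eventually hfg

/-- The partial derivative of the local analytic model is again an analytic model with the same ϑ.
This stability is what makes the induction in `contDiffOn_integral` run. -/
theorem IsAnalyticFamily.fderiv (h : IsAnalyticFamily R U f) :
    IsAnalyticFamily R U (fun t => fderiv ℂ (f t)) := by
  intro t y hy
  obtain ⟨ϑ, g, hϑ, hg, hfg⟩ := h t y hy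
  refine ⟨ϑ, fun p => (_root_.fderiv ℂ g p).comp (ContinuousLinearMap.inr ℂ R E), hϑ,
    (hg.fderiv_right (m := ω) (by simp)).clm_comp contDiffAt_const, ?_⟩
  have hg' : ∀ᶠ q in 𝓝 (ϑ t, y), DifferentiableAt ℂ g q :=
    (hg.eventually (by simp)).mono fun q hq => hq.differentiableAt (by simp)
  have h1 : ContinuousAt (fun p : K × E => (ϑ p.1, p.2)) (t, y) :=
    (ContinuousAt.comp (x := (t, y)) (f := Prod.fst) hϑ continuousAt_fst).prodMk continuousAt_snd
  filter_upwards [h1.eventually hg', eventually_eventually_nhds.2 hfg] with p hp hp2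
  have h2 : HasFDerivAt (fun y' => g (ϑ p.1, y'))
      ((_root_.fderiv ℂ g (ϑ p.1, p.2)).comp (ContinuousLinearMap.inr ℂ R E)) p.2 :=
    hp.hasFDerivAt.comp p.2 ((hasFDerivAt_const _ _).prodMk (hasFDerivAt_id _))
  have h3 : f p.1 =ᶠ[𝓝 p.2] fun y' => g (ϑ p.1, y') := by
    have h4 : Tendsto (fun y' : E => (p.1, y')) (𝓝 p.2) (𝓝 p) :=
      (Continuous.prodMk_right p.1).continuousAt
    exact h4.eventually hp2
  exact (h2.congr_of_eventuallyEq h3).fderiv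

theorem IsAnalyticFamily.continuous_param (h : IsAnalyticFamily R U f) {y : E} (hy : y ∈ U) :
    Continuous (fun t => f t y) :=
  continuous_iff_continuousAt.2 fun t =>
    (h.continuousAt t hy).comp (x := t) (f := fun t => (t, y))
      (Continuous.prodMk_left y).continuousAt

theorem integrable_of_continuous_compact {G' : Type*} [NormedAddCommGroup G'] {g : K → G'} (hg : Continuous g) : Integrable g μ := by
  obtain ⟨C, hC⟩ := (isCompact_range hg).isBounded.exists_norm_le
  exact (integrable_const C).mono' hg.aestronglyMeasurable (.of_forall fun t => hC _ ⟨t, rfl⟩)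

/-- Compactness of the parameter space makes the bound on the derivatives uniform near y, so
differentiation under the integral applies with a constant majorant. -/
theorem IsAnalyticFamily.hasFDerivAt_integral (h : IsAnalyticFamily R U f) (hU : IsOpen U) {y : E}
    (hy : y ∈ U) :
    HasFDerivAt (fun y => ∫ t, f t y ∂μ) (∫ t, _root_.fderiv ℂ (f t) y ∂μ) y := by
  obtain ⟨C, hC⟩ := (isCompact_range (h.fderiv.continuous_param hy)).isBounded.exists_norm_le
  have hb : ∀ᶠ y' in 𝓝 y, ∀ t ∈ (univ : Set K), ‖_root_.fderiv ℂ (f t) y'‖ ≤ C + 1 := by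
    refine isCompact_univ.eventually_forall_of_forall_eventually fun t _ => ?_
    have h1 := (h.fderiv.continuousAt t hy).norm
    have h2 : ∀ᶠ p : K × E in 𝓝 (t, y), ‖_root_.fderiv ℂ (f p.1) p.2‖ < C + 1 :=
      h1.eventually_lt continuousAt_const
        (lt_of_le_of_lt (hC _ ⟨t, rfl⟩) (lt_add_one C))
    exact (continuous_swap.continuousAt (x := (y, t))).eventually
      (h2.mono fun p hp => hp.le)
  have hs := hb.and (hU.mem_nhds hy)
  refine hasFDerivAt_integral_of_dominated_of_fderiv_le (bound := fun _ => C + 1) hs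
    ?_ (integrable_of_continuous_compact μ (h.continuous_param hy))
    (h.fderiv.continuous_param hy).aestronglyMeasurable
    (.of_forall fun t y' hy' => hy'.1 t (mem_univ t)) (integrable_const _)
    (.of_forall fun t y' hy' => (h.differentiableAt t hy'.2).hasFDerivAt)
  filter_upwards [hU.mem_nhds hy] with y' hy'
  exact (h.continuous_param hy').aestronglyMeasurable

/-- Induction on m: the derivative of the integral is the integral of the family of derivatives. The
target space is quantified inside because it changes at each step. -/
theorem IsAnalyticFamily.contDiffOn_integral (hU : IsOpen U) (m : ℕ) :
    ∀ {G : Type} [NormedAddCommGroup G] [NormedSpace ℂ G] {f : K → E → G},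
      IsAnalyticFamily R U f → ContDiffOn ℂ m (fun y => ∫ t, f t y ∂μ) U := by
  induction m with
  | zero =>
    intro G _ _ f h
    refine contDiffOn_zero.2 fun y hy => ?_
    exact (h.hasFDerivAt_integral μ hU hy).continuousAt.continuousWithinAt
  | succ m ih =>
    intro G _ _ f h
    rw [Nat.cast_succ, contDiffOn_succ_iff_fderiv_of_isOpen hU]
    refine ⟨fun y hy => (h.hasFDerivAt_integral μ hU hy).differentiableAt.differentiableWithinAt,
      by simp, ?_⟩
    exact (ih h.fderiv).congr fun y hy => (h.hasFDerivAt_integral μ hU hy).fderiv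

end ParametricIntegral

/-! ### Fourier coefficients on closed subgroups of the compact torus -/

section Characters

open MeasureTheory

variable {n : ℕ}

/-- The characters of the compact torus. -/
def torusChar (w : Fin n → ℤ) : (Fin n → Circle) →* Circle where
  toFun t := ∏ j, t j ^ w j
  map_one' := by simp
  map_mul' s t := by simp [mul_zpow, Finset.prod_mul_distrib]

theorem continuous_torusChar (w : Fin n → ℤ) : Continuous (torusChar w) := by
  change Continuous fun t : Fin n → Circle => ∏ j, t j ^ w j
  exact continuous_finsetProd _ fun j _ => (continuous_apply j).zpow (w j)

theorem torusChar_zero (t : Fin n → Circle) : torusChar 0 t = 1 := by simp [torusChar]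

theorem torusChar_add (w w' : Fin n → ℤ) (t : Fin n → Circle) :
    torusChar (w + w') t = torusChar w t * torusChar w' t := by
  simp [torusChar, zpow_add, Finset.prod_mul_distrib]

theorem torusChar_neg (w : Fin n → ℤ) (t : Fin n → Circle) :
    torusChar (-w) t = (torusChar w t)⁻¹ := by
  simp [torusChar]

variable (K : Subgroup (Fin n → Circle))

/-- The characters of the torus as continuous functions on a subgroup. -/
def charOn (w : Fin n → ℤ) : C(K, ℂ) where
  toFun t := torusChar w t
  continuous_toFun := continuous_subtype_val.comp
    ((continuous_torusChar w).comp continuous_subtype_val)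

/-- The algebra generated by the characters. -/
def charAlgebra : StarSubalgebra ℂ C(K, ℂ) where
  toSubalgebra := Algebra.adjoin ℂ (range (charOn K))
  star_mem' := by
    change Algebra.adjoin ℂ (range (charOn K)) ≤ star (Algebra.adjoin ℂ (range (charOn K)))
    refine Algebra.adjoin_le ?_
    rintro _ ⟨w, rfl⟩
    refine Algebra.subset_adjoin ⟨-w, ?_⟩
    ext1 x
    change ((torusChar (-w) (x : Fin n → Circle) : Circle) : ℂ) = starRingEnd ℂ (torusChar w x : Circle)
    rw [torusChar_neg, Circle.coe_inv_eq_conj]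

/-- Products of characters are characters, so the generated algebra is already the linear span. -/
theorem charAlgebra_coe : (charAlgebra K).toSubalgebra.toSubmodule =
    Submodule.span ℂ (range (charOn K)) := by
  apply Algebra.adjoin_eq_span_of_subset
  refine .trans (fun x ↦ Submonoid.closure_induction (fun _ ↦ id) ⟨0, ?_⟩ ?_)
    Submodule.subset_span
  · ext z
    simp [charOn, torusChar_zero]
  · rintro _ _ _ _ ⟨m, rfl⟩ ⟨n, rfl⟩
    refine ⟨m + n, ?_⟩
    ext z
    simp [charOn, torusChar_add]

theorem charAlgebra_separatesPoints : (charAlgebra K).SeparatesPoints := by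
  classical
  intro s t hst
  have hst' : (s : Fin n → Circle) ≠ t := fun h => hst (Subtype.ext h)
  rw [Ne, funext_iff, not_forall] at hst'
  obtain ⟨i, hi⟩ := hst'
  refine ⟨_, ⟨charOn K (Pi.single i 1), Algebra.subset_adjoin ⟨Pi.single i 1, rfl⟩, rfl⟩, ?_⟩
  have h : ∀ t : Fin n → Circle, torusChar (Pi.single i 1) t = t i := fun t => by
    change ∏ j, t j ^ (Pi.single i 1 : Fin n → ℤ) j = t i
    rw [Finset.prod_eq_single i]
    · simp
    · intro j _ hj
      simp [hj]
    · simp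
  change ((torusChar (Pi.single i 1) s : Circle) : ℂ) ≠ (torusChar (Pi.single i 1) t : Circle)
  rw [h, h, Ne, Circle.coe_inj]
  exact hi

variable [CompactSpace K]

/-- A continuous function on a compact subgroup of the torus, all of whose Fourier coefficients
vanish, is zero. -/
theorem eq_zero_of_integral_char_eq_zero [MeasurableSpace K] [BorelSpace K] (μ : Measure K)
    [IsFiniteMeasure μ] [μ.IsOpenPosMeasure] (φ : C(K, ℂ))
    (h : ∀ w, ∫ t, charOn K w t * φ t ∂μ = 0) : φ = 0 := by
  let Λ : C(K, ℂ) →ₗ[ℂ] ℂ :=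
    { toFun := fun g => ∫ t, g t * φ t ∂μ
      map_add' := fun g g' => by
        simp only [ContinuousMap.add_apply, add_mul]
        exact integral_add (integrable_of_continuous_compact μ (g.continuous.mul φ.continuous))
          (integrable_of_continuous_compact μ (g'.continuous.mul φ.continuous))
      map_smul' := fun c g => by
        simp only [ContinuousMap.smul_apply, smul_eq_mul, mul_assoc, RingHom.id_apply]
        exact integral_const_mul _ _ }
  -- The functional g ↦ ∫ gφ kills the characters, hence their span, hence by Stone–Weierstrass and
  -- continuity every function.
  have hΛ : ∀ g ∈ (charAlgebra K), Λ g = 0 := by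
    intro g hg
    have hg' : g ∈ Submodule.span ℂ (range (charOn K)) := by
      rw [← charAlgebra_coe]
      exact hg
    have hle : Submodule.span ℂ (range (charOn K)) ≤ LinearMap.ker Λ := by
      rw [Submodule.span_le]
      rintro _ ⟨w, rfl⟩
      exact h w
    exact hle hg'
  have hbound : ∀ g, ‖Λ g‖ ≤ (‖φ‖ * μ.real univ) * ‖g‖ := by
    intro g
    have := norm_integral_le_of_norm_le_const (μ := μ) (f := fun t => g t * φ t) (C := ‖g‖ * ‖φ‖)
      (.of_forall fun t => by
        rw [norm_mul]
        exact mul_le_mul (g.norm_coe_le_norm t) (φ.norm_coe_le_norm t) (norm_nonneg _)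
          (norm_nonneg _))
    calc ‖Λ g‖ ≤ _ := this
      _ = _ := by ring
  have hcont : Continuous Λ := (LinearMap.mkContinuous Λ _ hbound).continuous
  have hall : ∀ g, Λ g = 0 := by
    intro g
    have hd : Dense ((charAlgebra K : StarSubalgebra ℂ C(K, ℂ)) : Set C(K, ℂ)) := by
      have h1 := ContinuousMap.starSubalgebra_topologicalClosure_eq_top_of_separatesPoints
        (charAlgebra K) (charAlgebra_separatesPoints K)
      rw [dense_iff_closure_eq, ← StarSubalgebra.topologicalClosure_coe, h1]
      rfl
    have h2 : (Λ : C(K, ℂ) → ℂ) = fun _ => (0 : ℂ) :=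
      Continuous.ext_on hd hcont continuous_const hΛ
    exact congrFun h2 g
  -- Testing against the conjugate gives ∫ |φ|² = 0, and the measure charges every nonempty open
  -- set.
  have h1 := hall (star φ)
  have h2 : ∫ t, ‖φ t‖ ^ 2 ∂μ = 0 := by
    have h3 : ∀ t, (star φ) t * φ t = ((‖φ t‖ ^ 2 : ℝ) : ℂ) := fun t => by
      rw [ContinuousMap.star_apply, Complex.star_def, Complex.conj_mul']
      push_cast
      rfl
    have h4 : Λ (star φ) = ((∫ t, ‖φ t‖ ^ 2 ∂μ : ℝ) : ℂ) := by
      change ∫ t, (star φ) t * φ t ∂μ = _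
      simp_rw [h3]
      exact integral_ofReal
    rw [h4] at h1
    exact_mod_cast h1
  have hc : Continuous fun t => ‖φ t‖ ^ 2 := φ.continuous.norm.pow 2
  rw [integral_eq_zero_iff_of_nonneg (fun t => by positivity)
    (integrable_of_continuous_compact μ hc)] at h2
  have h5 := (hc.ae_eq_iff_eq μ continuous_zero).1 h2
  ext t
  have := congrFun h5 t
  simpa using this

end Characters

/-! ### Coordinates diagonalizing the infinitesimal stabilizer of a point -/

section WeightCoordinates

open MeasureTheory

variable {n : ℕ}

/-- The inclusion of the compact torus into the complex torus. -/
def toCTorus : (Fin n → Circle) →* CTorus n where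
  toFun t j := Circle.toUnits (t j)
  map_one' := by ext j; simp
  map_mul' s t := by ext j; simp

/-- A logarithm on the compact torus, continuous near `t₀`. -/
def torusArg (t₀ t : Fin n → Circle) : RSpace n :=
  WithLp.toLp 2 fun j => Complex.arg (t₀ j) + Complex.arg ((t j / t₀ j : Circle) : ℂ)

theorem toCTorus_eq_torusExp (t₀ t : Fin n → Circle) :
    toCTorus t = torusExp (Complex.I • rc (torusArg t₀ t)) := by
  ext j
  have h : (t j : ℂ) = Complex.exp (Complex.arg (t₀ j) * Complex.I) *
      Complex.exp (Complex.arg ((t j / t₀ j : Circle) : ℂ) * Complex.I) := by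
    have h1 : ∀ c : Circle, Complex.exp (Complex.arg (c : ℂ) * Complex.I) = c := fun c => by
      have := Complex.norm_mul_exp_arg_mul_I (c : ℂ)
      rwa [Circle.norm_coe, Complex.ofReal_one, one_mul] at this
    rw [h1, h1, ← Circle.coe_mul, mul_div_cancel]
  simp only [toCTorus, MonoidHom.coe_mk, OneHom.coe_mk, Circle.toUnits_apply, Units.val_mk0,
    torusExp, PiLp.smul_apply, rc_apply, torusArg, smul_eq_mul]
  rw [h, ← Complex.exp_add]
  congr 1
  push_cast
  ring

/-- At t = t₀ the quotient t / t₀ is 1, away from the branch cut of the argument; the base argument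
of t₀ is a constant. -/
theorem continuousAt_torusArg (t₀ : Fin n → Circle) : ContinuousAt (torusArg t₀) t₀ := by
  refine (PiLp.continuous_toLp 2 _).continuousAt.comp (continuousAt_pi.2 fun j => ?_)
  refine continuousAt_const.add ?_
  have h1 : ContinuousAt (fun t : Fin n → Circle => ((t j / t₀ j : Circle) : ℂ)) t₀ :=
    (continuous_subtype_val.comp ((continuous_apply j).div_const _)).continuousAt
  refine ContinuousAt.comp (f := fun t : Fin n → Circle => ((t j / t₀ j : Circle) : ℂ))
    (g := Complex.arg) (Complex.continuousAt_arg ?_) h1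
  simp

variable {M : Type*} [TopologicalSpace M] [ChartedSpace (CSpace n) M]
  [MulAction (CTorus n) M] [IsManifold 𝓘(ℂ, CSpace n) ω M] {Ω : TwoForm n M} {o : M}

theorem IsToricKaehler.continuous_toCTorus_smul (hM : IsToricKaehler Ω o) :
    Continuous fun p : (Fin n → Circle) × M => toCTorus p.1 • p.2 := by
  rw [continuous_iff_continuousAt]
  rintro ⟨t₀, z⟩
  have h : (fun p : (Fin n → Circle) × M => toCTorus p.1 • p.2) =
      (fun p : CSpace n × M => act p.1 p.2) ∘
        fun p : (Fin n → Circle) × M => (Complex.I • rc (torusArg t₀ p.1), p.2) := by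
    ext1 p
    simp only [Function.comp, act, ← toCTorus_eq_torusExp]
  rw [h]
  refine hM.continuous_act.continuousAt.comp (ContinuousAt.prodMk ?_ continuousAt_snd)
  exact (rc.continuous.const_smul Complex.I).continuousAt.comp
    (ContinuousAt.comp (x := (t₀, z)) (f := Prod.fst) (continuousAt_torusArg t₀) continuousAt_fst)

/-- The stabilizer of a point in the compact torus. -/
def compactStab (n : ℕ) {M : Type*} [MulAction (CTorus n) M] (z : M) : Subgroup (Fin n → Circle) :=
  (MulAction.stabilizer (CTorus n) z).comap toCTorus

theorem mem_compactStab {z : M} {t : Fin n → Circle} :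
    t ∈ compactStab n z ↔ toCTorus t • z = z := Iff.rfl

theorem IsToricKaehler.compactSpace_compactStab [T2Space M] (hM : IsToricKaehler Ω o) (z : M) :
    CompactSpace (compactStab n z) := by
  refine isCompact_iff_compactSpace.1 (IsClosed.isCompact ?_)
  exact isClosed_eq (hM.continuous_toCTorus_smul.comp (Continuous.prodMk_left z)) continuous_const

/-- The points of a chart at `z` which the stabilizer of `z` does not move out of the chart. -/
def stabDomain (n : ℕ) {M : Type*} [TopologicalSpace M] [ChartedSpace (CSpace n) M]
    [MulAction (CTorus n) M] (z : M) : Set (CSpace n) :=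
  {y | y ∈ (ch n z).target ∧ ∀ t : compactStab n z,
    toCTorus (t : Fin n → Circle) • (ch n z).symm y ∈ (ch n z).source}

theorem mem_stabDomain_self (z : M) : ch n z z ∈ stabDomain n z := by
  refine ⟨mem_chart_target _ z, fun t => ?_⟩
  rw [(ch n z).left_inv (mem_chart_source _ z), mem_compactStab.1 t.2]
  exact mem_chart_source _ z

theorem IsToricKaehler.isOpen_stabDomain [T2Space M] (hM : IsToricKaehler Ω o) (z : M) :
    IsOpen (stabDomain n z) := by
  have := hM.compactSpace_compactStab z
  rw [isOpen_iff_mem_nhds]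
  rintro y ⟨hy, hyt⟩
  have h1 : ∀ᶠ y' in 𝓝 y, ∀ t ∈ (univ : Set (compactStab n z)),
      toCTorus (t : Fin n → Circle) • (ch n z).symm y' ∈ (ch n z).source := by
    refine isCompact_univ.eventually_forall_of_forall_eventually fun t _ => ?_
    have hc : ContinuousAt (fun p : CSpace n × compactStab n z =>
        toCTorus (p.2 : Fin n → Circle) • (ch n z).symm p.1) (y, t) := by
      have h2 : ContinuousAt (fun p : CSpace n × compactStab n z =>
          ((p.2 : Fin n → Circle), (ch n z).symm p.1)) (y, t) :=
        (continuous_subtype_val.comp continuous_snd).continuousAt.prodMk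
          (ContinuousAt.comp (x := (y, t)) (f := Prod.fst) (g := (ch n z).symm)
            ((ch n z).continuousAt_symm hy) continuousAt_fst)
      exact hM.continuous_toCTorus_smul.continuousAt.comp h2
    exact hc.eventually ((ch n z).open_source.mem_nhds (hyt t))
  filter_upwards [h1, (ch n z).open_target.mem_nhds hy] with y' h2 h3
  exact ⟨h3, fun t => h2 t (mem_univ t)⟩

/-- Weighted components of the action of the stabilizer, in a chart. -/
def stabComponent (z : M) (w : Fin n → ℤ) (l : Fin n) (t : compactStab n z) (y : CSpace n) : ℂ :=
  charOn (compactStab n z) (-w) t * ch n z (toCTorus (t : Fin n → Circle) • (ch n z).symm y) l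

/-- The parameter space consists of a local logarithm of t and the value of the character. In terms
of these the component is analytic, because the action of ℂⁿ is. -/
theorem IsToricKaehler.isAnalyticFamily_stabComponent (hM : IsToricKaehler Ω o) (z : M)
    (w : Fin n → ℤ) (l : Fin n) :
    IsAnalyticFamily (CSpace n × ℂ) (stabDomain n z) (stabComponent z w l) := by
  rintro t₀ y₀ ⟨hy₀, hyt⟩
  refine ⟨fun t => (Complex.I • rc (torusArg t₀ t), charOn (compactStab n z) (-w) t),
    fun p => p.1.2 * actChart n z z (p.1.1, p.2) l, ?_, ?_, .of_forall fun p => ?_⟩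
  · refine ContinuousAt.prodMk ?_ (charOn (compactStab n z) (-w)).continuous.continuousAt
    exact (rc.continuous.const_smul Complex.I).continuousAt.comp
      ((continuousAt_torusArg (t₀ : Fin n → Circle)).comp continuous_subtype_val.continuousAt)
  · have h1 := hM.contDiffAt_actChart z z (p := (Complex.I • rc (torusArg t₀ t₀), y₀)) hy₀ (by
      rw [act, ← toCTorus_eq_torusExp]
      exact hyt t₀)
    have h2 : ContDiffAt ℂ ω (fun p : (CSpace n × ℂ) × CSpace n => actChart n z z (p.1.1, p.2))
        ((Complex.I • rc (torusArg t₀ t₀), charOn (compactStab n z) (-w) t₀), y₀) :=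
      ContDiffAt.comp (g := actChart n z z)
        (f := fun p : (CSpace n × ℂ) × CSpace n => (p.1.1, p.2)) _ h1 (by fun_prop)
    exact (contDiffAt_snd.comp _ contDiffAt_fst).mul ((contDiffAt_euclidean.1 h2) l)
  · simp only [stabComponent, actChart, act]
    rw [← toCTorus_eq_torusExp]

instance (z : M) : MeasurableSpace (compactStab n z) := borel _

instance (z : M) : BorelSpace (compactStab n z) := ⟨rfl⟩

/-- Averages of the components of a chart over the stabilizer. -/
def stabAverage (z : M) (μ : Measure (compactStab n z)) (w : Fin n → ℤ) (l : Fin n)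
    (y : CSpace n) : ℂ :=
  ∫ t, stabComponent z w l t y ∂μ

variable [T2Space M]

theorem IsToricKaehler.contDiffOn_stabAverage (hM : IsToricKaehler Ω o) (z : M)
    (μ : Measure (compactStab n z)) [IsFiniteMeasure μ]
    (w : Fin n → ℤ) (l : Fin n) : ContDiffOn ℂ (2 : ℕ) (stabAverage z μ w l) (stabDomain n z) := by
  have := hM.compactSpace_compactStab z
  exact IsAnalyticFamily.contDiffOn_integral _ (hM.isOpen_stabDomain z) 2
    (hM.isAnalyticFamily_stabComponent z w l)

theorem IsToricKaehler.hasFDerivAt_stabAverage (hM : IsToricKaehler Ω o) (z : M)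
    (μ : Measure (compactStab n z)) [IsFiniteMeasure μ] (w : Fin n → ℤ) (l : Fin n) {y : CSpace n} (hy : y ∈ stabDomain n z) :
    HasFDerivAt (stabAverage z μ w l) (∫ t, fderiv ℂ (stabComponent z w l t) y
      ∂μ) y := by
  have := hM.compactSpace_compactStab z
  exact (hM.isAnalyticFamily_stabComponent z w l).hasFDerivAt_integral _
    (hM.isOpen_stabDomain z) hy

/-- Substituting t for tk in the average costs one factor of the character, by right invariance of
the measure. -/
theorem IsToricKaehler.stabAverage_smul (hM : IsToricKaehler Ω o) (z : M)
    (μ : Measure (compactStab n z)) [μ.IsMulRightInvariant] (w : Fin n → ℤ)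
    (l : Fin n) (k : compactStab n z) {y : CSpace n} (hy : y ∈ stabDomain n z) :
    stabAverage z μ w l (ch n z (toCTorus (k : Fin n → Circle) • (ch n z).symm y)) =
      torusChar w (k : Fin n → Circle) * stabAverage z μ w l y := by
  have := hM.compactSpace_compactStab z
  have h1 : ∀ t, stabComponent z w l t
      (ch n z (toCTorus (k : Fin n → Circle) • (ch n z).symm y)) =
      torusChar w (k : Fin n → Circle) * stabComponent z w l (t * k) y := by
    intro t
    have h2 : charOn (compactStab n z) (-w) (t * k) =
        charOn (compactStab n z) (-w) t * (torusChar w (k : Fin n → Circle) : ℂ)⁻¹ := by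
      change ((torusChar (-w) ((t : Fin n → Circle) * k) : Circle) : ℂ) =
        (torusChar (-w) (t : Fin n → Circle) : Circle) * _
      rw [map_mul, torusChar_neg w (k : Fin n → Circle), Circle.coe_mul, Circle.coe_inv]
    rw [stabComponent, stabComponent, h2, (ch n z).left_inv (hy.2 k), Subgroup.coe_mul, map_mul,
      mul_smul]
    field_simp [Circle.coe_ne_zero]
  simp only [stabAverage, h1]
  rw [integral_const_mul, integral_mul_right_eq_self (fun t => stabComponent z w l t y)]

theorem toCTorus_exp (θ : RSpace n) :
    toCTorus (fun j => Circle.exp (θ j)) = torusExp (Complex.I • rc θ) := by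
  ext j
  simp [toCTorus, torusExp, rc_apply, mul_comm]

theorem torusChar_exp (w : Fin n → ℤ) (θ : RSpace n) :
    (torusChar w (fun j => Circle.exp (θ j)) : ℂ) =
      Complex.exp (Complex.I * (∑ j, (w j : ℝ) * θ j : ℝ)) := by
  change ((∏ j, Circle.exp (θ j) ^ w j : Circle) : ℂ) = _
  rw [show ((∏ j, Circle.exp (θ j) ^ w j : Circle) : ℂ) = ∏ j, ((Circle.exp (θ j) ^ w j : Circle) : ℂ)
    from map_prod Circle.coeHom _ _]
  simp only [Circle.coe_zpow, Circle.coe_exp, ← Complex.exp_int_mul]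
  rw [← Complex.exp_sum]
  congr 1
  push_cast
  rw [Finset.mul_sum]
  exact Finset.sum_congr rfl fun j _ => by ring

/-- The averages are eigenfunctions of the infinitesimal stabilizer. -/
theorem IsToricKaehler.fderiv_stabAverage_fund (hM : IsToricKaehler Ω o) (z : M)
    (μ : Measure (compactStab n z)) [IsFiniteMeasure μ] [μ.IsMulRightInvariant] (w : Fin n → ℤ)
    (l : Fin n) {ξ : RSpace n} (hξ : fund n z (ch n z z) (rc ξ) = 0) {y : CSpace n}
    (hy : y ∈ stabDomain n z) :
    fderiv ℂ (stabAverage z μ w l) y (fund n z y (rc ξ)) =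
      ((∑ j, (w j : ℝ) * ξ j : ℝ) : ℂ) * stabAverage z μ w l y := by
  -- The real one-parameter group generated by iξ lies in the compact stabilizer. Equivariance along
  -- it, differentiated at s = 0, gives the eigenvalue equation for iξ; complex linearity then
  -- removes the factor i.
  have hmem : ∀ s : ℝ, (fun j => Circle.exp ((s • ξ) j)) ∈ compactStab n z := by
    intro s
    rw [mem_compactStab, toCTorus_exp]
    have h := hM.act_smul_eq_of_fund_eq_zero z (mem_chart_source _ z) hξ (Complex.I * s)
    have h1 : Complex.I • rc (s • ξ) = (Complex.I * (s : ℂ)) • rc ξ := by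
      rw [map_smul, mul_smul]
      rfl
    rw [h1]
    exact h
  set p := (ch n z).symm y with hp
  have hps : p ∈ (ch n z).source := (ch n z).map_target hy.1
  have hpy : ch n z p = y := (ch n z).right_inv hy.1
  have heq : ∀ s : ℝ, stabAverage z μ w l (ch n z (act (s • (Complex.I • rc ξ)) p)) =
      Complex.exp (Complex.I * ((∑ j, (w j : ℝ) * ξ j : ℝ) : ℂ) * s) * stabAverage z μ w l y := by
    intro s
    have h1 := hM.stabAverage_smul z μ w l ⟨_, hmem s⟩ hy
    simp only [toCTorus_exp, torusChar_exp] at h1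
    rw [map_smul, smul_comm] at h1
    rw [act, h1]
    congr 2
    simp only [PiLp.smul_apply, smul_eq_mul]
    push_cast
    rw [Finset.mul_sum, Finset.mul_sum, Finset.sum_mul]
    exact Finset.sum_congr rfl fun j _ => by ring
  have hd1 : HasDerivAt (fun s : ℝ => stabAverage z μ w l (ch n z (act (s • (Complex.I • rc ξ)) p)))
      (fderiv ℂ (stabAverage z μ w l) y (fund n z y (Complex.I • rc ξ))) 0 := by
    have h1 : HasDerivAt (fun s : ℝ => s • (Complex.I • rc ξ)) (Complex.I • rc ξ) 0 := by
      simpa using (hasDerivAt_id (0 : ℝ)).smul_const (Complex.I • rc ξ)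
    have h2 : HasFDerivAt (fun ζ : CSpace n => ch n z (act ζ p))
        ((fund n z y).restrictScalars ℝ) ((0 : ℝ) • (Complex.I • rc ξ)) := by
      have := (hM.hasStrictFDerivAt_act_zero z hps).hasFDerivAt.restrictScalars ℝ
      rwa [hpy, ← zero_smul ℝ (Complex.I • rc ξ)] at this
    have h3 := h2.comp_hasDerivAt (0 : ℝ) h1
    have h4 : HasFDerivAt (stabAverage z μ w l)
        ((fderiv ℂ (stabAverage z μ w l) y).restrictScalars ℝ)
        (ch n z (act ((0 : ℝ) • (Complex.I • rc ξ)) p)) := by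
      rw [zero_smul, act_zero, hpy]
      exact (hM.hasFDerivAt_stabAverage z μ w l hy).differentiableAt.hasFDerivAt.restrictScalars ℝ
    exact h4.comp_hasDerivAt (0 : ℝ) h3
  have hd2 : HasDerivAt (fun s : ℝ => Complex.exp (Complex.I * ((∑ j, (w j : ℝ) * ξ j : ℝ) : ℂ) * s)
      * stabAverage z μ w l y)
      (Complex.I * ((∑ j, (w j : ℝ) * ξ j : ℝ) : ℂ) * stabAverage z μ w l y) 0 := by
    have h1 : HasDerivAt (fun s : ℝ => Complex.I * ((∑ j, (w j : ℝ) * ξ j : ℝ) : ℂ) * s)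
        (Complex.I * ((∑ j, (w j : ℝ) * ξ j : ℝ) : ℂ)) 0 := by
      simpa using (Complex.ofRealCLM.hasDerivAt (x := (0 : ℝ))).const_mul
        (Complex.I * ((∑ j, (w j : ℝ) * ξ j : ℝ) : ℂ))
    have h2 := h1.cexp.mul_const (stabAverage z μ w l y)
    simpa using h2
  have h := (hd1.congr_of_eventuallyEq (.of_forall fun s => (heq s).symm)).unique hd2
  rw [(fund n z y).map_smul, map_smul, smul_eq_mul, mul_assoc] at h
  exact mul_left_cancel₀ Complex.I_ne_zero h

/-- The differentials of the averages separate tangent vectors. -/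
theorem IsToricKaehler.eq_zero_of_fderiv_stabAverage (hM : IsToricKaehler Ω o) (z : M)
    (μ : Measure (compactStab n z)) [IsFiniteMeasure μ] [μ.IsOpenPosMeasure]
    {v : CSpace n} (hv : ∀ w l, fderiv ℂ (stabAverage z μ w l) (ch n z z) v = 0) : v = 0 := by
  have := hM.compactSpace_compactStab z
  have hy := mem_stabDomain_self (n := n) z
  ext l
  let f : compactStab n z → CSpace n → ℂ := stabComponent z 0 l
  have hf := hM.isAnalyticFamily_stabComponent z 0 l
  let φ : C(compactStab n z, ℂ) :=
    ⟨fun t => fderiv ℂ (f t) (ch n z z) v,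
      (hf.fderiv.continuous_param hy).clm_apply continuous_const⟩
  -- The differentials of the averages, applied to v, are the Fourier coefficients of the function φ
  -- on the stabilizer. Its value at the identity is the l-th component of v.
  have hφ : φ = 0 := by
    refine eq_zero_of_integral_char_eq_zero (compactStab n z) μ φ fun w => ?_
    have h1 := hv (-w) l
    rw [(hM.hasFDerivAt_stabAverage z μ (-w) l hy).fderiv,
      ContinuousLinearMap.integral_apply (integrable_of_continuous_compact _
        ((hM.isAnalyticFamily_stabComponent z (-w) l).fderiv.continuous_param hy))] at h1
    rw [← h1]
    refine integral_congr_ae (.of_forall fun t => ?_)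
    have h2 : stabComponent z (-w) l t = fun y => charOn (compactStab n z) w t * f t y := by
      ext1 y
      have h3 : charOn (compactStab n z) (-0) t = 1 := by
        change ((torusChar (-0) (t : Fin n → Circle) : Circle) : ℂ) = 1
        rw [neg_zero, torusChar_zero, Circle.coe_one]
      simp only [f, stabComponent, h3, one_mul, neg_neg]
    change _ = fderiv ℂ (stabComponent z (-w) l t) (ch n z z) v
    rw [h2, fderiv_const_mul (hf.differentiableAt t hy)]
    rfl
  have h1 : φ 1 = 0 := by rw [hφ]; rfl
  have h2 : f 1 =ᶠ[𝓝 (ch n z z)] fun y => y l := by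
    filter_upwards [(ch n z).open_target.mem_nhds (mem_chart_target _ z)] with y hy'
    have h3 : charOn (compactStab n z) (-0) 1 = 1 := by
      change ((torusChar (-0) (1 : Fin n → Circle) : Circle) : ℂ) = 1
      rw [map_one, Circle.coe_one]
    simp only [f, stabComponent, h3, one_mul, Subgroup.coe_one, map_one, one_smul]
    rw [(ch n z).right_inv hy']
  have h4 : fderiv ℂ (f 1) (ch n z z) = EuclideanSpace.proj l := by
    rw [h2.fderiv_eq]
    exact (EuclideanSpace.proj l : CSpace n →L[ℂ] ℂ).fderiv
  change fderiv ℂ (f 1) (ch n z z) v = 0 at h1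
  rw [h4] at h1
  exact h1

/-- Near every point there are holomorphic coordinates in which the infinitesimal stabilizer acts
diagonally. -/
theorem IsToricKaehler.exists_weight_coordinates (hM : IsToricKaehler Ω o) (z : M) :
    ∃ (W : Set (CSpace n)) (F : CSpace n → CSpace n) (w : Fin n → RSpace n), IsOpen W ∧
      ch n z z ∈ W ∧ W ⊆ (ch n z).target ∧ ContDiffOn ℂ 2 F W ∧
      Function.Injective (fderiv ℂ F (ch n z z)) ∧
      ∀ ξ : RSpace n, fund n z (ch n z z) (rc ξ) = 0 → ∀ y ∈ W, ∀ l,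
        fderiv ℂ F y (fund n z y (rc ξ)) l = ((inner ℝ (w l) ξ : ℝ) : ℂ) * F y l := by
  have := hM.compactSpace_compactStab z
  let μ : Measure (compactStab n z) := Measure.haar
  have hy := mem_stabDomain_self (n := n) z
  let D : (Fin n → ℤ) × Fin n → (CSpace n →L[ℂ] ℂ) := fun i =>
    fderiv ℂ (stabAverage z μ i.1 i.2) (ch n z z)
  -- A basis of the span is chosen among the differentials themselves, so each coordinate of F is an
  -- honest weight function. The span has rank n because these differentials separate vectors.
  obtain ⟨f, hf, hspan, -⟩ := Submodule.exists_fun_fin_finrank_span_eq ℂ (range D)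
  have hsep : ∀ v : CSpace n, (∀ i, f i v = 0) → v = 0 := by
    intro v hv
    refine hM.eq_zero_of_fderiv_stabAverage z μ fun w l => ?_
    have h1 : D (w, l) ∈ Submodule.span ℂ (range f) := by
      rw [hspan]
      exact Submodule.subset_span ⟨_, rfl⟩
    have h2 : Submodule.span ℂ (range f) ≤
        LinearMap.ker ((ContinuousLinearMap.apply ℂ ℂ v : (CSpace n →L[ℂ] ℂ) →L[ℂ] ℂ) :
          (CSpace n →L[ℂ] ℂ) →ₗ[ℂ] ℂ) := by
      rw [Submodule.span_le]
      rintro _ ⟨i, rfl⟩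
      exact hv i
    exact h2 h1
  have hrank : Module.finrank ℂ (Submodule.span ℂ (range D)) = n := by
    refine le_antisymm ?_ ?_
    · refine (Submodule.finrank_le _).trans ?_
      rw [← LinearEquiv.finrank_eq (LinearMap.toContinuousLinearMap (𝕜 := ℂ) (E := CSpace n)
        (F' := ℂ))]
      have := Subspace.dual_finrank_eq (K := ℂ) (V := CSpace n)
      rw [finrank_euclideanSpace_fin] at this
      exact this.le
    · have h1 : Function.Injective
          (LinearMap.pi fun i => ((f i : CSpace n →L[ℂ] ℂ) : CSpace n →ₗ[ℂ] ℂ)) := by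
        rw [injective_iff_map_eq_zero]
        intro v hv
        exact hsep v fun i => congrFun hv i
      have h2 := LinearMap.finrank_le_finrank_of_injective h1
      simpa using h2
  choose g hg using fun l : Fin n => hf (Fin.cast hrank.symm l)
  refine ⟨stabDomain n z, fun y => WithLp.toLp 2 fun l => stabAverage z μ (g l).1 (g l).2 y,
    fun l => WithLp.toLp 2 fun j => ((g l).1 j : ℝ), hM.isOpen_stabDomain z, hy, fun y hy => hy.1,
    ?_, ?_, ?_⟩
  · rw [contDiffOn_euclidean]
    exact fun l => hM.contDiffOn_stabAverage z μ (g l).1 (g l).2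
  · have hF : HasFDerivAt (fun y => WithLp.toLp 2 fun l => stabAverage z μ (g l).1 (g l).2 y)
        ((EuclideanSpace.equiv (Fin n) ℂ).symm.toContinuousLinearMap.comp
          (ContinuousLinearMap.pi fun l => D (g l))) (ch n z z) := by
      rw [← hasFDerivWithinAt_univ, hasFDerivWithinAt_euclidean]
      intro l
      rw [hasFDerivWithinAt_univ]
      exact (hM.hasFDerivAt_stabAverage z μ (g l).1 (g l).2 hy).differentiableAt.hasFDerivAt
    rw [hF.fderiv, injective_iff_map_eq_zero]
    intro v hv
    refine hsep v fun i => ?_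
    have h1 := congrArg (fun u : CSpace n => u (Fin.cast hrank i)) hv
    have h2 : D (g (Fin.cast hrank i)) v = 0 := h1
    rw [hg] at h2
    exact h2
  · intro ξ hξ y hy l
    have hF : HasFDerivAt (fun y => WithLp.toLp 2 fun l => stabAverage z μ (g l).1 (g l).2 y)
        ((EuclideanSpace.equiv (Fin n) ℂ).symm.toContinuousLinearMap.comp
          (ContinuousLinearMap.pi fun l => fderiv ℂ (stabAverage z μ (g l).1 (g l).2) y)) y := by
      rw [← hasFDerivWithinAt_univ, hasFDerivWithinAt_euclidean]
      intro l
      rw [hasFDerivWithinAt_univ]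
      exact (hM.hasFDerivAt_stabAverage z μ (g l).1 (g l).2 hy).differentiableAt.hasFDerivAt
    rw [hF.fderiv]
    have h1 := hM.fderiv_stabAverage_fund z μ (g l).1 (g l).2 hξ hy
    refine h1.trans ?_
    congr 2
    rw [PiLp.inner_apply]
    exact Finset.sum_congr rfl fun j _ => mul_comm _ _

end WeightCoordinates

/-! ### Division by coordinates and limits of the velocity at the boundary -/

section Division

variable {n : ℕ}

/-- A function whose quotient by the `l`-th coordinate is real vanishes with the coordinate. -/
theorem eq_zero_of_im_mul_conj {P : CSpace n → ℂ} {l : Fin n} {u : CSpace n} (hu : u l = 0)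
    (hc : ContinuousAt P u)
    (h : ∀ᶠ v in 𝓝 u, (P v * (starRingEnd ℂ) (v l)).im = 0) : P u = 0 := by
  have key : ∀ c : ℂ, (P u * (starRingEnd ℂ) c).im = 0 := by
    intro c
    -- On this ray the l-th coordinate is tc with t > 0, so dividing by t leaves Im(P c̄) = 0, which
    -- passes to the limit t → 0. The directions c = 1 and c = i then give P(u) = 0.
    let γ : ℝ → CSpace n := fun t => u + (t : ℂ) • EuclideanSpace.single l c
    have hγ0 : γ 0 = u := by simp [γ]
    have hγc : Continuous γ := by fun_prop
    have hγ : Tendsto γ (𝓝[>] 0) (𝓝 u) := by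
      have := hγc.tendsto 0
      rw [hγ0] at this
      exact this.mono_left nhdsWithin_le_nhds
    have h1 : Tendsto (fun t => (P (γ t) * (starRingEnd ℂ) c).im) (𝓝[>] 0)
        (𝓝 (P u * (starRingEnd ℂ) c).im) :=
      (Complex.continuous_im.tendsto _).comp ((hc.tendsto.comp hγ).mul_const _)
    refine tendsto_nhds_unique h1 (tendsto_const_nhds.congr' ?_)
    filter_upwards [hγ.eventually h, self_mem_nhdsWithin] with t ht ht0
    have h2 : γ t l = (t : ℂ) * c := by simp [γ, hu]
    rw [h2, map_mul, Complex.conj_ofReal, mul_left_comm, Complex.im_ofReal_mul] at ht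
    exact ((mul_eq_zero.1 ht).resolve_left (ne_of_gt ht0)).symm
  have h1 := key 1
  have h2 := key Complex.I
  simp at h1 h2
  exact Complex.ext h2 h1

/-- Reality of P/u_l forces P to vanish where u_l does, and forces the derivative of P at u₀ in the
complex direction l to be multiplication by a real number r. Strict differentiability then gives
P(u) - r u_l = o(|u_l|), which a mere derivative at u₀ would not. -/
theorem exists_tendsto_div_of_im_eq_zero {P : CSpace n → ℂ} {l : Fin n} {u₀ : CSpace n}
    (hu : u₀ l = 0) (hP : ContDiffAt ℝ 1 P u₀)
    (h : ∀ᶠ v in 𝓝 u₀, (P v * (starRingEnd ℂ) (v l)).im = 0) :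
    ∃ r : ℝ, Tendsto (fun u => P u / u l) (𝓝[{u | u l ≠ 0}] u₀) (𝓝 (r : ℂ)) := by
  have hcont : ∀ᶠ u in 𝓝 u₀, ContinuousAt P u :=
    (hP.eventually (by simp)).mono fun u hu => hu.continuousAt
  have hzero : ∀ᶠ u in 𝓝 u₀, u l = 0 → P u = 0 := by
    filter_upwards [h.eventually_nhds, hcont] with u h1 h2 h3
    exact eq_zero_of_im_mul_conj h3 h2 h1
  have hP0 : P u₀ = 0 := hzero.self_of_nhds hu
  set L := fderiv ℝ P u₀ with hL
  have hs : HasStrictFDerivAt P L u₀ := hP.hasStrictFDerivAt (by simp)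
  have key : ∀ c : ℂ, (L (EuclideanSpace.single l c) * (starRingEnd ℂ) c).im = 0 := by
    intro c
    let γ : ℝ → CSpace n := fun t => u₀ + t • EuclideanSpace.single l c
    have hγ0 : γ 0 = u₀ := by simp [γ]
    have hγ : Tendsto γ (𝓝 0) (𝓝 u₀) := by
      have : Continuous γ := by fun_prop
      simpa [hγ0] using this.tendsto 0
    have hd : HasDerivAt γ (EuclideanSpace.single l c) 0 := by
      have := ((hasDerivAt_id (0 : ℝ)).smul_const (EuclideanSpace.single l c)).const_add u₀
      rwa [one_smul] at this
    have h1 : HasDerivAt (fun t => P (γ t)) (L (EuclideanSpace.single l c)) 0 :=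
      HasFDerivAt.comp_hasDerivAt (f := γ) (0 : ℝ) (by rw [hγ0]; exact hs.hasFDerivAt) hd
    have h2 : HasDerivAt (fun t => (P (γ t) * (starRingEnd ℂ) c).im)
        (L (EuclideanSpace.single l c) * (starRingEnd ℂ) c).im 0 :=
      (Complex.imCLM.hasFDerivAt.comp_hasDerivAt (0 : ℝ) (h1.mul_const ((starRingEnd ℂ) c)))
    refine h2.unique ((hasDerivAt_const (0 : ℝ) (0 : ℝ)).congr_of_eventuallyEq ?_)
    filter_upwards [hγ.eventually h] with t ht
    rcases eq_or_ne t 0 with rfl | ht0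
    · simp [hγ0, hP0]
    have h3 : γ t l = (t : ℂ) * c := by simp [γ, hu]
    rw [h3, map_mul, Complex.conj_ofReal, mul_left_comm, Complex.im_ofReal_mul] at ht
    exact (mul_eq_zero.1 ht).resolve_left ht0
  -- A real linear map of ℂ with L(c) c̄ real for all c is a real scalar: c = 1 and c = i make L(1)
  -- real and L(i) imaginary, and c = 1 + i equates the two scalars.
  have hlin : ∀ c : ℂ, L (EuclideanSpace.single l c) =
      ((L (EuclideanSpace.single l 1)).re : ℂ) * c := by
    have e1 : ∀ c : ℂ, (EuclideanSpace.single l c : CSpace n) =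
        c.re • EuclideanSpace.single l (1 : ℂ) + c.im • EuclideanSpace.single l Complex.I := by
      intro c
      ext j
      by_cases hj : j = l <;> simp [hj, Complex.re_add_im]
    have k1 := key 1
    have k2 := key Complex.I
    have k3 := key (1 + Complex.I)
    have e3 := e1 (1 + Complex.I)
    simp only [Complex.add_re, Complex.one_re, Complex.I_re, Complex.add_im, Complex.one_im,
      Complex.I_im, add_zero, zero_add, one_smul] at e3
    rw [e3, map_add] at k3
    intro c
    rw [e1 c, map_add, map_smul, map_smul]
    generalize L (EuclideanSpace.single l 1) = p at *
    generalize L (EuclideanSpace.single l Complex.I) = q at *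
    simp at k1 k2 k3
    apply Complex.ext
    · simp; rw [k2]; ring
    · simp; rw [k1]; linear_combination c.im * (k3 : _) + c.im * k2 - c.im * k1
  refine ⟨(L (EuclideanSpace.single l 1)).re, ?_⟩
  set r : ℝ := (L (EuclideanSpace.single l 1)).re
  -- Comparing u with its projection to u_l = 0, where P vanishes, makes the error proportional to
  -- |u_l| rather than to the distance from u₀.
  let pr : CSpace n → CSpace n := fun u => u - EuclideanSpace.single l (u l)
  have hsingle : Continuous fun u : CSpace n => (EuclideanSpace.single l (u l) : CSpace n) := by
    have : (fun u : CSpace n => (EuclideanSpace.single l (u l) : CSpace n)) =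
        fun u => (u l) • EuclideanSpace.single l (1 : ℂ) := by
      ext u j
      by_cases hj : j = l <;> simp [hj]
    rw [this]
    fun_prop
  have hprc : Continuous pr := continuous_id.sub hsingle
  have hpr0 : pr u₀ = u₀ := by simp [pr, hu]
  have hprt : Tendsto pr (𝓝 u₀) (𝓝 u₀) := by simpa [hpr0] using hprc.tendsto u₀
  have hprl : ∀ u, pr u l = 0 := fun u => by simp [pr]
  rw [Metric.tendsto_nhdsWithin_nhds]
  intro ε hε
  have h1 := (hs.isLittleO.comp_tendsto
    ((tendsto_id.prodMk_nhds hprt : Tendsto (fun u => (u, pr u)) (𝓝 u₀) _))).def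
    (half_pos hε)
  have h2 : ∀ᶠ u in 𝓝 u₀, u l ≠ 0 → dist (P u / u l) (r : ℂ) < ε := by
    filter_upwards [h1, hprt.eventually hzero] with u hu1 hu2 hu0
    simp only [Function.comp, id] at hu1
    have e1 : u - pr u = EuclideanSpace.single l (u l) := by simp [pr]
    rw [hu2 (hprl u), e1, hlin, sub_zero, PiLp.norm_single] at hu1
    have e2 : P u / u l - r = (P u - r * u l) / u l := by field_simp
    rw [dist_eq_norm, e2, norm_div, div_lt_iff₀ (norm_pos_iff.2 hu0)]
    refine hu1.trans_lt ?_
    have := norm_pos_iff.2 hu0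
    nlinarith
  obtain ⟨δ, hδ, hb⟩ := Metric.eventually_nhds_iff.1 h2
  exact ⟨δ, hδ, fun u hu hd => hb hd hu⟩

theorem dense_setOf_forall_ne_zero : Dense {u : CSpace n | ∀ l, u l ≠ 0} := by
  have h1 : Dense (univ.pi fun _ : Fin n => ({0}ᶜ : Set ℂ)) :=
    dense_pi univ fun i _ => dense_compl_singleton 0
  have h2 := h1.preimage (PiLp.homeomorph 2 (fun _ : Fin n => ℂ)).isOpenMap
  refine h2.mono fun u hu l => ?_
  exact hu l (mem_univ l)

/-- A limit along a dense subset is a limit, for continuous functions. -/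
theorem tendsto_of_tendsto_dense {X Y : Type*} [TopologicalSpace X] [TopologicalSpace Y]
    [RegularSpace Y] {a : X → Y} {D D' : Set X} {x : X} {L : Y} (hD : IsOpen D)
    (ha : ContinuousOn a D) (hd : ∀ᶠ y in 𝓝 x, y ∈ D → y ∈ closure D')
    (h : Tendsto a (𝓝[D'] x) (𝓝 L)) : Tendsto a (𝓝[D] x) (𝓝 L) := by
  rw [(closed_nhds_basis L).tendsto_right_iff]
  rintro C ⟨hC, hCc⟩
  have h1 := h.eventually hC
  rw [eventually_nhdsWithin_iff] at h1 ⊢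
  filter_upwards [h1.eventually_nhds, hd] with y hy hdy hyD
  have hya : ContinuousAt a y := ha.continuousAt (hD.mem_nhds hyD)
  by_contra hn
  have h2 : ∀ᶠ y' in 𝓝 y, a y' ∈ Cᶜ := hya.eventually (hCc.isOpen_compl.mem_nhds hn)
  obtain ⟨y', hy', hy'D⟩ := (mem_closure_iff_frequently.1 (hdy hyD)).and_eventually
    (hy.and h2) |>.exists
  exact hy'D.2 (hy'D.1 hy')


/-- Here F are weight coordinates, k is the stabilizer algebra, G sends a Lie algebra vector to its
fundamental vector in these coordinates, R is the gradient field and D the open orbit. The part of a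
orthogonal to k is read off from the coordinates of weight zero by linear algebra; the part in k is
read off from the others by division. -/
theorem exists_tendsto_of_weights {F : CSpace n → CSpace n} {y₀ : CSpace n}
    {F' : CSpace n ≃L[ℂ] CSpace n} (hF : ContDiffAt ℂ 2 F y₀) (hF' : fderiv ℂ F y₀ = F')
    {G : CSpace n → CSpace n →L[ℂ] CSpace n} (hG : ContDiffAt ℝ 1 G y₀)
    {R : CSpace n → CSpace n} (hR : ContDiffAt ℝ 1 R y₀) {w : Fin n → RSpace n}
    {k : Submodule ℝ (RSpace n)}
    (hk : ∀ᶠ y in 𝓝 y₀, ∀ ξ ∈ k, ∀ l, G y (rc ξ) l = ((inner ℝ (w l) ξ : ℝ) : ℂ) * F y l)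
    (hk0 : ∀ η, (∀ l, (∀ ξ ∈ k, inner ℝ (w l) ξ = 0) → G y₀ (rc η) l = 0) → η ∈ k)
    (hF0 : ∀ l, (∃ ξ ∈ k, inner ℝ (w l) ξ ≠ 0) → F y₀ l = 0)
    {D : Set (CSpace n)} (hDo : IsOpen D) (hD : ∀ᶠ y in 𝓝 y₀, y ∈ closure D)
    {a : CSpace n → RSpace n} (ha : ContinuousOn a D)
    (haR : ∀ᶠ y in 𝓝 y₀, y ∈ D → R y = G y (rc (a y)))
    (hinj : ∀ᶠ y in 𝓝 y₀, y ∈ D → ∀ ξ : RSpace n, G y (rc ξ) = 0 → ξ = 0) :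
    ∃ L, Tendsto a (𝓝[D] y₀) (𝓝 L) := by
  classical
  -- local inverse of `F`
  have hs : HasStrictFDerivAt F (F' : CSpace n →L[ℂ] CSpace n) y₀ :=
    hF' ▸ hF.hasStrictFDerivAt (by simp)
  let Φ := hs.toOpenPartialHomeomorph F
  have hΦ : ∀ y, Φ y = F y := fun y => rfl
  have hΦs : y₀ ∈ Φ.source := hs.mem_toOpenPartialHomeomorph_source
  have hFt : Tendsto F (𝓝 y₀) (𝓝 (F y₀)) := hF.continuousAt
  have hinvt : Tendsto Φ.symm (𝓝 (F y₀)) (𝓝 y₀) := by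
    have := Φ.tendsto_symm hΦs
    exact this
  have hinvd : ContDiffAt ℝ 1 Φ.symm (F y₀) := by
    have h1 : ContDiffAt ℂ 2 Φ.symm (F y₀) := by
      refine Φ.contDiffAt_symm (f₀' := F') (Φ.map_source hΦs) ?_ ?_
      · rw [← hΦ y₀, Φ.left_inv hΦs]; exact hs.hasFDerivAt
      · rw [← hΦ y₀, Φ.left_inv hΦs]; exact hF
    exact (h1.restrict_scalars ℝ).of_le (by norm_num)
  -- generic points of `D`
  let D' : Set (CSpace n) := {y | y ∈ D ∧ ∀ l, F y l ≠ 0}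
  have hDD' : ∀ᶠ y in 𝓝 y₀, y ∈ D → y ∈ closure D' := by
    filter_upwards [Φ.open_source.mem_nhds hΦs] with y hy hyD
    rw [mem_closure_iff]
    intro U hU hyU
    have h1 : IsOpen (Φ '' (Φ.source ∩ (U ∩ D))) :=
      Φ.isOpen_image_source_inter (hU.inter hDo)
    obtain ⟨_, ⟨y', ⟨_, hyU', hyD'⟩, rfl⟩, hu⟩ := dense_setOf_forall_ne_zero.inter_open_nonempty _ h1
      ⟨Φ y, y, ⟨hy, hyU, hyD⟩, rfl⟩
    exact ⟨y', hyU', hyD', hu⟩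
  -- the projection to `k`
  let π : RSpace n →L[ℝ] RSpace n := k.starProjection
  have hπk : ∀ η, π η ∈ k := fun η => k.starProjection_apply_mem η
  have hπ : ∀ η ∈ k, π η = η := fun η hη => Submodule.starProjection_eq_self_iff.2 hη
  -- the projection to the coordinates of weight zero
  let Q : CSpace n →L[ℝ] CSpace n :=
    ∑ l, if ∀ ξ ∈ k, inner ℝ (w l) ξ = 0 then
      ((EuclideanSpace.proj l : CSpace n →L[ℂ] ℂ).restrictScalars ℝ).smulRight
        (EuclideanSpace.single l (1 : ℂ)) else 0
  have hQ : ∀ v l, Q v l = if ∀ ξ ∈ k, inner ℝ (w l) ξ = 0 then v l else 0 := by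
    intro v l
    have h1 : Q v = ∑ l, if ∀ ξ ∈ k, inner ℝ (w l) ξ = 0 then
        (v l) • (EuclideanSpace.single l (1 : ℂ) : CSpace n) else 0 := by
      simp only [Q, sum_apply]
      refine Finset.sum_congr rfl fun l _ => ?_
      split_ifs <;> rfl
    rw [h1, WithLp.ofLp_sum, Finset.sum_apply, Finset.sum_eq_single l]
    · split_ifs <;> simp
    · intro j _ hj
      split_ifs <;> simp [hj.symm]
    · simp
  -- The weight-zero coordinates of the fundamental vector determine η modulo k at y₀, and π
  -- supplies the part in k. So T is injective at y₀, and composing with a fixed left inverse gives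
  -- an endomorphism invertible near y₀.
  let T : CSpace n → RSpace n →L[ℝ] CSpace n × RSpace n := fun y =>
    (Q.comp (((G y).restrictScalars ℝ).comp rc)).prod π
  have hT0 : Function.Injective (T y₀) := by
    rw [injective_iff_map_eq_zero]
    intro η hη
    have h1 : Q (G y₀ (rc η)) = 0 := congrArg Prod.fst hη
    have h2 : π η = 0 := congrArg Prod.snd hη
    rw [← hπ η (hk0 η fun l hl => ?_), h2]
    have h3 := hQ (G y₀ (rc η)) l
    rw [if_pos hl, h1] at h3
    exact h3.symm
  obtain ⟨S₀, hS₀⟩ := LinearMap.exists_leftInverse_of_injective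
    ((T y₀ : RSpace n →L[ℝ] CSpace n × RSpace n) : RSpace n →ₗ[ℝ] CSpace n × RSpace n)
    (LinearMap.ker_eq_bot.2 hT0)
  let S : CSpace n × RSpace n →L[ℝ] RSpace n := LinearMap.toContinuousLinearMap S₀
  have hS : ∀ η, S (T y₀ η) = η := fun η => congrArg (fun f => f η) hS₀
  let B : CSpace n → RSpace n →L[ℝ] RSpace n := fun y => S.comp (T y)
  have hB0 : B y₀ = ((ContinuousLinearEquiv.refl ℝ (RSpace n) : RSpace n ≃L[ℝ] RSpace n) :
      RSpace n →L[ℝ] RSpace n) := by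
    ext1 η
    exact hS η
  have hTd : ContDiffAt ℝ 1 B y₀ := by
    have h0 : B = fun y => (S.comp (ContinuousLinearMap.inl ℝ _ _)).comp
        (Q.comp (((G y).restrictScalars ℝ).comp rc)) +
        (S.comp (ContinuousLinearMap.inr ℝ _ _)).comp π := by
      ext1 y
      ext1 η
      change S (_, _) = S (_, 0) + S (0, _)
      rw [← map_add, Prod.mk_add_mk, add_zero, zero_add]
      rfl
    have h1 : ContDiffAt ℝ 1 (fun y => (G y).restrictScalars ℝ) y₀ :=
      (ContinuousLinearMap.restrictScalarsL ℂ (CSpace n) (CSpace n) ℝ ℝ).contDiff.contDiffAt.comp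
        y₀ hG
    rw [h0]
    exact (contDiffAt_const.clm_comp (contDiffAt_const.clm_comp
      (h1.clm_comp contDiffAt_const))).add contDiffAt_const
  have hBinv : ∀ᶠ y in 𝓝 y₀, ∃ e : RSpace n ≃L[ℝ] RSpace n, (e : RSpace n →L[ℝ] RSpace n) = B y := by
    have h1 := (ContinuousLinearEquiv.refl ℝ (RSpace n)).nhds
    rw [← hB0] at h1
    exact hTd.continuousAt.eventually h1
  -- This equals a - π a on D, since vectors of k do not contribute to weight-zero coordinates; the
  -- formula is C¹ up to y₀.
  let am : CSpace n → RSpace n := fun y => (B y).inverse (S (Q (R y), 0))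
  have hamd : ContDiffAt ℝ 1 am y₀ := by
    have h1 : ContDiffAt ℝ 1 (fun y => (B y).inverse) y₀ := by
      have h2 := contDiffAt_map_inverse (𝕜 := ℝ) (n := 1) (ContinuousLinearEquiv.refl ℝ (RSpace n))
      rw [← hB0] at h2
      exact h2.comp y₀ hTd
    refine h1.clm_apply (S.contDiff.contDiffAt.comp y₀ ?_)
    exact (Q.contDiff.contDiffAt.comp y₀ hR).prodMk contDiffAt_const
  have ham : ∀ᶠ y in 𝓝 y₀, y ∈ D → am y = a y - π (a y) := by
    filter_upwards [hk, haR, hBinv] with y h1 h2 h3 hyD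
    obtain ⟨e, he⟩ := h3
    have h4 : Q (G y (rc (π (a y)))) = 0 := by
      ext l
      rw [hQ]
      split_ifs with hl
      · rw [h1 _ (hπk _) l, hl _ (hπk _)]; simp
      · rfl
    have h5 : B y (a y - π (a y)) = S (Q (R y), 0) := by
      have h6 : T y (a y - π (a y)) = (Q (R y), 0) := by
        refine Prod.ext ?_ ?_
        · change Q (G y (rc (a y - π (a y)))) = Q (R y)
          rw [map_sub, map_sub, map_sub, h4, sub_zero, h2 hyD]
        · change π (a y - π (a y)) = 0
          rw [map_sub, hπ _ (hπk _), sub_self]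
      change S (T y _) = _
      rw [h6]
    change (B y).inverse (S (Q (R y), 0)) = _
    rw [← h5, ← he, ContinuousLinearMap.inverse_equiv]
    exact e.symm_apply_apply _
  -- What remains is the fundamental vector of π a, whose l-th coordinate is the real number ⟨w_l, π
  -- a⟩ times F_l: the situation of the division lemma.
  let P : CSpace n → CSpace n := fun y => R y - G y (rc (am y))
  have hPd : ContDiffAt ℝ 1 P y₀ := by
    refine hR.sub ?_
    have h1 : ContDiffAt ℝ 1 (fun y => (G y).restrictScalars ℝ) y₀ :=
      (ContinuousLinearMap.restrictScalarsL ℂ (CSpace n) (CSpace n) ℝ ℝ).contDiff.contDiffAt.comp y₀ hG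
    exact h1.clm_apply (rc.contDiff.contDiffAt.comp y₀ hamd)
  have hP : ∀ᶠ y in 𝓝 y₀, y ∈ D → ∀ l, P y l = ((inner ℝ (w l) (π (a y)) : ℝ) : ℂ) * F y l := by
    filter_upwards [hk, haR, ham] with y h1 h2 h3 hyD l
    have : P y = G y (rc (π (a y))) := by
      change R y - G y (rc (am y)) = _
      rw [h2 hyD, h3 hyD, map_sub, map_sub, sub_sub_cancel]
    rw [this, h1 _ (hπk _) l]
  have hPc : ∀ᶠ y in 𝓝 y₀, ContinuousAt P y := (hPd.eventually (by simp)).mono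
    fun y hy => hy.continuousAt
  have hFc : ∀ᶠ y in 𝓝 y₀, ContinuousAt F y := (hF.eventually (by simp)).mono
    fun y hy => hy.continuousAt
  have hPim : ∀ᶠ y in 𝓝 y₀, ∀ l, (P y l * (starRingEnd ℂ) (F y l)).im = 0 := by
    filter_upwards [hP.eventually_nhds, hPc, hFc, hD] with y h1 h2 h3 h4 l
    have h5 : Tendsto (fun y => (P y l * (starRingEnd ℂ) (F y l)).im) (𝓝[D] y)
        (𝓝 (P y l * (starRingEnd ℂ) (F y l)).im) := by
      have e1 : ContinuousAt (fun y => P y l) y :=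
        (EuclideanSpace.proj l : CSpace n →L[ℂ] ℂ).continuous.continuousAt.comp h2
      have e2 : ContinuousAt (fun y => F y l) y :=
        (EuclideanSpace.proj l : CSpace n →L[ℂ] ℂ).continuous.continuousAt.comp h3
      exact (Complex.continuous_im.continuousAt.comp
        (e1.mul (Complex.continuous_conj.continuousAt.comp e2))).tendsto.mono_left
          nhdsWithin_le_nhds
    have : (𝓝[D] y).NeBot := mem_closure_iff_nhdsWithin_neBot.1 h4
    refine tendsto_nhds_unique h5 (tendsto_const_nhds.congr' ?_)
    rw [EventuallyEq, eventually_nhdsWithin_iff]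
    filter_upwards [h1] with y' h6 h7
    rw [h6 h7 l, mul_assoc, Complex.mul_conj, ← Complex.ofReal_mul, Complex.ofReal_im]
  have hlim : ∀ l, ∃ r : ℝ, Tendsto (fun y => inner ℝ (w l) (π (a y))) (𝓝[D'] y₀) (𝓝 r) := by
    intro l
    by_cases hl : ∀ ξ ∈ k, inner ℝ (w l) ξ = 0
    · exact ⟨0, by simp only [hl _ (hπk _)]; exact tendsto_const_nhds⟩
    push Not at hl
    have hFl : F y₀ l = 0 := hF0 l hl
    have hPl : ContDiffAt ℝ 1 (fun u => P (Φ.symm u) l) (F y₀) := by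
      have h1 : ContDiffAt ℝ 1 P (Φ.symm (F y₀)) := by
        rw [← hΦ y₀, Φ.left_inv hΦs]; exact hPd
      exact ((EuclideanSpace.proj l : CSpace n →L[ℂ] ℂ).restrictScalars ℝ).contDiff.contDiffAt.comp
        _ (h1.comp _ hinvd)
    obtain ⟨r, hr⟩ := exists_tendsto_div_of_im_eq_zero hFl hPl (by
      filter_upwards [hinvt.eventually hPim, Φ.open_target.mem_nhds (Φ.map_source hΦs)]
        with u h1 h2
      have := h1 l
      rwa [← hΦ, Φ.right_inv h2] at this)
    refine ⟨r, ?_⟩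
    have h1 : Tendsto F (𝓝[D'] y₀) (𝓝[{u | u l ≠ 0}] (F y₀)) := by
      refine tendsto_nhdsWithin_iff.2 ⟨hFt.mono_left nhdsWithin_le_nhds, ?_⟩
      filter_upwards [self_mem_nhdsWithin] with y hy
      exact hy.2 l
    have h2 := (Complex.continuous_re.tendsto _).comp (hr.comp h1)
    rw [Complex.ofReal_re] at h2
    refine h2.congr' ?_
    rw [EventuallyEq, eventually_nhdsWithin_iff]
    filter_upwards [hP, Φ.open_source.mem_nhds hΦs] with y h3 h4 h5
    simp only [Function.comp]
    rw [← hΦ y, Φ.left_inv h4, h3 h5.1 l, hΦ, mul_div_cancel_right₀ _ (h5.2 l), Complex.ofReal_re]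
  choose r hr using hlim
  -- The weights separate k: a vector of k of zero weights has zero fundamental vector near y₀,
  -- impossible at points of D. Hence the limits of the pairings determine a limit of π a.
  let N : RSpace n →L[ℝ] (Fin n → ℝ) × RSpace n :=
    (ContinuousLinearMap.pi fun l => innerSL ℝ (w l)).prod (ContinuousLinearMap.id ℝ _ - π)
  have hN : Function.Injective N := by
    rw [injective_iff_map_eq_zero]
    intro ξ hξ
    have h1 : ∀ l, inner ℝ (w l) ξ = 0 := fun l => congrFun (congrArg Prod.fst hξ) l
    have h2 : ξ - π ξ = 0 := congrArg Prod.snd hξ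
    have h3 : ξ ∈ k := by
      rw [sub_eq_zero.1 h2]; exact hπk ξ
    obtain ⟨y, hyD, hy1, hy2⟩ := ((mem_closure_iff_frequently.1 hD.self_of_nhds).and_eventually
      (hk.and hinj)).exists
    refine hy2 hyD ξ ?_
    ext l
    rw [hy1 ξ h3 l, h1]
    simp
  obtain ⟨S₂, hS₂⟩ := LinearMap.exists_leftInverse_of_injective
    (N : RSpace n →ₗ[ℝ] (Fin n → ℝ) × RSpace n) (LinearMap.ker_eq_bot.2 hN)
  let S' : (Fin n → ℝ) × RSpace n →L[ℝ] RSpace n := LinearMap.toContinuousLinearMap S₂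
  have hS' : ∀ η, S' (N η) = η := fun η => congrArg (fun f => f η) hS₂
  refine ⟨am y₀ + S' (r, 0), tendsto_of_tendsto_dense hDo ha hDD' ?_⟩
  have h1 : Tendsto (fun y => am y + S' ((fun l => inner ℝ (w l) (π (a y))), 0)) (𝓝[D'] y₀)
      (𝓝 (am y₀ + S' (r, 0))) := by
    refine (hamd.continuousAt.tendsto.mono_left nhdsWithin_le_nhds).add
      ((S'.continuous.tendsto _).comp ?_)
    exact (tendsto_pi_nhds.2 hr).prodMk_nhds tendsto_const_nhds
  refine h1.congr' ?_
  rw [EventuallyEq, eventually_nhdsWithin_iff]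
  filter_upwards [ham] with y h2 h3
  have h4 : N (π (a y)) = ((fun l => inner ℝ (w l) (π (a y))), 0) := by
    refine Prod.ext rfl ?_
    change π (a y) - π (π (a y)) = 0
    rw [hπ _ (hπk _), sub_self]
  rw [← h4, hS', h2 h3.1, sub_add_cancel]

end Division

/-! ### Continuous extension of the velocity to M -/

section Velocity

variable {n : ℕ} {M : Type*} [TopologicalSpace M] [ChartedSpace (CSpace n) M]
  [MulAction (CTorus n) M] [IsManifold 𝓘(ℂ, CSpace n) ω M] {Ω : TwoForm n M} {o : M}

/-- The open orbit in a chart. -/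
def orbitChart (o z : M) : Set (CSpace n) :=
  (ch n z).target ∩ (ch n z).symm ⁻¹' MulAction.orbit (CTorus n) o

theorem IsToricKaehler.isOpen_orbitChart (hM : IsToricKaehler Ω o) (z : M) :
    IsOpen (orbitChart (n := n) o z) :=
  (ch n z).isOpen_inter_preimage_symm hM.isOpen_orbit

theorem IsToricKaehler.subset_closure_orbitChart (hM : IsToricKaehler Ω o) (z : M) :
    (ch n z).target ⊆ closure (orbitChart (n := n) o z) := by
  intro y hy
  rw [mem_closure_iff]
  intro U hU hyU
  obtain ⟨p, ⟨hp, hpU⟩, hpo⟩ := hM.dense_orbit.inter_open_nonempty _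
    ((ch n z).isOpen_inter_preimage hU)
    ⟨(ch n z).symm y, (ch n z).map_target hy, by rwa [mem_preimage, (ch n z).right_inv hy]⟩
  refine ⟨ch n z p, hpU, (ch n z).map_source hp, ?_⟩
  rw [mem_preimage, (ch n z).left_inv hp]
  exact hpo

theorem exists_logParam_of_mem_orbitChart {z : M} {y : CSpace n}
    (hy : y ∈ orbitChart (n := n) o z) :
    ∃ ζ : CSpace n, logParam o ζ ∈ (ch n z).source ∧ ch n z (logParam o ζ) = y := by
  obtain ⟨ζ, hζ⟩ : (ch n z).symm y ∈ range (logParam (n := n) o) := by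
    rw [range_logParam]; exact hy.2
  refine ⟨ζ, ?_, ?_⟩
  · rw [hζ]; exact (ch n z).map_target hy.1
  · rw [hζ]; exact (ch n z).right_inv hy.1

theorem reL_eq_of_logParam_eq (hM : IsToricKaehler Ω o) {ζ η : CSpace n}
    (h : logParam o ζ = logParam o η) : reL ζ = reL η := by
  have h1 : torusExp ζ = torusExp η := hM.free h
  ext j
  have h2 : Complex.exp (ζ j) = Complex.exp (η j) := congrArg Units.val (congrFun h1 j)
  have h3 := congrArg norm h2
  rw [Complex.norm_exp, Complex.norm_exp] at h3
  exact Real.exp_injective h3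

/-- An inverse of a bijective fundamental map, as an equivalence. -/
theorem exists_equiv_of_injective {L : CSpace n →L[ℂ] CSpace n} (h : Function.Injective L) :
    ∃ e : CSpace n ≃L[ℂ] CSpace n, (e : CSpace n →L[ℂ] CSpace n) = L :=
  ⟨(LinearEquiv.ofInjectiveEndo (L : CSpace n →ₗ[ℂ] CSpace n) h).toContinuousLinearEquiv, rfl⟩

theorem IsToricKaehler.tendsto_nhds_of_logParam [T2Space M] (hM : IsToricKaehler Ω o)
    (z : M) {ζ : CSpace n} (hζ : logParam o ζ ∈ (ch n z).source) :
    map (ch n z ∘ logParam o) (𝓝 ζ) = 𝓝 (ch n z (logParam o ζ)) := by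
  obtain ⟨e, he⟩ := exists_equiv_of_injective
    (hM.fund_injective z hζ (logParam_mem_orbit o ζ))
  have h := hM.hasStrictFDerivAt_logParam z hζ
  rw [← he] at h
  exact h.map_nhds_eq_of_equiv

theorem IsToricKaehler.continuousAt_of_comp_logParam [T2Space M] (hM : IsToricKaehler Ω o)
    {Y : Type*} [TopologicalSpace Y] {A : M → Y} (hA : Continuous (A ∘ logParam (n := n) o))
    (z : M) {y : CSpace n} (hy : y ∈ orbitChart (n := n) o z) :
    ContinuousAt (A ∘ (ch n z).symm) y := by
  obtain ⟨ζ, hζ, rfl⟩ := exists_logParam_of_mem_orbitChart hy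
  rw [ContinuousAt, ← hM.tendsto_nhds_of_logParam z hζ, tendsto_map'_iff]
  have h1 : Tendsto (A ∘ logParam o) (𝓝 ζ) (𝓝 ((A ∘ logParam o) ζ)) := hA.tendsto ζ
  have h2 : (A ∘ (ch n z).symm) (ch n z (logParam o ζ)) = (A ∘ logParam o) ζ := by
    simp only [Function.comp, (ch n z).left_inv hζ]
  rw [h2]
  refine h1.congr' ?_
  filter_upwards [hM.contMDiff_logParam.continuous.continuousAt.eventually
    ((ch n z).open_source.mem_nhds hζ)] with η hη
  simp only [Function.comp, (ch n z).left_inv hη]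

/-- The stabilizer algebra is constant along orbits. -/
theorem IsToricKaehler.fund_act_eq_zero (hM : IsToricKaehler Ω o) (z : M) {p : M} {ζ : CSpace n}
    (hp : p ∈ (ch n z).source) (hp' : act ζ p ∈ (ch n z).source) {ξ : CSpace n}
    (h : fund n z (ch n z p) ξ = 0) : fund n z (ch n z (act ζ p)) ξ = 0 := by
  rw [← hM.fderiv_actChart_fund z z hp hp', h]
  exact map_zero _

/-- `exists_tendsto_of_weights` in the weight coordinates at z, with R the image of the gradient
field under the coordinate differential. -/
theorem IsToricKaehler.exists_tendsto_velocity [T2Space M] (hM : IsToricKaehler Ω o) {H : M → ℝ}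
    (hH : ContMDiff 𝓘(ℝ, CSpace n) 𝓘(ℝ, ℝ) 3 H) {A : M → RSpace n}
    (hAc : Continuous (A ∘ logParam (n := n) o))
    (hA : ∀ (z : M) (ζ : CSpace n), logParam o ζ ∈ (ch n z).source →
      gradChart Ω H z (ch n z (logParam o ζ)) =
        fund n z (ch n z (logParam o ζ)) (rc (A (logParam o ζ)))) (z : M) :
    ∃ L, Tendsto A (𝓝[MulAction.orbit (CTorus n) o] z) (𝓝 L) := by
  obtain ⟨W, F, w, hWo, hzW, hWt, hF, hFinj, hFw⟩ := hM.exists_weight_coordinates z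
  set y₀ := ch n z z with hy₀
  have hzs : z ∈ (ch n z).source := mem_chart_source _ z
  have hWn : W ∈ 𝓝 y₀ := hWo.mem_nhds hzW
  have hTn : (ch n z).target ∈ 𝓝 y₀ := (ch n z).open_target.mem_nhds (mem_chart_target _ z)
  have hF2 : ContDiffAt ℂ 2 F y₀ := hF.contDiffAt hWn
  obtain ⟨F', hF'⟩ := exists_equiv_of_injective hFinj
  have hdF : ContDiffAt ℂ 1 (fderiv ℂ F) y₀ := hF2.fderiv_right (by norm_num)
  have hV : ContDiffAt ℂ 1 (fund n z) y₀ := ((hM.contDiffOn_fund z).contDiffAt hTn).of_le le_top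
  have hY : ContDiffAt ℝ 1 (gradChart Ω H z) y₀ :=
    ((hM.kaehler.contDiffOn_gradChart hH z).contDiffAt hTn).of_le (by norm_num)
  let k : Submodule ℝ (RSpace n) :=
    LinearMap.ker ((((fund n z y₀).restrictScalars ℝ).comp rc : RSpace n →L[ℝ] CSpace n) :
      RSpace n →ₗ[ℝ] CSpace n)
  have hk : ∀ ξ, ξ ∈ k ↔ fund n z y₀ (rc ξ) = 0 := fun ξ => Iff.rfl
  let G : CSpace n → CSpace n →L[ℂ] CSpace n := fun y => (fderiv ℂ F y).comp (fund n z y)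
  -- The fundamental field of ξ vanishes along the orbit of z, so the eigenvalue equation kills
  -- every coordinate of nonzero weight there. Consequently fundamental vectors at z have no
  -- component in these coordinates.
  have hF0 : ∀ l, (∃ ξ ∈ k, inner ℝ (w l) ξ ≠ 0) →
      ∀ᶠ ζ in 𝓝 (0 : CSpace n), F (ch n z (act ζ z)) l = 0 := by
    rintro l ⟨ξ, hξ, hne⟩
    have hcont : Tendsto (fun ζ : CSpace n => act ζ z) (𝓝 0) (𝓝 z) := by
      have := (hM.continuous_act_left z).tendsto 0
      rwa [act_zero] at this
    have h1 := hcont.eventually ((ch n z).open_source.mem_nhds hzs)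
    have h2 := (((ch n z).continuousAt hzs).tendsto.comp hcont).eventually hWn
    filter_upwards [h1, h2] with ζ h3 h4
    have h5 := hFw ξ hξ _ h4 l
    rw [Function.comp_apply, hM.fund_act_eq_zero z hzs h3 ((hk ξ).1 hξ), map_zero] at h5
    have h6 : ((inner ℝ (w l) ξ : ℝ) : ℂ) ≠ 0 := by exact_mod_cast hne
    exact (mul_eq_zero.1 h5.symm).resolve_left h6
  have hG0 : ∀ l, (∃ ξ ∈ k, inner ℝ (w l) ξ ≠ 0) → ∀ η, G y₀ η l = 0 := by
    intro l hl η
    have h1 := (hM.hasStrictFDerivAt_act_zero z hzs).hasFDerivAt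
    have h2 : HasFDerivAt F (fderiv ℂ F y₀) (ch n z (act (0 : CSpace n) z)) := by
      rw [act_zero]
      exact (hF2.differentiableAt (by simp)).hasFDerivAt
    have h3 : HasFDerivAt (fun ζ : CSpace n => F (ch n z (act ζ z)) l)
        ((EuclideanSpace.proj l : CSpace n →L[ℂ] ℂ).comp (G y₀)) 0 :=
      (EuclideanSpace.proj l : CSpace n →L[ℂ] ℂ).hasFDerivAt.comp (0 : CSpace n)
        (HasFDerivAt.comp (0 : CSpace n) h2 h1)
    have h4 := h3.unique ((hasFDerivAt_const (0 : ℂ) (0 : CSpace n)).congr_of_eventuallyEq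
      (hF0 l hl))
    exact congrArg (fun f => f η) h4
  have hFi : ∀ᶠ y in 𝓝 y₀, Function.Injective (fderiv ℂ F y) := by
    have h1 := F'.nhds
    rw [hF'] at h1
    filter_upwards [hdF.continuousAt.eventually h1] with y hy
    obtain ⟨e, he⟩ := hy
    rw [← he]
    exact e.injective
  have hGc : ContDiffAt ℂ 1 G y₀ := hdF.clm_comp hV
  have hRc : ContDiffAt ℝ 1 (fun y => fderiv ℂ F y (gradChart Ω H z y)) y₀ := by
    have h1 : ContDiffAt ℝ 1 (fun y => (fderiv ℂ F y).restrictScalars ℝ) y₀ :=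
      (ContinuousLinearMap.restrictScalarsL ℂ (CSpace n) (CSpace n) ℝ ℝ).contDiff.contDiffAt.comp
        y₀ (hdF.restrict_scalars ℝ)
    exact h1.clm_apply hY
  have hmain : ∃ L, Tendsto (A ∘ (ch n z).symm) (𝓝[orbitChart o z] y₀) (𝓝 L) := by
    refine exists_tendsto_of_weights (w := w) (k := k) (D := orbitChart o z)
      (a := A ∘ (ch n z).symm) hF2 hF'.symm (hGc.restrict_scalars ℝ) hRc ?_ ?_ ?_
      (hM.isOpen_orbitChart z) ?_ ?_ ?_ ?_
    · filter_upwards [hWn] with y hy ξ hξ l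
      exact hFw ξ hξ y hy l
    · intro η hη
      refine (hk η).2 (hFinj ?_)
      rw [map_zero]
      ext l
      by_cases hl : ∀ ξ ∈ k, inner ℝ (w l) ξ = 0
      · exact hη l hl
      · push Not at hl
        exact hG0 l hl (rc η)
    · intro l hl
      have := (hF0 l hl).self_of_nhds
      rwa [act_zero] at this
    · filter_upwards [hTn] with y hy
      exact hM.subset_closure_orbitChart z hy
    · exact fun y hy => (hM.continuousAt_of_comp_logParam hAc z hy).continuousWithinAt
    · filter_upwards [] with y hy
      obtain ⟨ζ, hζ, rfl⟩ := exists_logParam_of_mem_orbitChart hy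
      simp only [Function.comp, (ch n z).left_inv hζ]
      rw [hA z ζ hζ]
      rfl
    · filter_upwards [hFi] with y hy hyo ξ hξ
      have h1 := hM.fund_injective z ((ch n z).map_target hyo.1) hyo.2
      rw [(ch n z).right_inv hyo.1] at h1
      have h2 : rc ξ = 0 := h1 (hy (by rw [map_zero, map_zero]; exact hξ))
      have h3 := congrArg reL h2
      rwa [reL_rc, map_zero] at h3
  obtain ⟨L, hL⟩ := hmain
  refine ⟨L, ?_⟩
  have h1 : Tendsto (ch n z) (𝓝[MulAction.orbit (CTorus n) o] z)
      (𝓝[orbitChart (n := n) o z] y₀) := by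
    refine tendsto_nhdsWithin_iff.2
      ⟨((ch n z).continuousAt hzs).tendsto.mono_left nhdsWithin_le_nhds, ?_⟩
    filter_upwards [self_mem_nhdsWithin,
      mem_nhdsWithin_of_mem_nhds ((ch n z).open_source.mem_nhds hzs)] with p hp hps
    exact ⟨(ch n z).map_source hps, by rwa [mem_preimage, (ch n z).left_inv hps]⟩
  refine (hL.comp h1).congr' ?_
  filter_upwards [mem_nhdsWithin_of_mem_nhds ((ch n z).open_source.mem_nhds hzs)] with p hps
  simp only [Function.comp, (ch n z).left_inv hps]

/-- The velocity field `(∇²ψ)⁻¹ ∇h` on the open orbit extends continuously to the manifold. -/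
theorem IsToricKaehler.exists_velocity [T2Space M] (hM : IsToricKaehler Ω o) {H : M → ℝ}
    (hH : ContMDiff 𝓘(ℝ, CSpace n) 𝓘(ℝ, ℝ) 3 H) (hinv : IsTorusInvariant (n := n) H)
    {ψ : RSpace n → ℝ} (hψ : IsOpenOrbitPotential Ω o ψ) :
    ∃ a : M → RSpace n, Continuous a ∧
      (∀ ζ : CSpace n, a (logParam o ζ) = hessianInvGrad ψ (onOpenOrbit o H) (reL ζ)) ∧
      (∀ z, ∀ y ∈ (ch n z).target,
        gradChart Ω H z y = fund n z y (rc (a ((ch n z).symm y)))) ∧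
      ∀ (θ : RSpace n) z, a (act (Complex.I • rc θ) z) = a z := by
  let A : M → RSpace n := fun p =>
    hessianInvGrad ψ (onOpenOrbit o H) (reL (Function.invFun (logParam (n := n) o) p))
  have hA : ∀ ζ : CSpace n, A (logParam o ζ) = hessianInvGrad ψ (onOpenOrbit o H) (reL ζ) := by
    intro ζ
    have h1 : logParam o (Function.invFun (logParam (n := n) o) (logParam o ζ)) = logParam o ζ :=
      Function.invFun_eq ⟨ζ, rfl⟩
    simp only [A, reL_eq_of_logParam_eq hM h1]
  have hAc : Continuous (A ∘ logParam (n := n) o) := by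
    have : A ∘ logParam (n := n) o =
        hessianInvGrad ψ (onOpenOrbit o H) ∘ reL := funext hA
    rw [this]
    exact (hψ.contDiff_hessianInvGrad hM (hM.contDiff_onOpenOrbit hH)).continuous.comp
      reL.continuous
  have hlim := hM.exists_tendsto_velocity hH hAc fun z ζ hζ => by
    rw [hA]; exact hψ.gradChart_eq hM hH hinv z hζ
  -- Limits exist at every point of M along the dense orbit, so the extension is continuous; the
  -- field equation and the torus invariance extend by density.
  let a : M → RSpace n := extendFrom (MulAction.orbit (CTorus n) o) A
  have hac : Continuous a := continuous_extendFrom hM.dense_orbit hlim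
  have haA : ∀ ζ : CSpace n, a (logParam o ζ) = A (logParam o ζ) := by
    intro ζ
    refine extendFrom_eq (subset_closure (logParam_mem_orbit o ζ)) ?_
    obtain ⟨L, hL⟩ := hlim (logParam o ζ)
    have hmem := logParam_mem_orbit (n := n) o ζ
    have h1 := tendsto_nhds_unique (hL.mono_left (pure_le_nhdsWithin hmem))
      (tendsto_pure_nhds A _)
    rwa [h1] at hL
  have ha : ∀ ζ : CSpace n, a (logParam o ζ) = hessianInvGrad ψ (onOpenOrbit o H) (reL ζ) :=
    fun ζ => (haA ζ).trans (hA ζ)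
  refine ⟨a, hac, ha, fun z y hy => ?_, fun θ z => ?_⟩
  · have h1 : ContinuousOn (fun y => fund n z y (rc (a ((ch n z).symm y)))) (ch n z).target :=
      (hM.contDiffOn_fund z).continuousOn.clm_apply
        (rc.continuous.comp_continuousOn (hac.comp_continuousOn (ch n z).continuousOn_symm))
    have h2 := (hM.kaehler.contDiffOn_gradChart hH z).continuousOn
    have hT := (ch n z).open_target.mem_nhds hy
    have : (𝓝[orbitChart (n := n) o z] y).NeBot :=
      mem_closure_iff_nhdsWithin_neBot.1 (hM.subset_closure_orbitChart z hy)
    refine tendsto_nhds_unique_of_eventuallyEq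
      ((h2.continuousAt hT).tendsto.mono_left (nhdsWithin_le_nhds (s := orbitChart (n := n) o z)))
      ((h1.continuousAt hT).tendsto.mono_left nhdsWithin_le_nhds) ?_
    filter_upwards [self_mem_nhdsWithin] with y' hy'
    obtain ⟨ζ, hζ, rfl⟩ := exists_logParam_of_mem_orbitChart hy'
    rw [(ch n z).left_inv hζ, ha]
    exact hψ.gradChart_eq hM hH hinv z hζ
  · refine congrFun ((hac.comp (hM.continuous_act_right _)).ext_on hM.dense_orbit hac ?_) z
    intro p hp
    rw [← range_logParam] at hp
    obtain ⟨ζ, rfl⟩ := hp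
    simp only [Function.comp]
    rw [act_logParam, ha, ha, map_add, reL_I_smul, imL_rc, neg_zero, zero_add]

end Velocity

/-! ### Hamiltonian orbits and their uniqueness -/

section HamiltonianOrbits

variable {n : ℕ} {M : Type*} [TopologicalSpace M] [ChartedSpace (CSpace n) M]
  [MulAction (CTorus n) M] [IsManifold 𝓘(ℂ, CSpace n) ω M] {Ω : TwoForm n M}

theorem fderiv_comp_chart_symm {H : M → ℝ} (hH : ContMDiff 𝓘(ℝ, CSpace n) 𝓘(ℝ, ℝ) 3 H) (z : M)
    {y : CSpace n} (hy : y ∈ (ch n z).target) (v : CSpace n) :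
    fderiv ℝ (H ∘ (ch n z).symm) y v =
      mfderiv 𝓘(ℝ, CSpace n) 𝓘(ℝ, ℝ) H ((ch n z).symm y)
        (mfderiv 𝓘(ℝ, CSpace n) 𝓘(ℝ, CSpace n) (ch n z).symm y v) := by
  have h1 : fderiv ℝ (H ∘ (ch n z).symm) y =
      (mfderiv 𝓘(ℝ, CSpace n) 𝓘(ℝ, ℝ) H ((ch n z).symm y)).comp
        (mfderiv 𝓘(ℝ, CSpace n) 𝓘(ℝ, CSpace n) (ch n z).symm y) := by
    rw [← mfderiv_eq_fderiv]
    exact mfderiv_comp y (hH.mdifferentiable (by simp) _)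
      ((chart_mdifferentiable (n := n) z).mdifferentiableAt_symm hy)
  rw [h1]
  rfl

/-- The Hamiltonian equation in a chart. -/
theorem hamiltonian_iff_chart (hΩ : IsKaehlerForm Ω) {H : M → ℝ}
    (hH : ContMDiff 𝓘(ℝ, CSpace n) 𝓘(ℝ, ℝ) 3 H) (z : M) {p : M} (hp : p ∈ (ch n z).source)
    (v : CSpace n) {u : TangentSpace 𝓘(ℝ, CSpace n) p}
    (hu : u = (mfderiv 𝓘(ℝ, CSpace n) 𝓘(ℝ, CSpace n) (ch n z).symm (ch n z p) v : CSpace n)) :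
    (∀ w : TangentSpace 𝓘(ℝ, CSpace n) p,
      Ω p ![u, w] = mfderiv 𝓘(ℝ, CSpace n) 𝓘(ℝ, ℝ) H p w) ↔ v = hamChart Ω H z (ch n z p) := by
  obtain ⟨y, hy, rfl⟩ : ∃ y ∈ (ch n z).target, p = (ch n z).symm y :=
    ⟨ch n z p, (ch n z).map_source hp, ((ch n z).left_inv hp).symm⟩
  rw [(ch n z).right_inv hy] at hu ⊢
  have key : ∀ w : CSpace n, Ω ((ch n z).symm y) ![u,
      mfderiv 𝓘(ℝ, CSpace n) 𝓘(ℝ, CSpace n) (ch n z).symm y w] = formChart Ω z y v w := by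
    intro w
    rw [formChart_apply, hu]
  constructor
  · intro h
    refine hΩ.eq_hamChart H z hy ?_
    ext w
    rw [← key, h, fderiv_comp_chart_symm hH z hy]
  · rintro rfl w
    obtain ⟨w', rfl⟩ : ∃ w' : CSpace n,
        mfderiv 𝓘(ℝ, CSpace n) 𝓘(ℝ, CSpace n) (ch n z).symm y w' = w := by
      have h1 := (chart_mdifferentiable (n := n) z).symm_comp_deriv ((ch n z).map_target hy)
      rw [(ch n z).right_inv hy] at h1
      exact ⟨_, DFunLike.congr_fun h1 w⟩
    rw [key, hΩ.formChart_hamChart H z hy, fderiv_comp_chart_symm hH z hy]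

theorem IsHamiltonianOrbit.hasDerivAt_chart (hΩ : IsKaehlerForm Ω) {H : M → ℝ}
    (hH : ContMDiff 𝓘(ℝ, CSpace n) 𝓘(ℝ, ℝ) 3 H) {z : M} {γ : ℝ → M}
    (hγ : IsHamiltonianOrbit Ω H z γ) (z' : M) {t : ℝ} (ht : γ t ∈ (ch n z').source) :
    HasDerivAt (ch n z' ∘ γ) (hamChart Ω H z' (ch n z' (γ t))) t := by
  have hd := ((mdifferentiableAt_iff_chart z' ht).1 (hγ.differentiable t)).2
  have h1 := (hamiltonian_iff_chart hΩ hH z' ht (fderiv ℝ (ch n z' ∘ γ) t (1 : ℝ))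
    (mfderiv_eq_symm_chart z' (hγ.differentiable t) ht (1 : ℝ))).1 (hγ.velocity t)
  rw [← h1]
  exact hd.hasDerivAt

theorem isHamiltonianOrbit_of_chart (hΩ : IsKaehlerForm Ω) {H : M → ℝ}
    (hH : ContMDiff 𝓘(ℝ, CSpace n) 𝓘(ℝ, ℝ) 3 H) {z : M} {γ : ℝ → M} (h0 : γ 0 = z)
    (hc : Continuous γ)
    (h : ∀ t, HasDerivAt (ch n (γ t) ∘ γ) (hamChart Ω H (γ t) (ch n (γ t) (γ t))) t) :
    IsHamiltonianOrbit Ω H z γ := by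
  have hd : MDifferentiable 𝓘(ℝ, ℝ) 𝓘(ℝ, CSpace n) γ := fun t =>
    (mdifferentiableAt_iff_chart (γ t) (mem_chart_source _ (γ t))).2
      ⟨hc.continuousAt, (h t).differentiableAt⟩
  refine ⟨h0, hd, fun t => ?_⟩
  refine (hamiltonian_iff_chart hΩ hH (γ t) (mem_chart_source _ (γ t))
    (fderiv ℝ (ch n (γ t) ∘ γ) t (1 : ℝ))
    (mfderiv_eq_symm_chart (γ t) (hd t) (mem_chart_source _ (γ t)) (1 : ℝ))).2 ?_
  exact (h t).deriv

/-- The coincidence set is closed because M is Hausdorff, and open because the field is C¹ in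
charts, hence locally Lipschitz. -/
theorem IsHamiltonianOrbit.unique [T2Space M] (hΩ : IsKaehlerForm Ω) {H : M → ℝ}
    (hH : ContMDiff 𝓘(ℝ, CSpace n) 𝓘(ℝ, ℝ) 3 H) {z : M} {γ δ : ℝ → M}
    (hγ : IsHamiltonianOrbit Ω H z γ) (hδ : IsHamiltonianOrbit Ω H z δ) : γ = δ := by
  have hγc : Continuous γ := hγ.differentiable.continuous
  have hδc : Continuous δ := hδ.differentiable.continuous
  have hcl : IsClosed {t | γ t = δ t} := isClosed_eq hγc hδc
  have hop : IsOpen {t | γ t = δ t} := by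
    rw [isOpen_iff_mem_nhds]
    intro t₀ ht₀
    set p := γ t₀ with hp
    have hps : p ∈ (ch n p).source := mem_chart_source _ p
    have hy : ch n p p ∈ (ch n p).target := (ch n p).map_source hps
    obtain ⟨K, s, hs, hK⟩ := ((hΩ.contDiffOn_hamChart hH p).contDiffAt
      ((ch n p).open_target.mem_nhds hy)).of_le (m := 1) (by norm_num) |>.exists_lipschitzOnWith
    have e1 : ∀ η : ℝ → M, IsHamiltonianOrbit Ω H z η → η t₀ = p →
        ∀ᶠ t in 𝓝 t₀, η t ∈ (ch n p).source ∧
          (HasDerivAt (ch n p ∘ η) (hamChart Ω H p ((ch n p ∘ η) t)) t ∧ (ch n p ∘ η) t ∈ s) := by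
      intro η hη h0
      have hηc : ContinuousAt η t₀ := (hη.differentiable t₀).continuousAt
      have h1 : ∀ᶠ t in 𝓝 t₀, η t ∈ (ch n p).source :=
        hηc.eventually ((ch n p).open_source.mem_nhds (by rwa [h0]))
      have h2 : Tendsto (ch n p ∘ η) (𝓝 t₀) (𝓝 (ch n p p)) := by
        have := ((ch n p).continuousAt (by rwa [h0])).tendsto.comp hηc.tendsto
        rwa [h0] at this
      filter_upwards [h1, h2.eventually hs] with t h3 h4
      exact ⟨h3, hη.hasDerivAt_chart hΩ hH p h3, h4⟩
    have h1 := e1 γ hγ rfl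
    have h2 := e1 δ hδ (Eq.symm ht₀)
    have h3 := ODE_solution_unique_of_eventually (v := fun _ => hamChart Ω H p) (s := fun _ => s)
      (.of_forall fun _ => hK) (h1.mono fun t h => h.2) (h2.mono fun t h => h.2)
      (by simp only [Function.comp]; rw [show γ t₀ = δ t₀ from ht₀])
    filter_upwards [h1, h2, h3] with t h4 h5 h6
    exact (ch n p).injOn h4.1 h5.1 h6
  have := IsClopen.eq_univ ⟨hcl, hop⟩ ⟨0, hγ.start.trans hδ.start.symm⟩
  funext t
  exact this.ge (mem_univ t)

end HamiltonianOrbits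

/-! ### Identity theorems for holomorphic maps of strips into M -/

section IdentityTheorem

variable {n : ℕ} {M : Type*} [TopologicalSpace M] [ChartedSpace (CSpace n) M]
  [IsManifold 𝓘(ℂ, CSpace n) ω M] [T2Space M]

/-- The set where the germs agree is open. At a limit point of it in U the values agree, so one
chart contains both maps nearby and the one-variable identity theorem applies. -/
theorem eqOn_of_eventuallyEq {U : Set ℂ} (hU : IsOpen U) (hUc : IsPreconnected U) {f g : ℂ → M}
    (hf : ∀ τ ∈ U, MDifferentiableAt 𝓘(ℂ, ℂ) 𝓘(ℂ, CSpace n) f τ)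
    (hg : ∀ τ ∈ U, MDifferentiableAt 𝓘(ℂ, ℂ) 𝓘(ℂ, CSpace n) g τ)
    {τ₀ : ℂ} (hτ₀ : τ₀ ∈ U) (h : f =ᶠ[𝓝 τ₀] g) : EqOn f g U := by
  let S : Set ℂ := {τ | f =ᶠ[𝓝 τ] g}
  have hS : IsOpen S := isOpen_setOfPred_eventually_nhds
  have key : closure S ∩ U ⊆ S := by
    rintro τ ⟨hτ, hτU⟩
    have hfc := (hf τ hτU).continuousAt
    have hgc := (hg τ hτU).continuousAt
    have hfreq : ∃ᶠ σ in 𝓝 τ, f =ᶠ[𝓝 σ] g := mem_closure_iff_frequently.1 hτ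
    have heq : f τ = g τ := by
      by_contra hne
      obtain ⟨σ, h1, h2⟩ := (hfreq.and_eventually ((hfc.prodMk hgc).eventually
        (isClosed_diagonal.isOpen_compl.mem_nhds (x := (f τ, g τ)) hne))).exists
      exact h2 h1.self_of_nhds
    set p := f τ with hp
    have hps : p ∈ (ch n p).source := mem_chart_source _ p
    have e1 : ∀ k : ℂ → M, (∀ τ ∈ U, MDifferentiableAt 𝓘(ℂ, ℂ) 𝓘(ℂ, CSpace n) k τ) → k τ = p →
        (∀ᶠ σ in 𝓝 τ, k σ ∈ (ch n p).source) ∧ AnalyticAt ℂ (ch n p ∘ k) τ := by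
      intro k hk h0
      have h1 : ∀ᶠ σ in 𝓝 τ, k σ ∈ (ch n p).source :=
        (hk τ hτU).continuousAt.eventually ((ch n p).open_source.mem_nhds (by rwa [h0]))
      refine ⟨h1, Complex.analyticAt_iff_eventually_differentiableAt.2 ?_⟩
      filter_upwards [h1, hU.mem_nhds hτU] with σ h2 h3
      exact ((mdifferentiableAt_complex_iff_chart p h2).1 (hk σ h3)).2
    obtain ⟨hf1, hf2⟩ := e1 f hf rfl
    obtain ⟨hg1, hg2⟩ := e1 g hg heq.symm
    by_cases hmem : τ ∈ S
    · exact hmem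
    have hfreq' : ∃ᶠ σ in 𝓝[≠] τ, (ch n p ∘ f) σ = (ch n p ∘ g) σ := by
      rw [frequently_nhdsWithin_iff]
      refine hfreq.mono fun σ hσ => ⟨?_, fun h => hmem (h ▸ hσ)⟩
      simp only [Function.comp, hσ.self_of_nhds]
    have h1 := (hf2.frequently_eq_iff_eventually_eq hg2).1 hfreq'
    change f =ᶠ[𝓝 τ] g
    filter_upwards [h1, hf1, hg1] with σ h2 h3 h4
    exact (ch n p).injOn h3 h4 h2
  exact fun τ hτ => (hUc.subset_of_closure_inter_subset hS ⟨τ₀, hτ₀, h⟩ key hτ).self_of_nhds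

/-- A holomorphic map of a half-strip which agrees with an entire map on the imaginary axis
agrees with it. -/
theorem eqOn_strip {T : ℝ} (hT : 0 < T) {f g : ℂ → M}
    (hf : MDifferentiableOn 𝓘(ℂ, ℂ) 𝓘(ℂ, CSpace n) f (strip T))
    (hg : MDifferentiable 𝓘(ℂ, ℂ) 𝓘(ℂ, CSpace n) g)
    (h : ∀ t : ℝ, f (Complex.I * t) = g (Complex.I * t)) : EqOn f g (strip T) := by
  classical
  have haxis : ∀ τ : ℂ, τ.re = 0 → f τ = g τ := by
    intro τ hτ
    have : τ = Complex.I * (τ.im : ℂ) := by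
      apply Complex.ext <;> simp [hτ]
    rw [this]; exact h _
  -- Gluing along the imaginary axis gives a holomorphic map of the half-plane re τ < T. It equals g
  -- for negative real part, and the identity theorem can start there.
  let k : ℂ → M := fun τ => if 0 ≤ τ.re then f τ else g τ
  have hkf : ∀ τ : ℂ, 0 ≤ τ.re → k τ = f τ := fun τ h => if_pos h
  have hkg : ∀ τ : ℂ, τ.re ≤ 0 → k τ = g τ := by
    intro τ h
    rcases h.eq_or_lt with h | h
    · rw [hkf _ h.ge, haxis _ h]
    · exact if_neg (not_le.2 h)
  let U : Set ℂ := {τ | τ.re < T}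
  have hU : IsOpen U := isOpen_lt Complex.continuous_re continuous_const
  have hUc : IsPreconnected U := (convex_halfSpace_re_lt T).isPreconnected
  have hkd : ∀ τ ∈ U, MDifferentiableAt 𝓘(ℂ, ℂ) 𝓘(ℂ, CSpace n) k τ := by
    intro τ hτ
    rcases lt_trichotomy τ.re 0 with h0 | h0 | h0
    · refine (hg τ).congr_of_eventuallyEq ?_
      filter_upwards [(isOpen_lt Complex.continuous_re continuous_const).mem_nhds h0] with σ hσ
      exact hkg σ (le_of_lt hσ)
    · have hkτ : k τ = g τ := hkg τ h0.le
      have hps : g τ ∈ (ch n (g τ)).source := mem_chart_source _ _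
      have hsn : strip T ∈ 𝓝[{σ | 0 ≤ σ.re}] τ := by
        filter_upwards [self_mem_nhdsWithin, mem_nhdsWithin_of_mem_nhds (hU.mem_nhds hτ)]
          with σ h1 h2
        exact ⟨h1, le_of_lt h2⟩
      have hfτ : MDifferentiableWithinAt 𝓘(ℂ, ℂ) 𝓘(ℂ, CSpace n) f {σ | 0 ≤ σ.re} τ :=
        (hf τ ⟨h0.ge, le_of_lt hτ⟩).mono_of_mem_nhdsWithin hsn
      have hkc : ContinuousAt k τ := by
        rw [← continuousWithinAt_univ, show (univ : Set ℂ) = {σ | 0 ≤ σ.re} ∪ {σ | σ.re ≤ 0} by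
          ext σ; simpa using le_total 0 σ.re]
        refine ContinuousWithinAt.union ?_ ?_
        · exact hfτ.continuousWithinAt.congr (fun σ hσ => hkf σ hσ) (hkf τ h0.ge)
        · exact (hg τ).continuousAt.continuousWithinAt.congr (fun σ hσ => hkg σ hσ) (hkg τ h0.le)
      rw [mdifferentiableAt_complex_iff_chart (g τ) (by rwa [hkτ])]
      refine ⟨hkc, ?_⟩
      have hgd : DifferentiableAt ℂ (ch n (g τ) ∘ g) τ :=
        ((mdifferentiableAt_complex_iff_chart (g τ) hps).1 (hg τ)).2
      have hfd : DifferentiableWithinAt ℂ (ch n (g τ) ∘ f) {σ | 0 ≤ σ.re} τ :=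
        mdifferentiableWithinAt_complex_chart (g τ) (by rwa [haxis τ h0]) hfτ
      have hline : ∀ (u : ℂ → CSpace n) (D : CSpace n), HasDerivWithinAt u D {σ | 0 ≤ σ.re} τ →
          HasDerivAt (fun t : ℝ => u (τ + Complex.I * t)) (Complex.I • D) 0 := by
        intro u D hD
        have h1 : HasDerivAt (fun t : ℝ => τ + Complex.I * (t : ℂ)) Complex.I 0 := by
          simpa using ((Complex.ofRealCLM.hasDerivAt (x := (0 : ℝ))).const_mul
            Complex.I).const_add τ
        have h2 : HasFDerivWithinAt u
            ((ContinuousLinearMap.toSpanSingleton ℂ D).restrictScalars ℝ) {σ | 0 ≤ σ.re}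
            (τ + Complex.I * ((0 : ℝ) : ℂ)) := by
          rw [Complex.ofReal_zero, mul_zero, add_zero]
          exact hD.hasFDerivWithinAt.restrictScalars ℝ
        have h3 := h2.comp_hasDerivWithinAt (s := univ) (0 : ℝ) h1.hasDerivWithinAt
          (fun t _ => by simp [h0])
        rw [hasDerivWithinAt_univ] at h3
        exact h3
      -- A complex derivative is determined by the derivative along the imaginary axis, where f and
      -- g coincide; so the one-sided derivatives match and the glued map is differentiable.
      have heq : derivWithin (ch n (g τ) ∘ f) {σ | 0 ≤ σ.re} τ = deriv (ch n (g τ) ∘ g) τ := by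
        have h1 := hline _ _ hfd.hasDerivWithinAt
        have h2 := hline _ _ hgd.hasDerivAt.hasDerivWithinAt
        have h3 : (fun t : ℝ => (ch n (g τ) ∘ f) (τ + Complex.I * t)) =
            fun t : ℝ => (ch n (g τ) ∘ g) (τ + Complex.I * t) := by
          ext1 t
          simp only [Function.comp]
          rw [haxis _ (by simp [h0])]
        rw [h3] at h1
        exact smul_right_injective _ Complex.I_ne_zero (h1.unique h2)
      have h1 : HasDerivWithinAt (ch n (g τ) ∘ k) (deriv (ch n (g τ) ∘ g) τ)
          {σ | 0 ≤ σ.re} τ := by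
        rw [← heq]
        refine hfd.hasDerivWithinAt.congr (fun σ hσ => ?_) ?_
        · simp only [Function.comp, hkf σ hσ]
        · simp only [Function.comp, hkf τ h0.ge]
      have h2 : HasDerivWithinAt (ch n (g τ) ∘ k) (deriv (ch n (g τ) ∘ g) τ)
          {σ | σ.re ≤ 0} τ := by
        refine hgd.hasDerivAt.hasDerivWithinAt.congr (fun σ hσ => ?_) ?_
        · simp only [Function.comp, hkg σ hσ]
        · simp only [Function.comp, hkg τ h0.le]
      have h3 := h1.union h2
      rw [show {σ : ℂ | 0 ≤ σ.re} ∪ {σ | σ.re ≤ 0} = univ by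
        ext σ; simpa using le_total 0 σ.re, hasDerivWithinAt_univ] at h3
      exact h3.differentiableAt
    · have hsn : strip T ∈ 𝓝 τ := by
        filter_upwards [(isOpen_lt continuous_const Complex.continuous_re).mem_nhds h0,
          hU.mem_nhds hτ] with σ h1 h2
        exact ⟨le_of_lt h1, le_of_lt h2⟩
      refine ((hf τ ⟨h0.le, le_of_lt hτ⟩).mdifferentiableAt hsn).congr_of_eventuallyEq ?_
      filter_upwards [hsn] with σ hσ
      exact hkf σ hσ.1
  have hkU : EqOn k g U := by
    refine eqOn_of_eventuallyEq hU hUc hkd (fun τ _ => hg τ) (τ₀ := -1) ?_ ?_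
    · change (-1 : ℂ).re < T
      simp only [Complex.neg_re, Complex.one_re]
      linarith
    · have : {σ : ℂ | σ.re < 0} ∈ 𝓝 (-1 : ℂ) :=
        (isOpen_lt Complex.continuous_re continuous_const).mem_nhds (by simp)
      filter_upwards [this] with σ hσ
      exact hkg σ (le_of_lt hσ)
  intro τ hτ
  rcases hτ.2.lt_or_eq with h1 | h1
  · rw [← hkf τ hτ.1]
    exact hkU h1
  -- The edge re τ = T lies outside the open half-plane and is reached by continuity from V.
  let V : Set ℂ := {σ | 0 ≤ σ.re ∧ σ.re < T}
  have hV : V ⊆ strip T := fun σ hσ => ⟨hσ.1, hσ.2.le⟩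
  have hcl : (𝓝[V] τ).NeBot := by
    rw [← mem_closure_iff_nhdsWithin_neBot, mem_closure_iff_frequently]
    have h2 : Tendsto (fun t : ℝ => τ - (t : ℂ)) (𝓝[>] 0) (𝓝 τ) := by
      have : Continuous fun t : ℝ => τ - (t : ℂ) := by fun_prop
      have h3 := this.tendsto 0
      simp only [Complex.ofReal_zero, sub_zero] at h3
      exact h3.mono_left nhdsWithin_le_nhds
    refine h2.frequently (Eventually.frequently ?_)
    filter_upwards [Ioo_mem_nhdsGT hT] with t ht
    constructor
    · simp only [Complex.sub_re, Complex.ofReal_re, h1]; linarith [ht.2]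
    · simp only [Complex.sub_re, Complex.ofReal_re, h1]; linarith [ht.1]
  refine tendsto_nhds_unique_of_eventuallyEq
    ((hf τ hτ).continuousWithinAt.mono hV).tendsto
    ((hg τ).continuousAt.continuousWithinAt (s := V)).tendsto ?_
  filter_upwards [self_mem_nhdsWithin] with σ hσ
  rw [← hkf σ hσ.1]
  exact hkU hσ.2

end IdentityTheorem

/-! ### The candidate Moser maps and their uniqueness -/

section MoserFlow

variable {n : ℕ} {M : Type*} [TopologicalSpace M] [ChartedSpace (CSpace n) M]
  [MulAction (CTorus n) M] [IsManifold 𝓘(ℂ, CSpace n) ω M] {Ω : TwoForm n M} {o : M}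

/-- `a` is a field of real Lie algebra elements which generates the gradient field of `H`. -/
structure IsVelocity (Ω : TwoForm n M) (H : M → ℝ) (a : M → RSpace n) : Prop where
  continuous : Continuous a
  gradChart_eq : ∀ z, ∀ y ∈ (ch n z).target,
    gradChart Ω H z y = fund n z y (rc (a ((ch n z).symm y)))
  invariant : ∀ (θ : RSpace n) z, a (act (Complex.I • rc θ) z) = a z

/-- The flow `z ↦ exp(-τ a(z)) z`. -/
def moserMap (a : M → RSpace n) (τ : ℂ) (z : M) : M := act (-τ • rc (a z)) z

theorem IsToricKaehler.mdifferentiable_act_line (hM : IsToricKaehler Ω o) (ξ : CSpace n) (z : M) :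
    MDifferentiable 𝓘(ℂ, ℂ) 𝓘(ℂ, CSpace n) fun τ : ℂ => act (-τ • ξ) z := by
  intro τ
  have h1 : MDifferentiableAt 𝓘(ℂ, CSpace n) 𝓘(ℂ, CSpace n) (fun ζ : CSpace n => act ζ z)
      (-τ • ξ) :=
    ((hM.contMDiff_act.comp (contMDiff_id.prodMk contMDiff_const)).mdifferentiable
      (by simp)) _
  have h2 : DifferentiableAt ℂ (fun τ : ℂ => -τ • ξ) τ := by fun_prop
  exact h1.comp τ h2.mdifferentiableAt

/-- For imaginary τ the curve moves inside a real torus orbit, on which a is constant. Its velocity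
is thus the fundamental vector of -i a, which is X because iX is that of a. -/
theorem IsVelocity.isHamiltonianOrbit {H : M → ℝ} {a : M → RSpace n} (ha : IsVelocity Ω H a)
    (hM : IsToricKaehler Ω o) (hH : ContMDiff 𝓘(ℝ, CSpace n) 𝓘(ℝ, ℝ) 3 H) (z : M) :
    IsHamiltonianOrbit Ω H z (fun t : ℝ => moserMap a (Complex.I * t) z) := by
  have hc : Continuous fun t : ℝ => moserMap a (Complex.I * t) z := by
    refine (hM.continuous_act_left z).comp ?_
    fun_prop
  refine isHamiltonianOrbit_of_chart hM.kaehler hH ?_ hc fun t => ?_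
  · simp only [moserMap, Complex.ofReal_zero, mul_zero, neg_zero, zero_smul, act_zero]
  set p := moserMap a (Complex.I * t) z with hp
  have hps : p ∈ (ch n p).source := mem_chart_source _ p
  have hap : a p = a z := by
    have h1 : -(Complex.I * (t : ℂ)) • rc (a z) = Complex.I • rc (-t • a z) := by
      rw [map_smul]
      ext j
      simp only [PiLp.smul_apply, smul_eq_mul, Complex.real_smul, Complex.ofReal_neg]
      ring
    rw [hp, moserMap, h1, ha.invariant]
  have h1 := (hM.hasStrictFDerivAt_act p hps).hasFDerivAt.restrictScalars ℝ
  have h2 : HasDerivAt (fun t : ℝ => -(Complex.I * (t : ℂ)) • rc (a z))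
      (-(Complex.I • rc (a z))) t := by
    have h3 : HasDerivAt (fun t : ℝ => -(Complex.I * (t : ℂ))) (-Complex.I) t := by
      have := ((Complex.ofRealCLM.hasDerivAt (x := t)).const_mul Complex.I).neg
      rwa [Complex.ofRealCLM_apply, Complex.ofReal_one, mul_one] at this
    simpa using h3.smul_const (rc (a z))
  have h3 := h1.comp_hasDerivAt t h2
  have h4 := ha.gradChart_eq p _ ((ch n p).map_source hps)
  rw [(ch n p).left_inv hps, hap] at h4
  rw [hamChart_eq, h4, ← map_smul, ← map_neg]
  exact h3

theorem IsVelocity.isMoserFamily {H : M → ℝ} {a : M → RSpace n} (ha : IsVelocity Ω H a)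
    (hM : IsToricKaehler Ω o) (hH : ContMDiff 𝓘(ℝ, CSpace n) 𝓘(ℝ, ℝ) 3 H) (T : ℝ) :
    IsMoserFamily Ω H T (moserMap a) :=
  ⟨ha.isHamiltonianOrbit hM hH, fun z =>
    (hM.mdifferentiable_act_line (rc (a z)) z).mdifferentiableOn⟩

/-- The Moser maps are unique. -/
theorem IsVelocity.eq_moserMap [T2Space M] {H : M → ℝ} {a : M → RSpace n}
    (ha : IsVelocity Ω H a) (hM : IsToricKaehler Ω o)
    (hH : ContMDiff 𝓘(ℝ, CSpace n) 𝓘(ℝ, ℝ) 3 H) {T : ℝ} (hT : 0 < T) {f : ℂ → M → M}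
    (hf : IsMoserFamily Ω H T f) (z : M) : ∀ τ ∈ strip T, f τ z = moserMap a τ z :=
  eqOn_strip hT (hf.holomorphic z) (hM.mdifferentiable_act_line (rc (a z)) z) fun t =>
    congrFun ((hf.orbit z).unique hM.kaehler hH (ha.isHamiltonianOrbit hM hH z)) t

end MoserFlow

/-! ### C¹ regularity across the zero set of an analytic function -/

section Removable

open MeasureTheory

/-- Zeros are isolated, since vanishing near one point would propagate to 0; compactness makes them
finite. -/
theorem finite_zeros_Icc {d : ℝ → ℂ} (hd : AnalyticOnNhd ℝ d (Icc 0 1)) (h0 : d 0 ≠ 0) :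
    {t ∈ Icc (0 : ℝ) 1 | d t = 0}.Finite := by
  have key : ∀ s ⊆ Icc (0 : ℝ) 1, IsCompact s → {t ∈ s | d t = 0}.Finite := by
    intro s hs hsc
    refine hsc.induction_on (p := fun s => {t ∈ s | d t = 0}.Finite) (by simp)
      (fun s t hst ht => ht.subset fun x hx => ⟨hst hx.1, hx.2⟩) (fun s t h1 h2 => ?_) ?_
    · refine (h1.union h2).subset ?_
      rintro x ⟨hx | hx, hx0⟩
      · exact .inl ⟨hx, hx0⟩
      · exact .inr ⟨hx, hx0⟩
    · intro t ht
      rcases (hd t (hs ht)).eventually_eq_zero_or_eventually_ne_zero with h | h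
      · exact absurd (hd.eqOn_zero_of_preconnected_of_eventuallyEq_zero isPreconnected_Icc (hs ht) h
          (left_mem_Icc.2 zero_le_one)) h0
      · rw [eventually_nhdsWithin_iff] at h
        refine ⟨_, mem_nhdsWithin_of_mem_nhds h, (finite_singleton t).subset ?_⟩
        rintro x ⟨hx, hx0⟩
        by_contra hne
        exact hx hne hx0
  exact key _ subset_rfl isCompact_Icc

/-- Differentiability across the zero set of an analytic function. -/
theorem hasStrictFDerivAt_of_analytic_exception {E F : Type*} [NormedAddCommGroup E]
    [NormedSpace ℝ E] [NormedAddCommGroup F] [NormedSpace ℝ F] [CompleteSpace F] {f : E → F}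
    {Λ : E → E →L[ℝ] F} {d : E → ℂ} {y₀ : E} (hf : ∀ᶠ y in 𝓝 y₀, ContinuousAt f y)
    (hΛ : ∀ᶠ y in 𝓝 y₀, ContinuousAt Λ y) (hda : AnalyticAt ℝ d y₀)
    (hdd : ∀ᶠ y in 𝓝 y₀, y ∈ closure {y | d y ≠ 0})
    (hd : ∀ᶠ y in 𝓝 y₀, d y ≠ 0 → HasFDerivAt f (Λ y) y) : HasStrictFDerivAt f (Λ y₀) y₀ := by
  refine HasStrictFDerivAt.of_isLittleO (Asymptotics.isLittleO_iff.2 fun ε hε => ?_)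
  have hε' : ∀ᶠ y in 𝓝 y₀, ‖Λ y - Λ y₀‖ ≤ ε := by
    have h1 : ContinuousAt (fun y => ‖Λ y - Λ y₀‖) y₀ :=
      (hΛ.self_of_nhds.sub continuousAt_const).norm
    have h2 : ‖Λ y₀ - Λ y₀‖ < ε := by simpa using hε
    exact (h1.eventually (gt_mem_nhds h2)).mono fun y hy => hy.le
  obtain ⟨r, hr, hball⟩ := Metric.eventually_nhds_iff_ball.1
    (hf.and (hΛ.and (hda.eventually_analyticAt.and (hdd.and (hd.and hε')))))
  -- A segment starting where d is nonzero meets the exceptional set in finitely many points, so the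
  -- fundamental theorem of calculus holds along it and bounds the remainder by the oscillation of
  -- Λ.
  have claim : ∀ y₁ ∈ Metric.ball y₀ r, ∀ y₂ ∈ Metric.ball y₀ r, d y₁ ≠ 0 →
      ‖f y₂ - f y₁ - Λ y₀ (y₂ - y₁)‖ ≤ ε * ‖y₂ - y₁‖ := by
    intro y₁ h₁ y₂ h₂ hne
    let γ : ℝ → E := fun t => y₁ + t • (y₂ - y₁)
    have hγc : Continuous γ := by fun_prop
    have hγ : ∀ t ∈ Icc (0 : ℝ) 1, γ t ∈ Metric.ball y₀ r := fun t ht =>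
      (convex_ball y₀ r).add_smul_sub_mem h₁ h₂ ht
    have hγd : ∀ t, HasDerivAt γ (y₂ - y₁) t := fun t => by
      have := ((hasDerivAt_id t).smul_const (y₂ - y₁)).const_add y₁
      rwa [one_smul] at this
    have hfin : {t ∈ Icc (0 : ℝ) 1 | (d ∘ γ) t = 0}.Finite := by
      refine finite_zeros_Icc (fun t ht => ?_) (by simpa [γ] using hne)
      refine AnalyticAt.comp (hball _ (hγ t ht)).2.2.1 ?_
      exact analyticAt_const.add (analyticAt_id.smul analyticAt_const)
    have hint := integral_eq_of_hasDerivAt_off_countable_of_le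
      (fun t => f (γ t) - t • Λ y₀ (y₂ - y₁))
      (fun t => Λ (γ t) (y₂ - y₁) - Λ y₀ (y₂ - y₁)) zero_le_one hfin.countable ?_ ?_ ?_
    · have h3 : f (γ 1) - (1 : ℝ) • Λ y₀ (y₂ - y₁) - (f (γ 0) - (0 : ℝ) • Λ y₀ (y₂ - y₁)) =
          f y₂ - f y₁ - Λ y₀ (y₂ - y₁) := by
        simp [γ]; abel
      rw [← h3, ← hint]
      have h4 := intervalIntegral.norm_integral_le_of_norm_le_const (a := 0) (b := 1)
        (f := fun t => Λ (γ t) (y₂ - y₁) - Λ y₀ (y₂ - y₁)) (C := ε * ‖y₂ - y₁‖) ?_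
      · simpa using h4
      · intro t ht
        rw [uIoc_of_le zero_le_one] at ht
        rw [← sub_apply]
        refine ((Λ (γ t) - Λ y₀).le_opNorm _).trans ?_
        exact mul_le_mul_of_nonneg_right (hball _ (hγ t ⟨ht.1.le, ht.2⟩)).2.2.2.2.2 (norm_nonneg _)
    · intro t ht
      exact ((ContinuousAt.comp (hball _ (hγ t ht)).1 hγc.continuousAt).sub
        (continuousAt_id.smul continuousAt_const)).continuousWithinAt
    · rintro t ⟨ht, htn⟩
      have ht' := Ioo_subset_Icc_self ht
      have h3 : d (γ t) ≠ 0 := fun h => htn ⟨ht', h⟩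
      have h4 := ((hball _ (hγ t ht')).2.2.2.2.1 h3).comp_hasDerivAt t (hγd t)
      have h5 := (hasDerivAt_id t).smul_const (Λ y₀ (y₂ - y₁))
      rw [one_smul] at h5
      exact h4.sub h5
    · refine ContinuousOn.intervalIntegrable ?_
      rw [uIcc_of_le zero_le_one]
      intro t ht
      exact (((ContinuousAt.comp (hball _ (hγ t ht)).2.1 hγc.continuousAt).clm_apply
        continuousAt_const).sub continuousAt_const).continuousWithinAt
  -- The condition on the starting point is removed by continuity, the good points being dense.
  have claim' : ∀ y₁ ∈ Metric.ball y₀ r, ∀ y₂ ∈ Metric.ball y₀ r,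
      ‖f y₂ - f y₁ - Λ y₀ (y₂ - y₁)‖ ≤ ε * ‖y₂ - y₁‖ := by
    intro y₁ h₁ y₂ h₂
    have h3 : (𝓝[{y | d y ≠ 0}] y₁).NeBot :=
      mem_closure_iff_nhdsWithin_neBot.1 (hball y₁ h₁).2.2.2.1
    have h4 : ContinuousAt (fun y => ‖f y₂ - f y - Λ y₀ (y₂ - y)‖) y₁ := by
      refine ((continuousAt_const.sub (hball y₁ h₁).1).sub ?_).norm
      exact ((Λ y₀).continuous.comp (continuous_const.sub continuous_id)).continuousAt
    have h5 : ContinuousAt (fun y => ε * ‖y₂ - y‖) y₁ := by fun_prop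
    refine le_of_tendsto_of_tendsto (h4.tendsto.mono_left (nhdsWithin_le_nhds (s := {y | d y ≠ 0})))
      (h5.tendsto.mono_left nhdsWithin_le_nhds) ?_
    filter_upwards [self_mem_nhdsWithin,
      mem_nhdsWithin_of_mem_nhds (Metric.isOpen_ball.mem_nhds h₁)] with y h6 h7
    exact claim y h7 y₂ h₂ h6
  have h1 : Metric.ball y₀ r ×ˢ Metric.ball y₀ r ∈ 𝓝 (y₀, y₀) :=
    prod_mem_nhds (Metric.ball_mem_nhds _ hr) (Metric.ball_mem_nhds _ hr)
  filter_upwards [h1] with p hp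
  exact claim' p.2 hp.2 p.1 hp.1

theorem contDiffAt_of_analytic_exception {E F : Type*} [NormedAddCommGroup E]
    [NormedSpace ℝ E] [NormedAddCommGroup F] [NormedSpace ℝ F] [CompleteSpace F] {f : E → F}
    {Λ : E → E →L[ℝ] F} {d : E → ℂ} {y₀ : E} (hf : ∀ᶠ y in 𝓝 y₀, ContinuousAt f y)
    (hΛ : ∀ᶠ y in 𝓝 y₀, ContinuousAt Λ y) (hda : AnalyticAt ℝ d y₀)
    (hdd : ∀ᶠ y in 𝓝 y₀, y ∈ closure {y | d y ≠ 0})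
    (hd : ∀ᶠ y in 𝓝 y₀, d y ≠ 0 → HasFDerivAt f (Λ y) y) : ContDiffAt ℝ 1 f y₀ := by
  have h : ∀ᶠ y in 𝓝 y₀, HasFDerivAt f (Λ y) y := by
    filter_upwards [hf.eventually_nhds, hΛ.eventually_nhds, hda.eventually_analyticAt,
      hdd.eventually_nhds, hd.eventually_nhds] with y h1 h2 h3 h4 h5
    exact (hasStrictFDerivAt_of_analytic_exception h1 h2 h3 h4 h5).hasFDerivAt
  exact contDiffAt_one_iff.2 ⟨Λ, _, hΛ.and h, fun y hy => hy.1.continuousWithinAt,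
    fun y hy => hy.2⟩

end Removable

/-! ### The boundary of the open orbit as an analytic zero set -/

section FundDet

variable {n : ℕ} {M : Type*} [TopologicalSpace M] [ChartedSpace (CSpace n) M]
  [MulAction (CTorus n) M] [IsManifold 𝓘(ℂ, CSpace n) ω M] {Ω : TwoForm n M} {o : M}

/-- The determinant of the fundamental vector fields in a chart. -/
def fundDet (n : ℕ) {M : Type*} [TopologicalSpace M] [ChartedSpace (CSpace n) M]
    [MulAction (CTorus n) M] (z : M) (y : CSpace n) : ℂ :=
  Matrix.det (Matrix.of fun i j : Fin n => fund n z y (EuclideanSpace.single j (1 : ℂ)) i)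

theorem fundDet_ne_zero_iff (z : M) (y : CSpace n) :
    fundDet n z y ≠ 0 ↔ Function.Injective (fund n z y) := by
  have h1 : fundDet n z y = LinearMap.det (fund n z y : CSpace n →ₗ[ℂ] CSpace n) := by
    rw [← LinearMap.det_toMatrix (EuclideanSpace.basisFun (Fin n) ℂ).toBasis, fundDet]
    congr 1
  rw [h1]
  constructor
  · intro h
    exact (LinearMap.equivOfDetNeZero _ h).injective
  · intro h h0
    have := LinearMap.bot_lt_ker_of_det_eq_zero h0
    rw [LinearMap.ker_eq_bot.2 h] at this
    exact lt_irrefl _ this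

theorem IsToricKaehler.analyticAt_fundDet (hM : IsToricKaehler Ω o) (z : M) {y : CSpace n}
    (hy : y ∈ (ch n z).target) : AnalyticAt ℝ (fundDet n z) y := by
  have hV := (hM.contDiffOn_fund z).contDiffAt ((ch n z).open_target.mem_nhds hy)
  have h1 : ContDiffAt ℂ ω (fundDet n z) y := by
    have : fundDet n z = fun y => ∑ σ : Equiv.Perm (Fin n), ((Equiv.Perm.sign σ : ℤ) : ℂ) *
        ∏ i, fund n z y (EuclideanSpace.single i (1 : ℂ)) (σ i) := by
      ext1 y
      rw [fundDet, Matrix.det_apply']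
      rfl
    rw [this]
    refine ContDiffAt.sum fun σ _ => contDiffAt_const.mul (contDiffAt_prod fun i _ => ?_)
    exact (contDiffAt_euclidean.1 (hV.clm_apply contDiffAt_const)) (σ i)
  exact (h1.restrict_scalars ℝ).analyticAt

theorem IsToricKaehler.fundDet_ne_zero_iff_mem_orbitChart [T2Space M] (hM : IsToricKaehler Ω o)
    (z : M) {y : CSpace n} (hy : y ∈ (ch n z).target) :
    fundDet n z y ≠ 0 ↔ y ∈ orbitChart (n := n) o z := by
  rw [fundDet_ne_zero_iff]
  have hs := (ch n z).map_target hy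
  constructor
  · intro h
    rw [← (ch n z).right_inv hy] at h
    exact ⟨hy, hM.mem_orbit_of_fund_injective z hs h⟩
  · intro h
    have := hM.fund_injective z hs h.2
    rwa [(ch n z).right_inv hy] at this

end FundDet

/-! ### The Moser maps are C¹ -/

section MoserDerivative

variable {n : ℕ} {M : Type*} [TopologicalSpace M] [ChartedSpace (CSpace n) M]
  [MulAction (CTorus n) M] [IsManifold 𝓘(ℂ, CSpace n) ω M] {Ω : TwoForm n M} {o : M}

theorem IsToricKaehler.fderiv_actChart_left (hM : IsToricKaehler Ω o) (z z' : M) {p : M}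
    {ζ : CSpace n} (hp : p ∈ (ch n z).source) (hp' : act ζ p ∈ (ch n z').source) (ξ : CSpace n) :
    fderiv ℂ (actChart n z z') (ζ, ch n z p) (ξ, 0) = fund n z' (ch n z' (act ζ p)) ξ := by
  have h := hM.contDiffAt_actChart z z' (p := (ζ, ch n z p)) ((ch n z).map_source hp)
    (by simpa [(ch n z).left_inv hp] using hp')
  have h1 := (h.differentiableAt (by simp)).hasFDerivAt.comp ζ
    ((hasFDerivAt_id (𝕜 := ℂ) ζ).prodMk (hasFDerivAt_const (ch n z p) ζ))
  have h2 := (hM.hasStrictFDerivAt_act z' hp').hasFDerivAt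
  have h3 : (actChart n z z') ∘ (fun η => (id η, ch n z p)) =
      fun η : CSpace n => ch n z' (act η p) := by
    ext1 η
    simp only [Function.comp, actChart, (ch n z).left_inv hp, id]
  rw [h3] at h1
  rw [← h1.unique h2]
  simp

/-- The partial derivative of the action in the direction of the manifold. -/
def actFDeriv (n : ℕ) {M : Type*} [TopologicalSpace M] [ChartedSpace (CSpace n) M]
    [MulAction (CTorus n) M] (z z' : M) (ζ y : CSpace n) : CSpace n →L[ℂ] CSpace n :=
  (fderiv ℂ (actChart n z z') (ζ, y)).comp (ContinuousLinearMap.inr ℂ _ _)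

/-- Moving the group element by ξ has the same effect as first moving the point by the fundamental
vector of ξ, so the action differential factors through its partial derivative in the point. -/
theorem IsToricKaehler.fderiv_actChart_apply (hM : IsToricKaehler Ω o) (z z' : M) {p : M}
    {ζ : CSpace n} (hp : p ∈ (ch n z).source) (hp' : act ζ p ∈ (ch n z').source) (ξ v : CSpace n) :
    fderiv ℂ (actChart n z z') (ζ, ch n z p) (ξ, v) =
      actFDeriv n z z' ζ (ch n z p) (v + fund n z (ch n z p) ξ) := by
  have h1 : (ξ, v) = (ξ, (0 : CSpace n)) + ((0 : CSpace n), v) := by simp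
  rw [h1, map_add, hM.fderiv_actChart_left z z' hp hp', ← hM.fderiv_actChart_fund z z' hp hp',
    actFDeriv, map_add, add_comm]
  rfl

/-- The partial derivative of the action of -ζ is a left inverse. -/
theorem IsToricKaehler.actFDeriv_injective (hM : IsToricKaehler Ω o) (z z' : M) {p : M}
    {ζ : CSpace n} (hp : p ∈ (ch n z).source) (hp' : act ζ p ∈ (ch n z').source) :
    Function.Injective (actFDeriv n z z' ζ (ch n z p)) := by
  have h := hM.contDiffAt_actChart z z' (p := (ζ, ch n z p)) ((ch n z).map_source hp)
    (by simpa [(ch n z).left_inv hp] using hp')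
  have h' := hM.contDiffAt_actChart z' z (p := (-ζ, ch n z' (act ζ p)))
    ((ch n z').map_source hp') (by
      rw [(ch n z').left_inv hp', act_neg_act]; exact hp)
  have e1 : actChart n z z' (ζ, ch n z p) = ch n z' (act ζ p) := by
    simp only [actChart, (ch n z).left_inv hp]
  have h1 : HasFDerivAt (fun y => actChart n z z' (ζ, y)) (actFDeriv n z z' ζ (ch n z p))
      (ch n z p) := by
    have := (h.differentiableAt (by simp)).hasFDerivAt.comp (ch n z p)
      ((hasFDerivAt_const (𝕜 := ℂ) ζ (ch n z p)).prodMk (hasFDerivAt_id (ch n z p)))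
    exact this
  have h2 : HasFDerivAt (fun y => actChart n z' z (-ζ, y))
      (actFDeriv n z' z (-ζ) (ch n z' (act ζ p))) (actChart n z z' (ζ, ch n z p)) := by
    rw [e1]
    have := (h'.differentiableAt (by simp)).hasFDerivAt.comp (ch n z' (act ζ p))
      ((hasFDerivAt_const (𝕜 := ℂ) (-ζ) (ch n z' (act ζ p))).prodMk
        (hasFDerivAt_id (ch n z' (act ζ p))))
    exact this
  have h3 := h2.comp (ch n z p) h1
  have h4 : (fun y => actChart n z' z (-ζ, y)) ∘ (fun y => actChart n z z' (ζ, y))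
      =ᶠ[𝓝 (ch n z p)] id := by
    have hc : ContinuousAt (fun y => act ζ ((ch n z).symm y)) (ch n z p) :=
      (hM.continuous_act_right ζ).continuousAt.comp
        ((ch n z).continuousAt_symm ((ch n z).map_source hp))
    filter_upwards [(ch n z).open_target.mem_nhds ((ch n z).map_source hp),
      hc.eventually ((ch n z').open_source.mem_nhds (by simpa [(ch n z).left_inv hp] using hp'))]
      with y h5 h6
    simp only [Function.comp, actChart, (ch n z').left_inv h6, act_neg_act, (ch n z).right_inv h5,
      id]
  have h5 := (h3.congr_of_eventuallyEq h4.symm).unique (hasFDerivAt_id _)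
  intro v w hvw
  have := congrArg (actFDeriv n z' z (-ζ) (ch n z' (act ζ p))) hvw
  rw [← ContinuousLinearMap.comp_apply, ← ContinuousLinearMap.comp_apply, h5] at this
  exact this

/-- The endomorphism `N` with `d f_τ = d(exp(-τ a)) ∘ (1 - τ N)`: on the open orbit, `N v` is the
fundamental vector of the derivative of `a` in the direction `v`. -/
def shear (Ω : TwoForm n M) (H : M → ℝ) (a : M → RSpace n) (z : M) (y : CSpace n) :
    CSpace n →L[ℝ] CSpace n :=
  fderiv ℝ (gradChart Ω H z) y -
    (((ContinuousLinearMap.apply ℂ (CSpace n)) (rc (a ((ch n z).symm y)))).restrictScalars ℝ).comp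
      (fderiv ℝ (fund n z) y)

/-- Only the values of a enter, never its derivative; the differentiated quantities are the gradient
field and the fundamental fields, which are C¹ on the whole chart. This makes the formula meaningful
at the boundary of the open orbit. -/
theorem IsVelocity.continuousOn_shear {H : M → ℝ} {a : M → RSpace n} (ha : IsVelocity Ω H a)
    (hM : IsToricKaehler Ω o) (hH : ContMDiff 𝓘(ℝ, CSpace n) 𝓘(ℝ, ℝ) 3 H) (z : M) :
    ContinuousOn (shear Ω H a z) (ch n z).target := by
  have hT := (ch n z).open_target
  refine ContinuousOn.sub ?_ (ContinuousOn.clm_comp ?_ ?_)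
  · exact (hM.kaehler.contDiffOn_gradChart hH z).continuousOn_fderiv_of_isOpen hT (by norm_num)
  · have h1 : Continuous fun ξ : CSpace n =>
        (((ContinuousLinearMap.apply ℂ (CSpace n)) ξ).restrictScalars ℝ :
          (CSpace n →L[ℂ] CSpace n) →L[ℝ] CSpace n) :=
      (ContinuousLinearMap.restrictScalarsL ℂ (CSpace n →L[ℂ] CSpace n) (CSpace n) ℝ ℝ).continuous.comp
        (ContinuousLinearMap.apply ℂ (CSpace n)).continuous
    exact h1.comp_continuousOn (rc.continuous.comp_continuousOn
      (ha.continuous.comp_continuousOn (ch n z).continuousOn_symm))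
  · exact ((hM.contDiffOn_fund z).restrict_scalars ℝ).continuousOn_fderiv_of_isOpen hT (by simp)

/-- The derivative of `f_τ` in charts. -/
def moserFDeriv (Ω : TwoForm n M) (H : M → ℝ) (a : M → RSpace n) (τ : ℂ) (z z' : M)
    (y : CSpace n) : CSpace n →L[ℝ] CSpace n :=
  ((actFDeriv n z z' (-τ • rc (a ((ch n z).symm y))) y).restrictScalars ℝ).comp
    (ContinuousLinearMap.id ℝ _ - τ • shear Ω H a z y)

variable [T2Space M] {α : RSpace n → RSpace n} {H : M → ℝ} {a : M → RSpace n}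

theorem IsToricKaehler.hasFDerivAt_velocity (hM : IsToricKaehler Ω o) (hα : Differentiable ℝ α)
    (haα : ∀ ζ : CSpace n, a (logParam o ζ) = α (reL ζ)) (z : M) {ζ : CSpace n}
    (hζ : logParam o ζ ∈ (ch n z).source) :
    ∃ D : CSpace n →L[ℝ] RSpace n,
      HasFDerivAt (a ∘ (ch n z).symm) D (ch n z (logParam o ζ)) ∧
      ∀ p, D (fund n z (ch n z (logParam o ζ)) p) = fderiv ℝ α (reL ζ) (reL p) := by
  obtain ⟨e, he⟩ := exists_equiv_of_injective
    (hM.fund_injective z hζ (logParam_mem_orbit o ζ))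
  have h : HasStrictFDerivAt (ch n z ∘ logParam o) (e : CSpace n →L[ℂ] CSpace n) ζ :=
    he ▸ hM.hasStrictFDerivAt_logParam z hζ
  let g := h.localInverse (ch n z ∘ logParam o) e ζ
  have hg0 : g (ch n z (logParam o ζ)) = ζ := h.localInverse_apply_image
  have hg : HasFDerivAt g ((e.symm : CSpace n →L[ℂ] CSpace n).restrictScalars ℝ)
      (ch n z (logParam o ζ)) := h.to_localInverse.hasFDerivAt.restrictScalars ℝ
  have h1 : HasFDerivAt (α ∘ reL) ((fderiv ℝ α (reL ζ)).comp reL)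
      (g (ch n z (logParam o ζ))) := by
    rw [hg0]
    exact (hα _).hasFDerivAt.comp ζ reL.hasFDerivAt
  have h2 := h1.comp _ hg
  refine ⟨_, h2.congr_of_eventuallyEq ?_, fun p => ?_⟩
  · have hgc : Tendsto g (𝓝 (ch n z (logParam o ζ))) (𝓝 ζ) := by
      have := hg.continuousAt.tendsto
      rwa [hg0] at this
    filter_upwards [h.eventually_right_inverse, hgc.eventually
      (hM.contMDiff_logParam.continuous.continuousAt.eventually
        ((ch n z).open_source.mem_nhds hζ))] with y h3 h4
    have h5 : (ch n z).symm y = logParam o (g y) := by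
      rw [← (ch n z).left_inv h4]
      exact congrArg (ch n z).symm h3.symm
    simp only [Function.comp]
    rw [h5, haα]
  · change fderiv ℝ α (reL ζ) (reL (e.symm _)) = _
    rw [← he]
    exact congrArg (fun q => fderiv ℝ α (reL ζ) (reL q)) (e.symm_apply_apply p)

/-- The Leibniz rule applied to iX = fund(a): subtracting the term in which the fundamental fields
are differentiated leaves the fundamental vector of the derivative of a. -/
theorem IsVelocity.fund_fderiv_velocity (ha : IsVelocity Ω H a) (hM : IsToricKaehler Ω o)
    (hH : ContMDiff 𝓘(ℝ, CSpace n) 𝓘(ℝ, ℝ) 3 H) (z : M) {y : CSpace n} (hy : y ∈ (ch n z).target)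
    {D : CSpace n →L[ℝ] RSpace n} (hD : HasFDerivAt (a ∘ (ch n z).symm) D y) (v : CSpace n) :
    fund n z y (rc (D v)) = shear Ω H a z y v := by
  have hTn := (ch n z).open_target.mem_nhds hy
  have hV : HasFDerivAt (fun y => (fund n z y).restrictScalars ℝ)
      ((ContinuousLinearMap.restrictScalarsL ℂ (CSpace n) (CSpace n) ℝ ℝ).comp
        (fderiv ℝ (fund n z) y)) y :=
    (ContinuousLinearMap.restrictScalarsL ℂ (CSpace n) (CSpace n) ℝ ℝ).hasFDerivAt.comp y
      (((hM.contDiffOn_fund z).contDiffAt hTn).restrict_scalars ℝ |>.differentiableAt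
        (by simp)).hasFDerivAt
  have hY := (((hM.kaehler.contDiffOn_gradChart hH z).contDiffAt hTn).differentiableAt
    (by norm_num)).hasFDerivAt
  have h1 := hV.clm_apply (rc.hasFDerivAt.comp y hD)
  have h2 : gradChart Ω H z =ᶠ[𝓝 y] fun y =>
      (fund n z y).restrictScalars ℝ (rc ((a ∘ (ch n z).symm) y)) := by
    filter_upwards [hTn] with y' hy'
    exact ha.gradChart_eq z y' hy'
  have h3 := congrArg (fun L => L v) (hY.unique (h1.congr_of_eventuallyEq h2))
  simp only [shear, sub_apply, h3]
  change _ = fund n z y (rc (D v)) + fderiv ℝ (fund n z) y v (rc (a ((ch n z).symm y))) -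
    fderiv ℝ (fund n z) y v (rc (a ((ch n z).symm y)))
  rw [add_sub_cancel_right]

theorem IsVelocity.shear_fund (ha : IsVelocity Ω H a) (hM : IsToricKaehler Ω o)
    (hH : ContMDiff 𝓘(ℝ, CSpace n) 𝓘(ℝ, ℝ) 3 H) (hα : Differentiable ℝ α)
    (haα : ∀ ζ : CSpace n, a (logParam o ζ) = α (reL ζ)) (z : M) {ζ : CSpace n}
    (hζ : logParam o ζ ∈ (ch n z).source) (p : CSpace n) :
    shear Ω H a z (ch n z (logParam o ζ)) (fund n z (ch n z (logParam o ζ)) p) =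
      fund n z (ch n z (logParam o ζ)) (rc (fderiv ℝ α (reL ζ) (reL p))) := by
  obtain ⟨D, hD, hDp⟩ := hM.hasFDerivAt_velocity hα haα z hζ
  rw [← ha.fund_fderiv_velocity hM hH z ((ch n z).map_source hζ) hD, hDp]

theorem IsVelocity.hasFDerivAt_moserMap_of_mem (ha : IsVelocity Ω H a) (hM : IsToricKaehler Ω o)
    (hH : ContMDiff 𝓘(ℝ, CSpace n) 𝓘(ℝ, ℝ) 3 H) (hα : Differentiable ℝ α)
    (haα : ∀ ζ : CSpace n, a (logParam o ζ) = α (reL ζ)) (τ : ℂ) (z z' : M) {y : CSpace n}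
    (hy : y ∈ orbitChart (n := n) o z)
    (hy' : moserMap a τ ((ch n z).symm y) ∈ (ch n z').source) :
    HasFDerivAt (ch n z' ∘ moserMap a τ ∘ (ch n z).symm) (moserFDeriv Ω H a τ z z' y) y := by
  obtain ⟨ζ, hζ, rfl⟩ := exists_logParam_of_mem_orbitChart hy
  obtain ⟨D, hD, -⟩ := hM.hasFDerivAt_velocity hα haα z hζ
  set y := ch n z (logParam o ζ) with hyd
  have hG := (hM.contDiffAt_actChart z z' (p := (-τ • rc ((a ∘ (ch n z).symm) y), y)) hy.1
    hy').differentiableAt (by simp) |>.hasFDerivAt.restrictScalars ℝ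
  have h1 : HasFDerivAt (fun y => -τ • rc ((a ∘ (ch n z).symm) y)) (-τ • rc.comp D) y :=
    (rc.hasFDerivAt.comp y hD).const_smul (-τ)
  have h2 := HasFDerivAt.comp (f := fun y => (-τ • rc ((a ∘ (ch n z).symm) y), y)) y hG
    (h1.prodMk (hasFDerivAt_id y))
  refine h2.congr_fderiv ?_
  ext1 v
  have h3 := hM.fderiv_actChart_apply z z' (p := logParam o ζ)
    (ζ := -τ • rc ((a ∘ (ch n z).symm) y)) hζ
    (by rw [← (ch n z).left_inv hζ]; exact hy') (-τ • rc (D v)) v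
  refine h3.trans ?_
  rw [map_smul, ha.fund_fderiv_velocity hM hH z hy.1 hD]
  change actFDeriv n z z' _ _ _ = actFDeriv n z z' _ _ (v - τ • shear Ω H a z y v)
  rw [neg_smul τ (shear Ω H a z y v), ← sub_eq_add_neg]
  rfl

theorem IsVelocity.continuous_moserMap (ha : IsVelocity Ω H a) (hM : IsToricKaehler Ω o) (τ : ℂ) :
    Continuous (moserMap (M := M) a τ) :=
  hM.continuous_act.comp (((rc.continuous.comp ha.continuous).const_smul (-τ)).prodMk continuous_id)

theorem IsVelocity.continuousAt_moserFDeriv (ha : IsVelocity Ω H a) (hM : IsToricKaehler Ω o)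
    (hH : ContMDiff 𝓘(ℝ, CSpace n) 𝓘(ℝ, ℝ) 3 H) (τ : ℂ) (z z' : M) {y : CSpace n}
    (hy : y ∈ (ch n z).target) (hy' : moserMap a τ ((ch n z).symm y) ∈ (ch n z').source) :
    ContinuousAt (moserFDeriv Ω H a τ z z') y := by
  have hTn := (ch n z).open_target.mem_nhds hy
  have hG := hM.contDiffAt_actChart z z' (p := (-τ • rc (a ((ch n z).symm y)), y)) hy hy'
  have h1 : ContinuousAt (fderiv ℂ (actChart n z z')) (-τ • rc (a ((ch n z).symm y)), y) :=
    (hG.fderiv_right (m := 0) (by simp)).continuousAt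
  have h2 : ContinuousAt (fun y => (-τ • rc (a ((ch n z).symm y)), y)) y :=
    (((rc.continuous.comp ha.continuous).continuousAt.comp
      ((ch n z).continuousAt_symm hy)).const_smul (-τ)).prodMk continuousAt_id
  have h3 : ContinuousAt (fun y => actFDeriv n z z' (-τ • rc (a ((ch n z).symm y))) y) y :=
    (ContinuousAt.comp (f := fun y => (-τ • rc (a ((ch n z).symm y)), y)) h1 h2).clm_comp
      continuousAt_const
  refine ContinuousAt.clm_comp ?_ (continuousAt_const.sub
    (((ha.continuousOn_shear hM hH z).continuousAt hTn).const_smul τ))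
  exact (ContinuousLinearMap.restrictScalarsL ℂ (CSpace n) (CSpace n) ℝ ℝ).continuous.continuousAt.comp h3

theorem IsVelocity.eventually_moserMap_mem (ha : IsVelocity Ω H a) (hM : IsToricKaehler Ω o)
    (τ : ℂ) (z z' : M) {y : CSpace n}
    (hy : y ∈ (ch n z).target) (hy' : moserMap a τ ((ch n z).symm y) ∈ (ch n z').source) :
    ∀ᶠ y' in 𝓝 y, y' ∈ (ch n z).target ∧ moserMap a τ ((ch n z).symm y') ∈ (ch n z').source :=
  Eventually.and ((ch n z).open_target.mem_nhds hy)
    ((ContinuousAt.comp (f := (ch n z).symm) (g := moserMap a τ)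
      (ha.continuous_moserMap hM τ).continuousAt ((ch n z).continuousAt_symm hy)).eventually
        ((ch n z').open_source.mem_nhds hy'))

/-- The candidate derivative is continuous and is the true derivative wherever `fundDet` is nonzero,
so the removability lemmas apply. -/
theorem IsVelocity.hasStrictFDerivAt_moserMap (ha : IsVelocity Ω H a) (hM : IsToricKaehler Ω o)
    (hH : ContMDiff 𝓘(ℝ, CSpace n) 𝓘(ℝ, ℝ) 3 H) (hα : Differentiable ℝ α)
    (haα : ∀ ζ : CSpace n, a (logParam o ζ) = α (reL ζ)) (τ : ℂ) (z z' : M) {y : CSpace n}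
    (hy : y ∈ (ch n z).target) (hy' : moserMap a τ ((ch n z).symm y) ∈ (ch n z').source) :
    HasStrictFDerivAt (ch n z' ∘ moserMap a τ ∘ (ch n z).symm) (moserFDeriv Ω H a τ z z' y) y ∧
      ContDiffAt ℝ 1 (ch n z' ∘ moserMap a τ ∘ (ch n z).symm) y := by
  have hev := ha.eventually_moserMap_mem hM τ z z' hy hy'
  have h1 : ∀ᶠ y' in 𝓝 y, ContinuousAt (ch n z' ∘ moserMap a τ ∘ (ch n z).symm) y' := by
    filter_upwards [hev] with y' h
    exact ContinuousAt.comp (f := moserMap a τ ∘ (ch n z).symm) (g := ch n z')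
      ((ch n z').continuousAt h.2) (ContinuousAt.comp (f := (ch n z).symm) (g := moserMap a τ)
        (ha.continuous_moserMap hM τ).continuousAt ((ch n z).continuousAt_symm h.1))
  have h2 : ∀ᶠ y' in 𝓝 y, ContinuousAt (moserFDeriv Ω H a τ z z') y' := by
    filter_upwards [hev] with y' h
    exact ha.continuousAt_moserFDeriv hM hH τ z z' h.1 h.2
  have h3 : ∀ᶠ y' in 𝓝 y, y' ∈ closure {y | fundDet n z y ≠ 0} := by
    filter_upwards [hev] with y' h
    refine closure_mono (fun u hu => ?_) (hM.subset_closure_orbitChart z h.1)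
    exact (hM.fundDet_ne_zero_iff_mem_orbitChart z hu.1).2 hu
  have h4 : ∀ᶠ y' in 𝓝 y, fundDet n z y' ≠ 0 →
      HasFDerivAt (ch n z' ∘ moserMap a τ ∘ (ch n z).symm) (moserFDeriv Ω H a τ z z' y') y' := by
    filter_upwards [hev] with y' h hne
    exact ha.hasFDerivAt_moserMap_of_mem hM hH hα haα τ z z'
      ((hM.fundDet_ne_zero_iff_mem_orbitChart z h.1).1 hne) h.2
  exact ⟨hasStrictFDerivAt_of_analytic_exception h1 h2 (hM.analyticAt_fundDet z hy) h3 h4,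
    contDiffAt_of_analytic_exception h1 h2 (hM.analyticAt_fundDet z hy) h3 h4⟩

theorem IsVelocity.contMDiff_moserMap (ha : IsVelocity Ω H a) (hM : IsToricKaehler Ω o)
    (hH : ContMDiff 𝓘(ℝ, CSpace n) 𝓘(ℝ, ℝ) 3 H) (hα : Differentiable ℝ α)
    (haα : ∀ ζ : CSpace n, a (logParam o ζ) = α (reL ζ)) (τ : ℂ) :
    ContMDiff 𝓘(ℝ, CSpace n) 𝓘(ℝ, CSpace n) 1 (moserMap (M := M) a τ) := by
  intro z
  rw [contMDiffAt_iff]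
  refine ⟨(ha.continuous_moserMap hM τ).continuousAt, ?_⟩
  have hz : (ch n z).symm (ch n z z) = z := (ch n z).left_inv (mem_chart_source _ z)
  have := (ha.hasStrictFDerivAt_moserMap hM hH hα haα τ z (moserMap a τ z)
    (mem_chart_target _ z) (by rw [hz]; exact mem_chart_source _ _)).2
  simpa using this.contDiffWithinAt

theorem IsVelocity.isTGood (ha : IsVelocity Ω H a) (hM : IsToricKaehler Ω o)
    (hH : ContMDiff 𝓘(ℝ, CSpace n) 𝓘(ℝ, ℝ) 3 H) (hα : Differentiable ℝ α)
    (haα : ∀ ζ : CSpace n, a (logParam o ζ) = α (reL ζ)) (T : ℝ) : IsTGood Ω H T :=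
  ⟨moserMap a, ha.isMoserFamily hM hH T, fun τ _ => ha.contMDiff_moserMap hM hH hα haα τ⟩

end MoserDerivative

/-! ### Differentiable convex functions -/

section ConvexGeneral

variable {V : Type*} [NormedAddCommGroup V] [InnerProductSpace ℝ V]

theorem hasDerivAt_line (y d : V) (t : ℝ) : HasDerivAt (fun t : ℝ => y + t • d) d t := by
  have := ((hasDerivAt_id t).smul_const d).const_add y
  rwa [one_smul] at this

/-- The gradient inequality for convex functions. -/
theorem le_of_convexOn_of_hasFDerivAt {R : Set V} {u : V → ℝ} (hu : ConvexOn ℝ R u) {y y' θ : V}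
    (hy : y ∈ R) (hy' : y' ∈ R) (hd : HasFDerivAt u (innerSL ℝ θ) y) :
    u y + inner ℝ θ (y' - y) ≤ u y' := by
  have h0 : HasFDerivAt u (innerSL ℝ θ) (y + (0 : ℝ) • (y' - y)) := by rwa [zero_smul, add_zero]
  have h1 : HasDerivAt (fun t : ℝ => u (y + t • (y' - y))) (inner ℝ θ (y' - y)) 0 := by
    have := HasFDerivAt.comp_hasDerivAt (f := fun t : ℝ => y + t • (y' - y)) (0 : ℝ) h0
      (hasDerivAt_line y (y' - y) 0)
    exact this
  have h2 := h1.tendsto_slope_zero_right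
  have h3 : inner ℝ θ (y' - y) ≤ u y' - u y := by
    refine le_of_tendsto h2 ?_
    filter_upwards [Ioo_mem_nhdsGT (zero_lt_one' ℝ)] with t ht
    have h4 := hu.2 hy hy' (sub_nonneg.2 ht.2.le) ht.1.le (by ring : 1 - t + t = 1)
    have h5 : (1 - t) • y + t • y' = y + t • (y' - y) := by module
    rw [h5] at h4
    simp only [zero_add, zero_smul, add_zero, smul_eq_mul] at h4 ⊢
    rw [inv_mul_le_iff₀ ht.1]
    linarith
  linarith

theorem inner_sub_nonneg_of_convexOn {R : Set V} {u : V → ℝ} (hu : ConvexOn ℝ R u) {y y' θ θ' : V}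
    (hy : y ∈ R) (hy' : y' ∈ R) (hd : HasFDerivAt u (innerSL ℝ θ) y)
    (hd' : HasFDerivAt u (innerSL ℝ θ') y') : 0 ≤ inner ℝ (θ' - θ) (y' - y) := by
  have h1 := le_of_convexOn_of_hasFDerivAt hu hy hy' hd
  have h2 := le_of_convexOn_of_hasFDerivAt hu hy' hy hd'
  rw [← neg_sub y' y, inner_neg_right] at h2
  rw [inner_sub_left]
  linarith

theorem convexOn_of_hasFDerivAt {R : Set V} (hR : Convex ℝ R) {u : V → ℝ} {θ : V → V}
    {B : V → V →L[ℝ] V} (hu : ∀ y ∈ R, HasFDerivAt u (innerSL ℝ (θ y)) y)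
    (hθ : ∀ y ∈ R, HasFDerivAt θ (B y) y) (hB : ∀ y ∈ R, ∀ d, 0 ≤ inner ℝ (B y d) d) :
    ConvexOn ℝ R u := by
  refine ⟨hR, fun x hx y hy a b ha hb hab => ?_⟩
  have hmem : ∀ t ∈ Icc (0 : ℝ) 1, x + t • (y - x) ∈ R := fun t ht =>
    hR.add_smul_sub_mem hx hy ht
  have h1 : ∀ t ∈ Icc (0 : ℝ) 1, HasDerivAt (fun t : ℝ => u (x + t • (y - x)))
      (inner ℝ (θ (x + t • (y - x))) (y - x)) t := fun t ht => by
    have := HasFDerivAt.comp_hasDerivAt (f := fun t : ℝ => x + t • (y - x)) t (hu _ (hmem t ht))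
      (hasDerivAt_line x (y - x) t)
    exact this
  have h2 : ∀ t ∈ Icc (0 : ℝ) 1, HasDerivAt (fun t : ℝ => inner ℝ (θ (x + t • (y - x))) (y - x))
      (inner ℝ (B (x + t • (y - x)) (y - x)) (y - x)) t := fun t ht => by
    have := ((hθ _ (hmem t ht)).comp_hasDerivAt t (hasDerivAt_line x (y - x) t)).inner ℝ
      (hasDerivAt_const t (y - x))
    simpa using this
  have hmono : MonotoneOn (fun t : ℝ => inner ℝ (θ (x + t • (y - x))) (y - x)) (Icc 0 1) := by
    refine monotoneOn_of_deriv_nonneg (convex_Icc 0 1)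
      (fun t ht => (h2 t ht).continuousAt.continuousWithinAt)
      (fun t ht => (h2 t (interior_subset ht)).differentiableAt.differentiableWithinAt)
      fun t ht => ?_
    rw [(h2 t (interior_subset ht)).deriv]
    exact hB _ (hmem t (interior_subset ht)) _
  have hconv : ConvexOn ℝ (Icc (0 : ℝ) 1) (fun t : ℝ => u (x + t • (y - x))) := by
    refine MonotoneOn.convexOn_of_deriv (convex_Icc 0 1)
      (fun t ht => (h1 t ht).continuousAt.continuousWithinAt)
      (fun t ht => (h1 t (interior_subset ht)).differentiableAt.differentiableWithinAt) ?_
    intro t ht t' ht' htt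
    rw [(h1 t (interior_subset ht)).deriv, (h1 t' (interior_subset ht')).deriv]
    exact hmono (interior_subset ht) (interior_subset ht') htt
  have h3 := hconv.2 (left_mem_Icc.2 zero_le_one) (right_mem_Icc.2 zero_le_one) ha hb hab
  have h4 : x + b • (y - x) = a • x + b • y := by
    rw [← eq_sub_iff_add_eq] at hab
    rw [hab]
    module
  simpa [h4] using h3

/-- A strict minimum leaves a gap c > 0 on the compact unit sphere around x₀, and convexity along
rays turns this gap into growth at rate c. -/
theorem tendsto_atTop_of_convexOn [FiniteDimensional ℝ V] {f : V → ℝ} (hf : ConvexOn ℝ univ f)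
    (hc : Continuous f) {x₀ : V} (h0 : ∀ x, x ≠ x₀ → f x₀ < f x) :
    Tendsto f (cocompact V) atTop := by
  have hsph : IsCompact (Metric.sphere x₀ 1) := isCompact_sphere x₀ 1
  obtain ⟨c, hc0, hcb⟩ : ∃ c > 0, ∀ x ∈ Metric.sphere x₀ 1, f x₀ + c ≤ f x := by
    rcases (Metric.sphere x₀ (1 : ℝ)).eq_empty_or_nonempty with he | hne
    · exact ⟨1, one_pos, fun x hx => by rw [he] at hx; exact absurd hx (notMem_empty x)⟩
    · obtain ⟨m, hm, hmin⟩ := hsph.exists_isMinOn hne hc.continuousOn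
      refine ⟨f m - f x₀, sub_pos.2 (h0 m fun h => ?_), fun x hx => ?_⟩
      · rw [h, mem_sphere_iff_norm, sub_self, norm_zero] at hm
        exact zero_ne_one hm
      · have := hmin hx
        simp only [mem_ofPred_eq] at this
        linarith
  have hgrow : ∀ x, f x₀ + c * (‖x - x₀‖ - 1) ≤ f x := by
    intro x
    rcases lt_or_ge ‖x - x₀‖ 1 with hlt | hge
    · have h1 : f x₀ ≤ f x := by
        rcases eq_or_ne x x₀ with rfl | hne
        · exact le_rfl
        · exact (h0 x hne).le
      nlinarith
    · set r := ‖x - x₀‖ with hr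
      have hr0 : 0 < r := by linarith
      have hmem : x₀ + r⁻¹ • (x - x₀) ∈ Metric.sphere x₀ 1 := by
        rw [mem_sphere_iff_norm, add_sub_cancel_left, norm_smul, norm_inv, norm_norm,
          inv_mul_cancel₀ hr0.ne']
      have h1 := hcb _ hmem
      have h2 := hf.2 (mem_univ x₀) (mem_univ x) (sub_nonneg.2 (inv_le_one_of_one_le₀ hge))
        (inv_nonneg.2 hr0.le) (by ring : 1 - r⁻¹ + r⁻¹ = 1)
      have h3 : (1 - r⁻¹) • x₀ + r⁻¹ • x = x₀ + r⁻¹ • (x - x₀) := by module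
      rw [h3] at h2
      simp only [smul_eq_mul] at h2
      have h4 : c ≤ r⁻¹ * (f x - f x₀) := by linarith
      rw [le_inv_mul_iff₀ hr0] at h4
      nlinarith
  refine tendsto_atTop_mono hgrow ?_
  refine tendsto_atTop_add_const_left _ _ (Tendsto.const_mul_atTop hc0 ?_)
  refine tendsto_atTop_add_const_right _ _ ?_
  have h1 : Tendsto (fun x : V => ‖x‖ - ‖x₀‖) (cocompact V) atTop :=
    tendsto_atTop_add_const_right _ _ tendsto_norm_cocompact_atTop
  exact tendsto_atTop_mono (fun x => norm_sub_norm_le x x₀) h1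

end ConvexGeneral

/-- A strictly convex potential `ψ`, and a velocity field `α` with `∇²ψ α = ∇h`. -/
structure IsMoserData {n : ℕ} (ψ h : RSpace n → ℝ) (α : RSpace n → RSpace n) : Prop where
  smooth : ContDiff ℝ 3 ψ
  hess_pos : ∀ x v, v ≠ 0 → 0 < inner ℝ (hess ψ x v) v
  smooth_right : ContDiff ℝ 1 h
  smooth_velocity : ContDiff ℝ 2 α
  hess_velocity : ∀ x, hess ψ x (α x) = gradient h x

/-! ### Legendre duality for the potential and the velocity -/

namespace IsMoserData

variable {n : ℕ} {ψ h : RSpace n → ℝ} {α : RSpace n → RSpace n}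

theorem contDiff_two (hd : IsMoserData ψ h α) : ContDiff ℝ 2 ψ := hd.smooth.of_le (by norm_num)

theorem hasFDerivAt_velocity (hd : IsMoserData ψ h α) (x : RSpace n) :
    HasFDerivAt α (fderiv ℝ α x) x :=
  (hd.smooth_velocity.differentiable (by norm_num) x).hasFDerivAt

theorem hasFDerivAt_potential (hd : IsMoserData ψ h α) (x : RSpace n) :
    HasFDerivAt ψ (innerSL ℝ (gradient ψ x)) x := by
  refine (hd.smooth.differentiable (by norm_num) x).hasFDerivAt.congr_fderiv ?_
  ext1 v
  exact fderiv_eq_inner_gradient ψ x v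

theorem hasFDerivAt_right (hd : IsMoserData ψ h α) (x : RSpace n) :
    HasFDerivAt h (innerSL ℝ (gradient h x)) x := by
  refine (hd.smooth_right.differentiable (by norm_num) x).hasFDerivAt.congr_fderiv ?_
  ext1 v
  exact fderiv_eq_inner_gradient h x v

theorem inner_velocity_hess (hd : IsMoserData ψ h α) (x v : RSpace n) :
    inner ℝ (α x) (hess ψ x v) = inner ℝ (gradient h x) v := by
  rw [real_inner_comm, hess_symm hd.contDiff_two, hd.hess_velocity]

/-- The derivative of the velocity is symmetric with respect to the Hessian metric. -/
theorem inner_fderiv_velocity_symm (hd : IsMoserData ψ h α) (x v w : RSpace n) :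
    inner ℝ (fderiv ℝ α x v) (hess ψ x w) = inner ℝ (fderiv ℝ α x w) (hess ψ x v) := by
  -- The function ⟨α, ∇ψ - p⟩ - h has differential ⟨∇ψ - p, Dα ·⟩. With p = ∇ψ(x), the second
  -- derivative of α drops out at x, and symmetry of the Hessian of this function is the claim.
  let p := gradient ψ x
  have hg : ∀ y, HasFDerivAt (fun y => gradient ψ y - p) (hess ψ y) y := fun y =>
    (hasFDerivAt_gradient hd.contDiff_two y).sub_const p
  have hk : ∀ y, HasFDerivAt (fun y => inner ℝ (α y) (gradient ψ y - p) - h y)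
      ((innerSL ℝ (gradient ψ y - p)).comp (fderiv ℝ α y)) y := by
    intro y
    refine (((hd.hasFDerivAt_velocity y).inner ℝ (hg y)).sub
      (hd.hasFDerivAt_right y)).congr_fderiv ?_
    ext1 v
    have h1 := hd.inner_velocity_hess y v
    simp only [sub_apply, ContinuousLinearMap.comp_apply, ContinuousLinearMap.prod_apply,
      fderivInnerCLM_apply, innerSL_apply_apply, h1]
    rw [real_inner_comm (gradient ψ y - p)]
    ring
  have hα2 : HasFDerivAt (fderiv ℝ α) (fderiv ℝ (fderiv ℝ α) x) x :=
    ((hd.smooth_velocity.fderiv_right (m := 1) (by norm_num)).differentiable (by norm_num)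
      x).hasFDerivAt
  have hk2 := ((innerSL ℝ (E := RSpace n)).hasFDerivAt.comp x (hg x)).clm_comp hα2
  have h1 := second_derivative_symmetric (𝕜 := ℝ) hk hk2 w v
  have h2 : gradient ψ x - p = 0 := sub_self _
  simp [h2] at h1
  have h3 : inner ℝ (hess ψ x w) (fderiv ℝ α x v) = inner ℝ (hess ψ x v) (fderiv ℝ α x w) := h1
  rw [real_inner_comm, h3, real_inner_comm]

theorem inner_gradient_sub_pos (hd : IsMoserData ψ h α) {x x' : RSpace n} (hne : x ≠ x') :
    0 < inner ℝ (gradient ψ x' - gradient ψ x) (x' - x) := by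
  have h1 : ∀ t : ℝ, HasDerivAt (fun t : ℝ => inner ℝ (gradient ψ (x + t • (x' - x))) (x' - x))
      (inner ℝ (hess ψ (x + t • (x' - x)) (x' - x)) (x' - x)) t := fun t => by
    have := ((hasFDerivAt_gradient hd.contDiff_two _).comp_hasDerivAt t
      (hasDerivAt_line x (x' - x) t)).inner ℝ (hasDerivAt_const t (x' - x))
    simpa using this
  have h2 : StrictMono (fun t : ℝ => inner ℝ (gradient ψ (x + t • (x' - x))) (x' - x)) :=
    strictMono_of_deriv_pos fun t => by
      rw [(h1 t).deriv]
      exact hd.hess_pos _ _ (sub_ne_zero.2 hne.symm)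
  have h3 := h2 zero_lt_one
  simp only [zero_smul, add_zero, one_smul, add_sub_cancel] at h3
  rw [inner_sub_left]
  linarith

theorem gradient_injective (hd : IsMoserData ψ h α) : Function.Injective (gradient ψ) := by
  intro x x' hxx
  by_contra hne
  have := hd.inner_gradient_sub_pos hne
  rw [hxx, sub_self, inner_zero_left] at this
  exact lt_irrefl _ this

theorem convexOn (hd : IsMoserData ψ h α) : ConvexOn ℝ univ ψ :=
  (strictConvexOn_of_hess_pos hd.contDiff_two hd.hess_pos).convexOn

theorem legendre_gradient (hd : IsMoserData ψ h α) (x : RSpace n) :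
    legendre ψ (gradient ψ x) = inner ℝ x (gradient ψ x) - ψ x := by
  have hb : ∀ x', inner ℝ x' (gradient ψ x) - ψ x' ≤ inner ℝ x (gradient ψ x) - ψ x := by
    intro x'
    have := le_of_convexOn_of_hasFDerivAt hd.convexOn (mem_univ x) (mem_univ x')
      (hd.hasFDerivAt_potential x)
    rw [inner_sub_right, real_inner_comm x', real_inner_comm x] at this
    linarith
  exact le_antisymm (ciSup_le hb) (le_ciSup (f := fun x' => inner ℝ x' (gradient ψ x) - ψ x')
    ⟨_, forall_mem_range.2 hb⟩ x)

theorem exists_equiv_hess (hd : IsMoserData ψ h α) (x : RSpace n) :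
    ∃ e : RSpace n ≃L[ℝ] RSpace n, (e : RSpace n →L[ℝ] RSpace n) = hess ψ x := by
  have hinj : Function.Injective (hess ψ x : RSpace n →ₗ[ℝ] RSpace n) := by
    rw [injective_iff_map_eq_zero]
    intro v hv
    by_contra hne
    have := hd.hess_pos x v hne
    rw [show hess ψ x v = 0 from hv, inner_zero_left] at this
    exact lt_irrefl _ this
  exact ⟨(LinearEquiv.ofInjectiveEndo _ hinj).toContinuousLinearEquiv, rfl⟩

theorem invFun_gradient (hd : IsMoserData ψ h α) (x : RSpace n) :
    Function.invFun (gradient ψ) (gradient ψ x) = x :=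
  Function.leftInverse_invFun hd.gradient_injective x

theorem hasStrictFDerivAt_gradient (hd : IsMoserData ψ h α) (x : RSpace n) :
    HasStrictFDerivAt (gradient ψ) (hess ψ x) x :=
  (contDiff_gradient (m := 1) hd.contDiff_two (by norm_num)).contDiffAt.hasStrictFDerivAt
    (by norm_num)

theorem range_gradient_mem_nhds (hd : IsMoserData ψ h α) (x : RSpace n) :
    range (gradient ψ) ∈ 𝓝 (gradient ψ x) := by
  obtain ⟨e, he⟩ := hd.exists_equiv_hess x
  have h1 := hd.hasStrictFDerivAt_gradient x
  rw [← he] at h1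
  rw [← h1.map_nhds_eq_of_equiv]
  exact range_mem_map

theorem hasFDerivAt_invFun (hd : IsMoserData ψ h α) {x : RSpace n} {e : RSpace n ≃L[ℝ] RSpace n}
    (he : (e : RSpace n →L[ℝ] RSpace n) = hess ψ x) :
    HasFDerivAt (Function.invFun (gradient ψ)) (e.symm : RSpace n →L[ℝ] RSpace n)
      (gradient ψ x) := by
  have h1 := hd.hasStrictFDerivAt_gradient x
  rw [← he] at h1
  refine h1.to_localInverse.hasFDerivAt.congr_of_eventuallyEq ?_
  filter_upwards [h1.eventually_right_inverse] with y hy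
  rw [← hy, hd.invFun_gradient, hy]

/-- The map `κ = id - s α`. -/
theorem hasFDerivAt_shift (hd : IsMoserData ψ h α) (s : ℝ) (x : RSpace n) :
    HasFDerivAt (fun x => x - s • α x) (ContinuousLinearMap.id ℝ _ - s • fderiv ℝ α x) x :=
  (hasFDerivAt_id x).sub ((hd.hasFDerivAt_velocity x).const_smul s)

/-- Pulled back by ∇ψ the function is ⟨x, ∇ψ⟩ - ψ - s h, with differential ⟨x - sα, ∇²ψ ·⟩ because
∇h = ∇²ψ α; the inverse of ∇ψ cancels the Hessian. -/
theorem hasFDerivAt_dual (hd : IsMoserData ψ h α) (s : ℝ) (x : RSpace n) :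
    HasFDerivAt (fun y => legendre ψ y - s * h (Function.invFun (gradient ψ) y))
      (innerSL ℝ (x - s • α x)) (gradient ψ x) := by
  obtain ⟨e, he⟩ := hd.exists_equiv_hess x
  have h1 : HasFDerivAt (fun x => inner ℝ x (gradient ψ x) - ψ x - s * h x)
      ((innerSL ℝ (x - s • α x)).comp (hess ψ x)) x := by
    refine ((((hasFDerivAt_id x).inner ℝ (hasFDerivAt_gradient hd.contDiff_two x)).sub
      (hd.hasFDerivAt_potential x)).sub ((hd.hasFDerivAt_right x).const_mul s)).congr_fderiv ?_
    ext1 v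
    simp only [sub_apply, ContinuousLinearMap.comp_apply, ContinuousLinearMap.prod_apply,
      fderivInnerCLM_apply, innerSL_apply_apply, smul_apply, inner_sub_left,
      real_inner_smul_left, hd.inner_velocity_hess, id, ContinuousLinearMap.id_apply, smul_eq_mul]
    rw [real_inner_comm v]
    ring
  have h2 : HasFDerivAt (fun x => inner ℝ x (gradient ψ x) - ψ x - s * h x)
      ((innerSL ℝ (x - s • α x)).comp (hess ψ x)) (Function.invFun (gradient ψ) (gradient ψ x)) := by
    rwa [hd.invFun_gradient]
  have h3 := h2.comp (gradient ψ x) (hd.hasFDerivAt_invFun he)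
  refine (h3.congr_of_eventuallyEq ?_).congr_fderiv ?_
  · filter_upwards [hd.range_gradient_mem_nhds x] with y hy
    obtain ⟨x', rfl⟩ := hy
    simp only [Function.comp, hd.invFun_gradient, hd.legendre_gradient]
  · ext1 v
    change inner ℝ _ (hess ψ x (e.symm v)) = inner ℝ _ v
    rw [← he]
    exact congrArg _ (e.apply_symm_apply v)

theorem sub_inner_gradient_lt (hd : IsMoserData ψ h α) {x₀ x : RSpace n} (hne : x ≠ x₀) :
    ψ x₀ - inner ℝ (gradient ψ x₀) x₀ < ψ x - inner ℝ (gradient ψ x₀) x := by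
  have h1 := le_of_convexOn_of_hasFDerivAt hd.convexOn (mem_univ x₀) (mem_univ x)
    (hd.hasFDerivAt_potential x₀)
  rw [inner_sub_right] at h1
  refine lt_of_le_of_ne (by linarith) fun heq => hne ?_
  refine (strictConvexOn_of_hess_pos hd.contDiff_two hd.hess_pos).sub_concaveOn
    ((innerSL ℝ (gradient ψ x₀) : RSpace n →L[ℝ] ℝ).toLinearMap.concaveOn convex_univ)
    |>.eq_of_isMinOn (x := x) (y := x₀) ?_ ?_ (mem_univ _) (mem_univ _)
  · intro x' _
    have h2 := le_of_convexOn_of_hasFDerivAt hd.convexOn (mem_univ x₀) (mem_univ x')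
      (hd.hasFDerivAt_potential x₀)
    rw [inner_sub_right] at h2
    change ψ x - inner ℝ (gradient ψ x₀) x ≤ ψ x' - inner ℝ (gradient ψ x₀) x'
    linarith
  · intro x' _
    have h2 := le_of_convexOn_of_hasFDerivAt hd.convexOn (mem_univ x₀) (mem_univ x')
      (hd.hasFDerivAt_potential x₀)
    rw [inner_sub_right] at h2
    change ψ x₀ - inner ℝ (gradient ψ x₀) x₀ ≤ ψ x' - inner ℝ (gradient ψ x₀) x'
    linarith

theorem tendsto_sub_inner_gradient (hd : IsMoserData ψ h α) (x₀ : RSpace n) :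
    Tendsto (fun x => ψ x - inner ℝ (gradient ψ x₀) x) (cocompact _) atTop :=
  tendsto_atTop_of_convexOn
    (hd.convexOn.sub ((innerSL ℝ (gradient ψ x₀) : RSpace n →L[ℝ] ℝ).toLinearMap.concaveOn
      convex_univ))
    (hd.smooth.continuous.sub (continuous_const.inner continuous_id))
    fun _ hx => hd.sub_inner_gradient_lt hx

/-- For a point y of an open segment between two gradients, ψ - ⟨y, ·⟩ is a positive multiple of a
proper function plus one bounded below. So it attains a minimum, and there ∇ψ = y. -/
theorem convex_range_gradient (hd : IsMoserData ψ h α) : Convex ℝ (range (gradient ψ)) := by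
  rw [convex_iff_openSegment_subset]
  rintro _ ⟨x₀, rfl⟩ _ ⟨x₁, rfl⟩ _ ⟨a, b, ha, hb, hab, rfl⟩
  have hc : ∀ p : RSpace n, Continuous fun x => ψ x - inner ℝ p x := fun p =>
    hd.smooth.continuous.sub (continuous_const.inner continuous_id)
  set y := a • gradient ψ x₀ + b • gradient ψ x₁ with hy
  have hlim : Tendsto (fun x => ψ x - inner ℝ y x) (cocompact _) atTop := by
    have h1 := hd.tendsto_sub_inner_gradient x₀
    have h2 : ∀ x, a * (ψ x - inner ℝ (gradient ψ x₀) x) +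
        b * (ψ x₁ - inner ℝ (gradient ψ x₁) x₁) ≤ ψ x - inner ℝ y x := by
      intro x
      have h3 : ψ x₁ - inner ℝ (gradient ψ x₁) x₁ ≤ ψ x - inner ℝ (gradient ψ x₁) x := by
        rcases eq_or_ne x x₁ with rfl | hne
        · exact le_rfl
        · exact (hd.sub_inner_gradient_lt hne).le
      have h4 : ψ x - inner ℝ y x = a * (ψ x - inner ℝ (gradient ψ x₀) x) +
          b * (ψ x - inner ℝ (gradient ψ x₁) x) := by
        rw [hy, inner_add_left, real_inner_smul_left, real_inner_smul_left]
        linear_combination (-(ψ x)) * hab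
      rw [h4]
      nlinarith
    refine tendsto_atTop_mono h2 (tendsto_atTop_add_const_right _ _ (h1.const_mul_atTop ha))
  obtain ⟨x, hx⟩ := (hc y).exists_forall_le hlim
  refine ⟨x, ?_⟩
  have h1 : HasFDerivAt (fun x => ψ x - inner ℝ y x) (innerSL ℝ (gradient ψ x) - innerSL ℝ y) x :=
    (hd.hasFDerivAt_potential x).sub (innerSL ℝ y).hasFDerivAt
  have h2 : IsLocalMin (fun x => ψ x - inner ℝ y x) x := .of_forall hx
  have h3 := h2.hasFDerivAt_eq_zero h1
  rw [← map_sub] at h3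
  have h4 := congrArg (fun L => L (gradient ψ x - y)) h3
  simp only [innerSL_apply_apply, zero_apply, inner_self_eq_zero] at h4
  exact sub_eq_zero.1 h4

end IsMoserData

/-! ### Second variations and quadratic forms -/

theorem deriv_deriv_nonneg_of_forall_le {e e' : ℝ → ℝ} {D : ℝ} (he : ∀ t, HasDerivAt e (e' t) t)
    (hd : HasDerivAt e' D 0) (hmin : ∀ t, e 0 ≤ e t) : 0 ≤ D := by
  by_contra hneg
  push Not at hneg
  have hde : deriv e = e' := funext fun t => (he t).deriv
  have h0 : e' 0 = 0 := (show IsLocalMin e 0 from .of_forall hmin).hasDerivAt_eq_zero (he 0)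
  have h1 : IsLocalMax e 0 := isLocalMax_of_deriv_deriv_neg (by rw [hde, hd.deriv]; exact hneg)
    (by rw [hde, h0]) (he 0).continuousAt
  have h2 : e =ᶠ[𝓝 0] fun _ => e 0 := by
    filter_upwards [h1] with t ht
    exact le_antisymm ht (hmin t)
  have h3 : e' =ᶠ[𝓝 0] fun _ => 0 := by
    have := h2.deriv
    rw [hde] at this
    simpa using this
  have h4 := hd.unique ((hasDerivAt_const (0 : ℝ) (0 : ℝ)).congr_of_eventuallyEq h3)
  rw [h4] at hneg
  exact lt_irrefl _ hneg

/-- The second variation at a minimum, for a differential of the form `⟨g, L ·⟩` with `g = 0` at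
the minimum. -/
theorem inner_nonneg_of_forall_le {V : Type*} [NormedAddCommGroup V] [InnerProductSpace ℝ V]
    {E : V → ℝ} {g : V → V} {L : V → V →L[ℝ] V} {x : V} {g' : V →L[ℝ] V}
    (hE : ∀ x, HasFDerivAt E ((innerSL ℝ (g x)).comp (L x)) x) (hmin : ∀ y, E x ≤ E y)
    (hg0 : g x = 0) (hg : HasFDerivAt g g' x) (hL : DifferentiableAt ℝ L x) (v : V) :
    0 ≤ inner ℝ (g' v) (L x v) := by
  have hx0 : x + (0 : ℝ) • v = x := by rw [zero_smul, add_zero]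
  have he : ∀ t, HasDerivAt (fun t : ℝ => E (x + t • v))
      (inner ℝ (g (x + t • v)) (L (x + t • v) v)) t := fun t => by
    have := HasFDerivAt.comp_hasDerivAt (f := fun t : ℝ => x + t • v) t (hE (x + t • v))
      (hasDerivAt_line x v t)
    exact this
  have h1 : HasDerivAt (fun t : ℝ => g (x + t • v)) (g' v) 0 := by
    have := HasFDerivAt.comp_hasDerivAt (f := fun t : ℝ => x + t • v) (0 : ℝ)
      (by rw [hx0]; exact hg) (hasDerivAt_line x v 0)
    exact this
  have h2 : HasDerivAt (fun t : ℝ => L (x + t • v)) (fderiv ℝ L x v) 0 := by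
    have := HasFDerivAt.comp_hasDerivAt (f := fun t : ℝ => x + t • v) (0 : ℝ)
      (by rw [hx0]; exact hL.hasFDerivAt) (hasDerivAt_line x v 0)
    exact this
  have h3 := h1.inner ℝ (h2.clm_apply (hasDerivAt_const (0 : ℝ) v))
  rw [hx0, hg0, inner_zero_left, zero_add] at h3
  exact deriv_deriv_nonneg_of_forall_le he h3 fun t => by rw [hx0]; exact hmin _

theorem eq_zero_of_forall_nonneg_quadratic {b c : ℝ} (h : ∀ t : ℝ, 0 ≤ 2 * t * b + t ^ 2 * c) :
    b = 0 := by
  by_contra hb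
  -- A step opposite to b, with denominator exceeding |c|, lets the linear term dominate the
  -- quadratic one.
  have h1 := h (-b / (|c| + 1))
  have hc : 0 < |c| + 1 := by positivity
  have h2 : 2 * (-b / (|c| + 1)) * b + (-b / (|c| + 1)) ^ 2 * c =
      b ^ 2 * (c - 2 * (|c| + 1)) / (|c| + 1) ^ 2 := by
    field_simp
    ring
  rw [h2] at h1
  have h3 : b ^ 2 * (c - 2 * (|c| + 1)) < 0 :=
    mul_neg_of_pos_of_neg (by positivity) (by linarith [le_abs_self c, abs_nonneg c])
  exact absurd h1 (not_le.2 (div_neg_of_neg_of_pos h3 (by positivity)))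

/-- The bilinear form `(v, w) ↦ ⟨(1 - s Dα) v, ∇²ψ w⟩`. -/
def shiftForm {n : ℕ} (ψ : RSpace n → ℝ) (α : RSpace n → RSpace n) (s : ℝ) (x v w : RSpace n) : ℝ :=
  inner ℝ (v - s • fderiv ℝ α x v) (hess ψ x w)

/-- The form is affine in s, so its value at s interpolates between the Hessian at 0 and the
nonnegative value at s'. -/
theorem le_shiftForm {n : ℕ} {ψ : RSpace n → ℝ} {α : RSpace n → RSpace n}
    {s s' : ℝ} (hs : 0 ≤ s) (hss : s < s') (hq : ∀ x v, 0 ≤ shiftForm ψ α s' x v v) (x v : RSpace n) :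
    (1 - s / s') * inner ℝ v (hess ψ x v) ≤ shiftForm ψ α s x v v := by
  have hs' : 0 < s' := hs.trans_lt hss
  have h1 := mul_nonneg (div_nonneg hs hs'.le) (hq x v)
  have h2 : shiftForm ψ α s x v v = (1 - s / s') * inner ℝ v (hess ψ x v) +
      s / s' * shiftForm ψ α s' x v v := by
    simp only [shiftForm, inner_sub_left, real_inner_smul_left]
    field_simp
    ring
  linarith

/-! ### Convexity of the dual function and positivity of the shifted form -/

namespace IsMoserData

variable {n : ℕ} {ψ h : RSpace n → ℝ} {α : RSpace n → RSpace n}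

theorem shiftForm_symm (hd : IsMoserData ψ h α) (s : ℝ) (x v w : RSpace n) :
    shiftForm ψ α s x v w = shiftForm ψ α s x w v := by
  rw [shiftForm, shiftForm, inner_sub_left, inner_sub_left, real_inner_smul_left,
    real_inner_smul_left, hd.inner_fderiv_velocity_symm, real_inner_comm,
    hess_symm hd.contDiff_two, real_inner_comm w]

theorem continuous_shiftForm (hd : IsMoserData ψ h α) (s : ℝ) :
    Continuous fun p : RSpace n × RSpace n => shiftForm ψ α s p.1 p.2 p.2 := by
  have h1 : Continuous (hess ψ) :=
    (contDiff_hess (m := 0) hd.contDiff_two (by norm_num)).continuous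
  have h2 : Continuous (fderiv ℝ α) := hd.smooth_velocity.continuous_fderiv (by norm_num)
  unfold shiftForm
  refine Continuous.inner (continuous_snd.sub (Continuous.const_smul ?_ s)) ?_
  · exact (h2.comp continuous_fst).clm_apply continuous_snd
  · exact (h1.comp continuous_fst).clm_apply continuous_snd

/-- The gradient of the dual function, as a function of y = ∇ψ(x), has derivative (1 - sDα)(∇²ψ)⁻¹;
evaluated on d = ∇²ψ v, its quadratic form is the shifted form. -/
theorem convexOn_dual_iff (hd : IsMoserData ψ h α) (s : ℝ) :
    ConvexOn ℝ (range (gradient ψ))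
      (fun y => legendre ψ y - s * h (Function.invFun (gradient ψ) y)) ↔
      ∀ x v, 0 ≤ shiftForm ψ α s x v v := by
  constructor
  · intro hc x v
    have h1 : HasDerivAt (fun t : ℝ => x + t • v - s • α (x + t • v))
        (v - s • fderiv ℝ α x v) 0 := by
      have := HasFDerivAt.comp_hasDerivAt (f := fun t : ℝ => x + t • v) (0 : ℝ)
        (by rw [zero_smul, add_zero]; exact hd.hasFDerivAt_shift s x) (hasDerivAt_line x v 0)
      exact this
    have h2 : HasDerivAt (fun t : ℝ => gradient ψ (x + t • v)) (hess ψ x v) 0 := by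
      have := HasFDerivAt.comp_hasDerivAt (f := fun t : ℝ => x + t • v) (0 : ℝ)
        (by rw [zero_smul, add_zero]; exact hasFDerivAt_gradient hd.contDiff_two x)
        (hasDerivAt_line x v 0)
      exact this
    have h3 := h1.tendsto_slope_zero_right.inner h2.tendsto_slope_zero_right (𝕜 := ℝ)
    refine ge_of_tendsto h3 (.of_forall fun t => ?_)
    rw [real_inner_smul_left, real_inner_smul_right, ← mul_assoc, ← sq]
    refine mul_nonneg (sq_nonneg _) ?_
    have h4 := inner_sub_nonneg_of_convexOn hc ⟨x, rfl⟩ ⟨x + t • v, rfl⟩ (hd.hasFDerivAt_dual s x)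
      (hd.hasFDerivAt_dual s (x + t • v))
    simpa using h4
  · intro hq
    choose e he using hd.exists_equiv_hess
    refine convexOn_of_hasFDerivAt hd.convex_range_gradient
      (θ := fun y => Function.invFun (gradient ψ) y - s • α (Function.invFun (gradient ψ) y))
      (B := fun y => (ContinuousLinearMap.id ℝ _ -
          s • fderiv ℝ α (Function.invFun (gradient ψ) y)).comp
        ((e (Function.invFun (gradient ψ) y)).symm : RSpace n →L[ℝ] RSpace n)) ?_ ?_ ?_
    · rintro _ ⟨x, rfl⟩
      simp only [hd.invFun_gradient]
      exact hd.hasFDerivAt_dual s x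
    · rintro _ ⟨x, rfl⟩
      have h1 := hd.hasFDerivAt_invFun (he x)
      have h2 : HasFDerivAt (fun x => x - s • α x) (ContinuousLinearMap.id ℝ _ - s • fderiv ℝ α x)
          (Function.invFun (gradient ψ) (gradient ψ x)) := by
        rw [hd.invFun_gradient]; exact hd.hasFDerivAt_shift s x
      have h3 := h2.comp (gradient ψ x) h1
      simp only [hd.invFun_gradient]
      exact h3
    · rintro _ ⟨x, rfl⟩ d
      simp only [hd.invFun_gradient]
      have h1 := hq x ((e x).symm d)
      have h2 : hess ψ x ((e x).symm d) = d := by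
        rw [← he]; exact (e x).apply_symm_apply d
      rw [shiftForm, h2] at h1
      exact h1

/-- Up to the factor s', the map x - sα is (s' - s) times the identity plus s times x - s'α. Paired
with increments of ∇ψ, the first is strictly monotone and the second monotone. -/
theorem shift_injective (hd : IsMoserData ψ h α) {s s' : ℝ} (hs : 0 ≤ s) (hss : s < s')
    (hq : ∀ x v, 0 ≤ shiftForm ψ α s' x v v) : Function.Injective fun x => x - s • α x := by
  intro x x' hxx
  by_contra hne
  have hs' : 0 < s' := hs.trans_lt hss
  have h1 := inner_sub_nonneg_of_convexOn ((hd.convexOn_dual_iff s').2 hq) ⟨x, rfl⟩ ⟨x', rfl⟩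
    (hd.hasFDerivAt_dual s' x) (hd.hasFDerivAt_dual s' x')
  have h2 := hd.inner_gradient_sub_pos hne
  rw [real_inner_comm] at h2
  have h3 : x - s • α x = x' - s • α x' := hxx
  have h4 : (s' - s) • (x' - x) + s • ((x' - s' • α x') - (x - s' • α x)) = 0 := by
    have : (s' - s) • (x' - x) + s • ((x' - s' • α x') - (x - s' • α x)) =
        s' • ((x' - s • α x') - (x - s • α x)) := by module
    rw [this, h3, sub_self, smul_zero]
  have h5 := congrArg (fun u => inner ℝ u (gradient ψ x' - gradient ψ x)) h4
  simp only [inner_add_left, real_inner_smul_left, inner_zero_left] at h5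
  have := mul_pos (sub_pos.2 hss) h2
  have := mul_nonneg hs h1
  linarith

/-- At a minimum of an auxiliary proper function the form is positive. -/
theorem exists_shiftForm_pos (hd : IsMoserData ψ h α) {s A G C : ℝ} (hs : 0 ≤ s)
    (hA : ∀ x, ‖α x‖ ≤ A) (hG : ∀ x, ‖gradient ψ x‖ ≤ G) (hC : ∀ x, |h x| ≤ C)
    (hinj : ∀ x v, v - s • fderiv ℝ α x v = 0 → v = 0) :
    ∃ x, ∀ v, v ≠ 0 → 0 < shiftForm ψ α s x v v := by
  let p := gradient ψ 0
  let κ : RSpace n → RSpace n := fun x => x - s • α x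
  -- The terms before the last are a primitive of ⟨∇ψ - p, Dκ ·⟩, so dE = ⟨g, Dκ ·⟩. At a minimum g
  -- = 0, and the second variation gives ⟨∇²ψ v, Dκ v⟩ ≥ ½⟨∇²ψ(κ) Dκ v, Dκ v⟩, which is positive.
  -- The weight ½ both preserves properness and leaves this positive lower bound.
  let E : RSpace n → ℝ := fun x => ψ x - inner ℝ p x - s * inner ℝ (α x) (gradient ψ x - p) +
    s * h x - 2⁻¹ * (ψ (κ x) - inner ℝ p (κ x))
  let g : RSpace n → RSpace n := fun x => gradient ψ x - p - (2⁻¹ : ℝ) • (gradient ψ (κ x) - p)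
  let Dκ : RSpace n → RSpace n →L[ℝ] RSpace n := fun x =>
    ContinuousLinearMap.id ℝ _ - s • fderiv ℝ α x
  have hκ : ∀ x, HasFDerivAt κ (Dκ x) x := fun x => hd.hasFDerivAt_shift s x
  have hE : ∀ x, HasFDerivAt E ((innerSL ℝ (g x)).comp (Dκ x)) x := by
    intro x
    have h1 := (hd.hasFDerivAt_potential x).sub (innerSL ℝ p).hasFDerivAt
    have h2 := (((hd.hasFDerivAt_velocity x).inner ℝ
      ((hasFDerivAt_gradient hd.contDiff_two x).sub_const p)).const_mul s)
    have h3 := (hd.hasFDerivAt_right x).const_mul s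
    have h4 := (((hd.hasFDerivAt_potential (κ x)).sub (innerSL ℝ p).hasFDerivAt).comp x
      (hκ x)).const_mul (2⁻¹ : ℝ)
    refine (((h1.sub h2).add h3).sub h4).congr_fderiv ?_
    ext1 v
    simp only [sub_apply, add_apply, ContinuousLinearMap.comp_apply, ContinuousLinearMap.prod_apply,
      fderivInnerCLM_apply, innerSL_apply_apply, smul_apply, inner_sub_left, inner_sub_right,
      real_inner_smul_left, real_inner_smul_right, hd.inner_velocity_hess, g, Dκ, smul_eq_mul,
      ContinuousLinearMap.id_apply]
    rw [real_inner_comm (gradient ψ x), real_inner_comm p (fderiv ℝ α x v)]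
    ring
  have hlim : Tendsto E (cocompact _) atTop := by
    have hA0 : 0 ≤ A := (norm_nonneg _).trans (hA 0)
    have hG0 : 0 ≤ G := (norm_nonneg _).trans (hG 0)
    have hb : ∀ x y z : RSpace n, |inner ℝ (α x) (gradient ψ y)| ≤ A * G := fun x y z =>
      (abs_real_inner_le_norm _ _).trans (mul_le_mul (hA x) (hG y) (norm_nonneg _) hA0)
    -- The gradient inequality at κ(x) bounds ψ(κ(x)) by ψ(x) up to s⟨α, ∇ψ(κ)⟩. Half of the proper
    -- function ψ - ⟨p, ·⟩ survives, and all other terms are bounded through A, G and C.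
    have hbound : ∀ x, 2⁻¹ * (ψ x - inner ℝ p x) + (-(3 * (s * (A * G))) - s * C) ≤ E x := by
      intro x
      have h1 := le_of_convexOn_of_hasFDerivAt hd.convexOn (mem_univ (κ x)) (mem_univ x)
        (hd.hasFDerivAt_potential (κ x))
      have h2 : x - κ x = s • α x := by simp [κ]
      rw [h2, real_inner_smul_right, real_inner_comm] at h1
      have h3 : inner ℝ p (κ x) = inner ℝ p x - s * inner ℝ (α x) p := by
        rw [inner_sub_right, real_inner_smul_right, real_inner_comm p (α x)]
      have k1 := mul_le_mul_of_nonneg_left (abs_le.1 (hb x (κ x) 0)).1 hs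
      have k2 := mul_le_mul_of_nonneg_left (abs_le.1 (hb x x 0)).2 hs
      have k3 := mul_le_mul_of_nonneg_left (abs_le.1 (hb x 0 0)).1 hs
      have k5 := mul_le_mul_of_nonneg_left (abs_le.1 (hb x 0 0)).2 hs
      have k4 := mul_le_mul_of_nonneg_left (abs_le.1 (hC x)).1 hs
      change _ ≤ ψ x - inner ℝ p x - s * inner ℝ (α x) (gradient ψ x - p) + s * h x -
        2⁻¹ * (ψ (κ x) - inner ℝ p (κ x))
      rw [h3, inner_sub_right]
      change _ ≤ s * inner ℝ (α x) p at k3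
      change s * inner ℝ (α x) p ≤ _ at k5
      linarith
    exact tendsto_atTop_mono hbound (tendsto_atTop_add_const_right _ _
      ((hd.tendsto_sub_inner_gradient 0).const_mul_atTop (by norm_num)))
  have hEc : Continuous E := continuous_iff_continuousAt.2 fun x => (hE x).continuousAt
  obtain ⟨x, hx⟩ := hEc.exists_forall_le hlim
  have hg0 : g x = 0 := by
    have h1 := (show IsLocalMin E x from .of_forall hx).hasFDerivAt_eq_zero (hE x)
    have h2 : Function.Injective (Dκ x : RSpace n →ₗ[ℝ] RSpace n) := by
      rw [injective_iff_map_eq_zero]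
      exact fun v hv => hinj x v hv
    obtain ⟨v, hv⟩ := LinearMap.surjective_of_injective h2 (g x)
    have h3 := congrArg (fun L => L v) h1
    have h4 : inner ℝ (g x) (g x) = (0 : ℝ) := by
      nth_rewrite 2 [← hv]
      exact h3
    exact inner_self_eq_zero.1 h4
  refine ⟨x, fun v hv => ?_⟩
  -- second variation
  have hgd : HasFDerivAt g (hess ψ x - (2⁻¹ : ℝ) • (hess ψ (κ x)).comp (Dκ x)) x :=
    ((hasFDerivAt_gradient hd.contDiff_two x).sub_const p).sub
      ((((hasFDerivAt_gradient hd.contDiff_two (κ x)).comp x (hκ x)).sub_const p).const_smul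
        (2⁻¹ : ℝ))
  have hDκd : DifferentiableAt ℝ Dκ x := by
    refine (differentiableAt_const _).sub (DifferentiableAt.const_smul ?_ s)
    exact (hd.smooth_velocity.fderiv_right (m := 1) (by norm_num)).differentiable (by norm_num) x
  have hnn : 0 ≤ inner ℝ (hess ψ x v - (2⁻¹ : ℝ) • hess ψ (κ x) (Dκ x v)) (Dκ x v) :=
    inner_nonneg_of_forall_le hE hx hg0 hgd hDκd v
  have hDv : Dκ x v ≠ 0 := fun h0 => hv (hinj x v h0)
  have hpos := hd.hess_pos (κ x) _ hDv
  rw [inner_sub_left, real_inner_smul_left] at hnn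
  rw [shiftForm, real_inner_comm]
  change 0 < inner ℝ (hess ψ x v) (Dκ x v)
  linarith

/-- Positivity of the form propagates as long as it is nondegenerate. -/
theorem shiftForm_pos (hd : IsMoserData ψ h α) {s A G C : ℝ} (hs : 0 ≤ s)
    (hA : ∀ x, ‖α x‖ ≤ A) (hG : ∀ x, ‖gradient ψ x‖ ≤ G) (hC : ∀ x, |h x| ≤ C)
    (hinj : ∀ x v, v - s • fderiv ℝ α x v = 0 → v = 0) (x v : RSpace n) (hv : v ≠ 0) :
    0 < shiftForm ψ α s x v v := by
  -- A null vector of a semidefinite symmetric form pairs to zero with everything, so it lies in the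
  -- kernel of 1 - sDα. Thus semidefinite points are definite, and the closed set of such points is
  -- open as well.
  have hnd : ∀ x, (∀ v, 0 ≤ shiftForm ψ α s x v v) → ∀ v, v ≠ 0 → 0 < shiftForm ψ α s x v v := by
    intro x hx v hv
    refine lt_of_le_of_ne (hx v) fun h0 => hv (hinj x v ?_)
    obtain ⟨e, he⟩ := hd.exists_equiv_hess x
    have key : ∀ w, shiftForm ψ α s x v w = 0 := by
      intro w
      have h1 : ∀ t : ℝ, 0 ≤ 2 * t * shiftForm ψ α s x v w + t ^ 2 * shiftForm ψ α s x w w := by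
        intro t
        have h2 := hx (v + t • w)
        have h3 : shiftForm ψ α s x (v + t • w) (v + t • w) = shiftForm ψ α s x v v +
            t * shiftForm ψ α s x v w + t * shiftForm ψ α s x w v +
              t ^ 2 * shiftForm ψ α s x w w := by
          simp only [shiftForm, map_add, map_smul, inner_add_left, inner_add_right, smul_add,
            inner_sub_left, real_inner_smul_left, real_inner_smul_right]
          ring
        rw [h3, ← h0, hd.shiftForm_symm s x w v] at h2
        linarith
      exact eq_zero_of_forall_nonneg_quadratic h1
    have h2 := key (e.symm (v - s • fderiv ℝ α x v))
    rw [shiftForm, ← he] at h2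
    have h3 : (e : RSpace n →L[ℝ] RSpace n) (e.symm (v - s • fderiv ℝ α x v)) =
        v - s • fderiv ℝ α x v := e.apply_symm_apply _
    rw [h3] at h2
    exact inner_self_eq_zero.1 h2
  have hc := hd.continuous_shiftForm s
  have hclosed : IsClosed {x | ∀ v, 0 ≤ shiftForm ψ α s x v v} := by
    rw [show {x | ∀ v, 0 ≤ shiftForm ψ α s x v v} =
      ⋂ v, {x | 0 ≤ shiftForm ψ α s x v v} by ext x; simp]
    exact isClosed_iInter fun v => isClosed_le continuous_const
      (hc.comp (Continuous.prodMk_left v))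
  have hopen : IsOpen {x | ∀ v, 0 ≤ shiftForm ψ α s x v v} := by
    rw [isOpen_iff_mem_nhds]
    intro x hx
    have h1 : ∀ᶠ x' in 𝓝 x, ∀ v ∈ Metric.sphere (0 : RSpace n) 1,
        0 < shiftForm ψ α s x' v v := by
      refine (isCompact_sphere _ _).eventually_forall_of_forall_eventually fun v hv => ?_
      have h2 : v ≠ 0 := fun h => by simp [h] at hv
      exact hc.continuousAt.eventually (lt_mem_nhds (hnd x hx v h2))
    filter_upwards [h1] with x' hx' v
    rcases eq_or_ne v 0 with rfl | hv
    · simp [shiftForm]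
    · have h2 := hx' (‖v‖⁻¹ • v) (by simp [norm_smul, hv])
      have h3 : shiftForm ψ α s x' (‖v‖⁻¹ • v) (‖v‖⁻¹ • v) =
          ‖v‖⁻¹ ^ 2 * shiftForm ψ α s x' v v := by
        simp only [shiftForm, map_smul, smul_comm s, ← smul_sub, real_inner_smul_left,
          real_inner_smul_right]
        ring
      rw [h3] at h2
      exact (pos_of_mul_pos_right h2 (sq_nonneg _)).le
  obtain ⟨x₀, hx₀⟩ := hd.exists_shiftForm_pos hs hA hG hC hinj
  have huniv := IsClopen.eq_univ ⟨hclosed, hopen⟩ ⟨x₀, fun v => by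
    rcases eq_or_ne v 0 with rfl | hv
    · simp [shiftForm]
    · exact (hx₀ v hv).le⟩
  exact hnd x (huniv.ge (mem_univ x)) v hv

end IsMoserData

/-! ### From invertible derivatives in charts to diffeomorphisms -/

section Diffeomorphisms

variable {n : ℕ} {M : Type*} [TopologicalSpace M] [ChartedSpace (CSpace n) M]

theorem isOpenMap_of_chart {g : M → M} (hg : Continuous g)
    (hstr : ∀ z, ∃ e : CSpace n ≃L[ℝ] CSpace n,
      HasStrictFDerivAt (ch n (g z) ∘ g ∘ (ch n z).symm) (e : CSpace n →L[ℝ] CSpace n)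
        (ch n z z)) : IsOpenMap g := by
  rw [isOpenMap_iff_nhds_le]
  intro z
  obtain ⟨e, he⟩ := hstr z
  have hz := mem_chart_source (CSpace n) z
  have hgz := mem_chart_source (CSpace n) (g z)
  have h1 := he.map_nhds_eq_of_equiv
  have h2 : (ch n (g z) ∘ g ∘ (ch n z).symm) (ch n z z) = ch n (g z) (g z) := by
    simp only [Function.comp, (ch n z).left_inv hz]
  rw [h2] at h1
  have h3 : 𝓝 (g z) = map (ch n (g z)).symm (𝓝 (ch n (g z) (g z))) := by
    rw [(ch n (g z)).symm.map_nhds_eq ((ch n (g z)).map_source hgz), (ch n (g z)).left_inv hgz]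
  rw [h3, ← h1, ← (ch n z).map_nhds_eq hz, map_map, map_map]
  refine le_of_eq (Filter.map_congr ?_)
  filter_upwards [(ch n z).open_source.mem_nhds hz,
    hg.continuousAt.eventually ((ch n (g z)).open_source.mem_nhds hgz)] with p hp hp'
  simp only [Function.comp, (ch n z).left_inv hp, (ch n (g z)).left_inv hp']

theorem exists_diffeomorph_of_chart {g : M → M} (hb : Function.Bijective g)
    (hg : ContMDiff 𝓘(ℝ, CSpace n) 𝓘(ℝ, CSpace n) 1 g)
    (hstr : ∀ z, ∃ e : CSpace n ≃L[ℝ] CSpace n,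
      HasStrictFDerivAt (ch n (g z) ∘ g ∘ (ch n z).symm) (e : CSpace n →L[ℝ] CSpace n)
        (ch n z z)) :
    ∃ Φ : M ≃ₘ^1⟮𝓘(ℝ, CSpace n), 𝓘(ℝ, CSpace n)⟯ M, ⇑Φ = g := by
  let φ : M ≃ₜ M := (Equiv.ofBijective g hb).toHomeomorphOfContinuousOpen hg.continuous
    (isOpenMap_of_chart hg.continuous hstr)
  have hφ : ⇑φ = g := rfl
  have hinv : ContMDiff 𝓘(ℝ, CSpace n) 𝓘(ℝ, CSpace n) 1 φ.symm := by
    intro p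
    obtain ⟨z, rfl⟩ := hb.2 p
    have hsz : φ.symm (g z) = z := φ.symm_apply_apply z
    rw [contMDiffAt_iff]
    refine ⟨φ.symm.continuous.continuousAt, ?_⟩
    obtain ⟨e, he⟩ := hstr z
    have hz := mem_chart_source (CSpace n) z
    have hgz := mem_chart_source (CSpace n) (g z)
    let Θ := (ch n z).symm.trans (φ.toOpenPartialHomeomorph.trans (ch n (g z)))
    have hΘs : Θ.symm (ch n (g z) (g z)) = ch n z z := by
      change ch n z (φ.symm ((ch n (g z)).symm (ch n (g z) (g z)))) = _
      rw [(ch n (g z)).left_inv hgz, hsz]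
    have hΘt : ch n (g z) (g z) ∈ Θ.target := by
      have : Θ (ch n z z) = ch n (g z) (g z) := by
        change ch n (g z) (g ((ch n z).symm (ch n z z))) = _
        rw [(ch n z).left_inv hz]
      rw [← this]
      refine Θ.map_source ⟨(ch n z).map_source hz, mem_univ _, ?_⟩
      change g ((ch n z).symm (ch n z z)) ∈ (ch n (g z)).source
      rw [(ch n z).left_inv hz]
      exact hgz
    have h1 : ContDiffAt ℝ 1 Θ (ch n z z) := by
      have h := (contMDiffAt_iff.1 (hg z)).2
      have h' : ContDiffWithinAt ℝ 1 (ch n (g z) ∘ g ∘ (ch n z).symm) univ (ch n z z) := by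
        simpa using h
      exact contDiffWithinAt_univ.1 h'
    have h2 : ContDiffAt ℝ 1 Θ.symm (ch n (g z) (g z)) := by
      refine Θ.contDiffAt_symm hΘt (f₀' := e) ?_ ?_
      · rw [hΘs]; exact he.hasFDerivAt
      · rw [hΘs]; exact h1
    have h3 : ContDiffWithinAt ℝ 1 (ch n z ∘ φ.symm ∘ (ch n (g z)).symm) (range id)
      (ch n (g z) (g z)) := h2.contDiffWithinAt
    rw [hsz]
    simpa using h3
  exact ⟨⟨φ.toEquiv, hg, hinv⟩, rfl⟩

end Diffeomorphisms

/-! ### The shifted form on M and the lifespan criterion -/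

section Lifespan

variable {n : ℕ} {M : Type*} [TopologicalSpace M] [ChartedSpace (CSpace n) M]
  [MulAction (CTorus n) M] [IsManifold 𝓘(ℂ, CSpace n) ω M] {Ω : TwoForm n M} {o : M}

/-- The bilinear form `(v, w) ↦ Ω((1 - s N) v, J w)` in a chart. -/
def moserForm (Ω : TwoForm n M) (H : M → ℝ) (a : M → RSpace n) (s : ℝ) (z : M)
    (y v w : CSpace n) : ℝ :=
  formChart Ω z y (v - s • shear Ω H a z y v) (Complex.I • w)

variable {ψ h : RSpace n → ℝ} {α : RSpace n → RSpace n} {H : M → ℝ} {a : M → RSpace n}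

theorem moserForm_zero (z : M) (y v w : CSpace n) :
    moserForm Ω H a 0 z y v w = formChart Ω z y v (Complex.I • w) := by
  rw [moserForm, zero_smul, sub_zero]

theorem moserForm_smul_smul (s c : ℝ) (z : M) (y v : CSpace n) :
    moserForm Ω H a s z y (c • v) (c • v) = c ^ 2 * moserForm Ω H a s z y v v := by
  have h1 : Complex.I • c • v = c • Complex.I • v := smul_comm _ _ _
  rw [moserForm, moserForm, h1, map_smul (shear Ω H a z y), smul_comm s, ← smul_sub]
  have h2 := (formChart Ω z y).map_smul c (v - s • shear Ω H a z y v)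
  have h3 := (formChart Ω z y (v - s • shear Ω H a z y v)).map_smul c (Complex.I • v)
  rw [h2, smul_apply, h3, smul_eq_mul, smul_eq_mul]
  ring

theorem moserForm_add_smul (s t : ℝ) (z : M) (y v w : CSpace n) :
    moserForm Ω H a s z y (v + t • w) (v + t • w) = moserForm Ω H a s z y v v +
      t * moserForm Ω H a s z y v w + t * moserForm Ω H a s z y w v +
        t ^ 2 * moserForm Ω H a s z y w w := by
  have h1 : Complex.I • (v + t • w) = Complex.I • v + t • Complex.I • w := by
    rw [smul_add, smul_comm]
  have h2 : v + t • w - s • shear Ω H a z y (v + t • w) =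
      (v - s • shear Ω H a z y v) + t • (w - s • shear Ω H a z y w) := by
    rw [map_add, map_smul]
    module
  have h3 : ∀ u u' w w' : CSpace n, formChart Ω z y (u + t • u') (w + t • w') =
      formChart Ω z y u w + t * formChart Ω z y u w' + t * formChart Ω z y u' w +
        t ^ 2 * formChart Ω z y u' w' := by
    intro u u' w w'
    simp only [map_add, map_smul, add_apply, smul_apply, smul_eq_mul]
    ring
  simp only [moserForm, h1, h2, h3]

theorem IsVelocity.continuousAt_moserForm (ha : IsVelocity Ω H a) (hM : IsToricKaehler Ω o)
    (hH : ContMDiff 𝓘(ℝ, CSpace n) 𝓘(ℝ, ℝ) 3 H) (z : M) (s : ℝ) {y : CSpace n}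
    (hy : y ∈ (ch n z).target) (v w : CSpace n) :
    ContinuousAt (fun p : (ℝ × CSpace n) × CSpace n × CSpace n =>
      moserForm Ω H a p.1.1 z p.1.2 p.2.1 p.2.2) ((s, y), (v, w)) := by
  have hTn := (ch n z).open_target.mem_nhds hy
  have h0 : ContinuousAt (fun p : (ℝ × CSpace n) × CSpace n × CSpace n => p.1.2)
    ((s, y), (v, w)) := by fun_prop
  have h1 : ContinuousAt (fun p : (ℝ × CSpace n) × CSpace n × CSpace n => formChart Ω z p.1.2)
      ((s, y), (v, w)) :=
    ContinuousAt.comp (f := fun p : (ℝ × CSpace n) × CSpace n × CSpace n => p.1.2)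
      ((hM.kaehler.contDiffOn_formChart z).continuousOn.continuousAt hTn) h0
  have h2 : ContinuousAt (fun p : (ℝ × CSpace n) × CSpace n × CSpace n => shear Ω H a z p.1.2)
      ((s, y), (v, w)) :=
    ContinuousAt.comp (f := fun p : (ℝ × CSpace n) × CSpace n × CSpace n => p.1.2)
      ((ha.continuousOn_shear hM hH z).continuousAt hTn) h0
  have hs : ContinuousAt (fun p : (ℝ × CSpace n) × CSpace n × CSpace n => p.1.1)
    ((s, y), (v, w)) := by fun_prop
  have hv : ContinuousAt (fun p : (ℝ × CSpace n) × CSpace n × CSpace n => p.2.1)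
    ((s, y), (v, w)) := by fun_prop
  have hw : ContinuousAt (fun p : (ℝ × CSpace n) × CSpace n × CSpace n => Complex.I • p.2.2)
    ((s, y), (v, w)) := by fun_prop
  exact (h1.clm_apply (hv.sub (hs.smul (h2.clm_apply hv)))).clm_apply hw

theorem IsVelocity.continuousOn_moserForm (ha : IsVelocity Ω H a) (hM : IsToricKaehler Ω o)
    (hH : ContMDiff 𝓘(ℝ, CSpace n) 𝓘(ℝ, ℝ) 3 H) (z : M) (s : ℝ) (v w : CSpace n) :
    ContinuousOn (fun y => moserForm Ω H a s z y v w) (ch n z).target := fun y hy =>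
  (ContinuousAt.comp (f := fun y : CSpace n => ((s, y), (v, w)))
    (ha.continuousAt_moserForm hM hH z s hy v w) (by fun_prop)).continuousWithinAt

theorem IsToricKaehler.nonneg_of_orbitChart (hM : IsToricKaehler Ω o) {z : M} {g : CSpace n → ℝ}
    (hg : ContinuousOn g (ch n z).target) (h : ∀ y ∈ orbitChart (n := n) o z, 0 ≤ g y)
    {y : CSpace n} (hy : y ∈ (ch n z).target) : 0 ≤ g y := by
  have hne : (𝓝[orbitChart (n := n) o z] y).NeBot :=
    mem_closure_iff_nhdsWithin_neBot.1 (hM.subset_closure_orbitChart z hy)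
  have h1 : ContinuousWithinAt g (orbitChart (n := n) o z) y := (hg y hy).mono inter_subset_left
  refine ge_of_tendsto h1.tendsto ?_
  filter_upwards [self_mem_nhdsWithin] with u hu using h u hu

variable [T2Space M]

theorem IsToricKaehler.exists_fund_eq (hM : IsToricKaehler Ω o) (z : M) {ζ : CSpace n}
    (hζ : logParam o ζ ∈ (ch n z).source) (v : CSpace n) :
    ∃ p, fund n z (ch n z (logParam o ζ)) p = v := by
  obtain ⟨e, he⟩ := exists_equiv_of_injective
    (hM.fund_injective z hζ (logParam_mem_orbit o ζ))
  exact ⟨e.symm v, by rw [← he]; exact e.apply_symm_apply v⟩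

/-- On fundamental vectors N sees only real parts and takes values in real directions. Hence the
form splits into the shifted form on real parts and the unshifted Hessian on imaginary parts. -/
theorem IsVelocity.moserForm_fund (ha : IsVelocity Ω H a) (hM : IsToricKaehler Ω o)
    (hH : ContMDiff 𝓘(ℝ, CSpace n) 𝓘(ℝ, ℝ) 3 H) (hψ : IsOpenOrbitPotential Ω o ψ)
    (hα : Differentiable ℝ α) (haα : ∀ ζ : CSpace n, a (logParam o ζ) = α (reL ζ)) (s : ℝ) (z : M)
    {ζ : CSpace n} (hζ : logParam o ζ ∈ (ch n z).source) (p q : CSpace n) :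
    moserForm Ω H a s z (ch n z (logParam o ζ)) (fund n z (ch n z (logParam o ζ)) p)
      (fund n z (ch n z (logParam o ζ)) q) =
      shiftForm ψ α s (reL ζ) (reL p) (reL q) + inner ℝ (hess ψ (reL ζ) (imL p)) (imL q) := by
  have h1 : fund n z (ch n z (logParam o ζ)) p -
      s • shear Ω H a z (ch n z (logParam o ζ)) (fund n z (ch n z (logParam o ζ)) p) =
      fund n z (ch n z (logParam o ζ)) (p - s • rc (fderiv ℝ α (reL ζ) (reL p))) := by
    rw [ha.shear_fund hM hH hα haα z hζ, map_sub, ContinuousLinearMap.map_smul_of_tower]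
  rw [moserForm, h1, ← (fund n z (ch n z (logParam o ζ))).map_smul, ← hM.orbForm_eq_formChart z hζ, hψ.orbForm_eq_hess hM]
  simp only [map_sub, map_smul, reL_rc, imL_rc, reL_I_smul, imL_I_smul, smul_zero, sub_zero,
    map_neg, inner_neg_left, sub_neg_eq_add, shiftForm]
  rw [← map_smul, ← map_sub, hess_symm hψ.contDiff_two, real_inner_comm, hess_symm hψ.contDiff_two _ (imL q)]

theorem IsVelocity.moserForm_symm (ha : IsVelocity Ω H a) (hM : IsToricKaehler Ω o)
    (hH : ContMDiff 𝓘(ℝ, CSpace n) 𝓘(ℝ, ℝ) 3 H) (hψ : IsOpenOrbitPotential Ω o ψ)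
    (hd : IsMoserData ψ h α) (haα : ∀ ζ : CSpace n, a (logParam o ζ) = α (reL ζ)) (s : ℝ) (z : M)
    {y : CSpace n} (hy : y ∈ (ch n z).target) (v w : CSpace n) :
    moserForm Ω H a s z y v w = moserForm Ω H a s z y w v := by
  have key : ∀ y ∈ orbitChart (n := n) o z, ∀ v w : CSpace n,
      moserForm Ω H a s z y v w = moserForm Ω H a s z y w v := by
    rintro y hy v w
    obtain ⟨ζ, hζ, rfl⟩ := exists_logParam_of_mem_orbitChart hy
    obtain ⟨p, rfl⟩ := hM.exists_fund_eq z hζ v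
    obtain ⟨q, rfl⟩ := hM.exists_fund_eq z hζ w
    rw [ha.moserForm_fund hM hH hψ (fun x => (hd.hasFDerivAt_velocity x).differentiableAt) haα s z hζ,
      ha.moserForm_fund hM hH hψ (fun x => (hd.hasFDerivAt_velocity x).differentiableAt) haα s z hζ,
      hd.shiftForm_symm, hess_symm hψ.contDiff_two]
  have hc := ha.continuousOn_moserForm hM hH z s
  refine le_antisymm ?_ ?_
  · refine sub_nonneg.1 (hM.nonneg_of_orbitChart
      (g := fun y => moserForm Ω H a s z y w v - moserForm Ω H a s z y v w)
      ((hc w v).sub (hc v w)) (fun y hy => ?_) hy)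
    rw [key y hy w v, sub_self]
  · refine sub_nonneg.1 (hM.nonneg_of_orbitChart
      (g := fun y => moserForm Ω H a s z y v w - moserForm Ω H a s z y w v)
      ((hc v w).sub (hc w v)) (fun y hy => ?_) hy)
    rw [key y hy w v, sub_self]

/-- On the open orbit this is the interpolation bound `le_shiftForm`. Being a non-strict inequality
between continuous functions it persists on the closure, and the factor 1 - s/s' > 0 keeps the form
definite at boundary points. -/
theorem IsVelocity.le_moserForm (ha : IsVelocity Ω H a) (hM : IsToricKaehler Ω o)
    (hH : ContMDiff 𝓘(ℝ, CSpace n) 𝓘(ℝ, ℝ) 3 H) (hψ : IsOpenOrbitPotential Ω o ψ)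
    (hd : IsMoserData ψ h α) (haα : ∀ ζ : CSpace n, a (logParam o ζ) = α (reL ζ)) {s s' : ℝ}
    (hs : 0 ≤ s) (hss : s < s') (hq : ∀ x v, 0 ≤ shiftForm ψ α s' x v v) (z : M)
    {y : CSpace n} (hy : y ∈ (ch n z).target) (v : CSpace n) :
    (1 - s / s') * formChart Ω z y v (Complex.I • v) ≤ moserForm Ω H a s z y v v := by
  have hα : Differentiable ℝ α := fun x => (hd.hasFDerivAt_velocity x).differentiableAt
  rw [← moserForm_zero (H := H) (a := a)]
  refine sub_nonneg.1 (hM.nonneg_of_orbitChart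
    (g := fun y => moserForm Ω H a s z y v v - (1 - s / s') * moserForm Ω H a 0 z y v v)
    ((ha.continuousOn_moserForm hM hH z s v v).sub
      ((ha.continuousOn_moserForm hM hH z 0 v v).const_mul _)) (fun y hy => ?_) hy)
  obtain ⟨ζ, hζ, rfl⟩ := exists_logParam_of_mem_orbitChart hy
  obtain ⟨p, rfl⟩ := hM.exists_fund_eq z hζ v
  rw [ha.moserForm_fund hM hH hψ hα haα s z hζ, ha.moserForm_fund hM hH hψ hα haα 0 z hζ]
  have h1 := le_shiftForm hs hss hq (reL ζ) (reL p)
  have h2 : shiftForm ψ α 0 (reL ζ) (reL p) (reL p) =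
      inner ℝ (reL p) (hess ψ (reL ζ) (reL p)) := by
    rw [shiftForm, zero_smul, sub_zero]
  have h3 : 0 ≤ inner ℝ (hess ψ (reL ζ) (imL p)) (imL p) := by
    rcases eq_or_ne (imL p) 0 with h0 | h0
    · rw [h0, inner_zero_right]
    · exact (hd.hess_pos _ _ h0).le
  have h4 : 0 ≤ s / s' := div_nonneg hs (hs.trans hss.le)
  rw [h2]
  linarith [mul_nonneg h4 h3]

theorem IsVelocity.injective_sub_shear (ha : IsVelocity Ω H a) (hM : IsToricKaehler Ω o)
    (hH : ContMDiff 𝓘(ℝ, CSpace n) 𝓘(ℝ, ℝ) 3 H) (hψ : IsOpenOrbitPotential Ω o ψ)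
    (hd : IsMoserData ψ h α) (haα : ∀ ζ : CSpace n, a (logParam o ζ) = α (reL ζ)) {s s' : ℝ}
    (hs : 0 ≤ s) (hss : s < s') (hq : ∀ x v, 0 ≤ shiftForm ψ α s' x v v) (z : M)
    {y : CSpace n} (hy : y ∈ (ch n z).target) {v : CSpace n}
    (hv : v - s • shear Ω H a z y v = 0) : v = 0 := by
  by_contra h0
  have h1 := ha.le_moserForm hM hH hψ hd haα hs hss hq z hy v
  rw [moserForm, hv, map_zero, zero_apply] at h1
  have h2 : 0 < 1 - s / s' := sub_pos.2 ((div_lt_one (hs.trans_lt hss)).2 hss)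
  exact absurd h1 (not_le.2 (mul_pos h2 (hM.kaehler.formChart_pos z hy h0)))

theorem moserFDeriv_apply (s : ℝ) (z z' : M) (y v : CSpace n) :
    moserFDeriv Ω H a s z z' y v =
      actFDeriv n z z' (-(s : ℂ) • rc (a ((ch n z).symm y))) y (v - s • shear Ω H a z y v) := rfl

theorem moserMap_logParam (haα : ∀ ζ : CSpace n, a (logParam o ζ) = α (reL ζ)) (τ : ℂ)
    (ζ : CSpace n) : moserMap a τ (logParam o ζ) = logParam o (ζ - τ • rc (α (reL ζ))) := by
  rw [moserMap, haα, act_logParam, neg_smul, neg_add_eq_sub]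

theorem IsVelocity.exists_equiv_hasStrictFDerivAt (ha : IsVelocity Ω H a) (hM : IsToricKaehler Ω o)
    (hH : ContMDiff 𝓘(ℝ, CSpace n) 𝓘(ℝ, ℝ) 3 H) (hα : Differentiable ℝ α)
    (haα : ∀ ζ : CSpace n, a (logParam o ζ) = α (reL ζ)) {s : ℝ} (z : M)
    (hinj : ∀ v, v - s • shear Ω H a z (ch n z z) v = 0 → v = 0) :
    ∃ e : CSpace n ≃L[ℝ] CSpace n,
      HasStrictFDerivAt (ch n (moserMap a s z) ∘ moserMap a s ∘ (ch n z).symm)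
        (e : CSpace n →L[ℝ] CSpace n) (ch n z z) := by
  have hz := mem_chart_source (CSpace n) z
  have hgz := mem_chart_source (CSpace n) (moserMap a s z)
  have h1 := (ha.hasStrictFDerivAt_moserMap hM hH hα haα s z (moserMap a s z)
    ((ch n z).map_source hz) (by rwa [(ch n z).left_inv hz])).1
  have h2 : Function.Injective (moserFDeriv Ω H a s z (moserMap a s z) (ch n z z) :
      CSpace n →ₗ[ℝ] CSpace n) := by
    rw [injective_iff_map_eq_zero]
    intro v hv
    refine hinj v ?_
    have h3 : actFDeriv n z (moserMap a s z) (-(s : ℂ) • rc (a ((ch n z).symm (ch n z z))))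
      (ch n z z) (v - s • shear Ω H a z (ch n z z) v) = 0 := hv
    refine hM.actFDeriv_injective z (moserMap a s z) hz ?_ (h3.trans (map_zero _).symm)
    rw [(ch n z).left_inv hz]
    exact hgz
  exact ⟨(LinearEquiv.ofInjectiveEndo _ h2).toContinuousLinearEquiv, h1⟩

/-- On the open orbit, equal images force equal real parts, hence the same group element, which acts
injectively. If two other points had the same image, the images of disjoint neighbourhoods would
overlap in an open set, which meets the open orbit; both preimages lie in the open orbit, a
contradiction. -/
theorem IsToricKaehler.moserMap_injective (hM : IsToricKaehler Ω o)
    (haα : ∀ ζ : CSpace n, a (logParam o ζ) = α (reL ζ)) {s : ℝ}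
    (hopen : IsOpenMap (moserMap (M := M) a s))
    (hshift : Function.Injective fun x => x - s • α x) :
    Function.Injective (moserMap (M := M) a s) := by
  have hO : InjOn (moserMap (M := M) a s) (MulAction.orbit (CTorus n) o) := by
    rw [← range_logParam]
    rintro _ ⟨ζ, rfl⟩ _ ⟨η, rfl⟩ hζη
    have h1 := hζη
    rw [moserMap_logParam haα, moserMap_logParam haα] at h1
    have h2 := reL_eq_of_logParam_eq hM h1
    have h3 : ∀ ζ : CSpace n, reL (ζ - (s : ℂ) • rc (α (reL ζ))) = reL ζ - s • α (reL ζ) := by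
      intro ζ
      rw [Complex.coe_smul, map_sub, map_smul, reL_rc]
    rw [h3, h3] at h2
    have h4 : reL ζ = reL η := hshift h2
    rw [moserMap, moserMap, haα, haα, h4] at hζη
    exact act_injective _ hζη
  have hmem : ∀ z, moserMap a s z ∈ MulAction.orbit (CTorus n) o ↔
      z ∈ MulAction.orbit (CTorus n) o := fun z => act_mem_orbit_iff o _ z
  intro p q hpq
  by_contra hne
  obtain ⟨U, V, hU, hV, hpU, hqV, hUV⟩ := t2_separation hne
  obtain ⟨r, ⟨⟨u, hu, hur⟩, v, hv, hvr⟩, hro⟩ := hM.dense_orbit.inter_open_nonempty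
    (moserMap a s '' U ∩ moserMap a s '' V) ((hopen U hU).inter (hopen V hV))
    ⟨moserMap a s p, mem_image_of_mem _ hpU, hpq ▸ mem_image_of_mem _ hqV⟩
  have huo : u ∈ MulAction.orbit (CTorus n) o := (hmem u).1 (hur ▸ hro)
  have hvo : v ∈ MulAction.orbit (CTorus n) o := (hmem v).1 (hvr ▸ hro)
  exact disjoint_left.1 hUV hu (hO huo hvo (hur.trans hvr.symm) ▸ hv)

/-- The map is a local diffeomorphism, so its image is open; it is also compact, hence all of the
connected manifold. -/
theorem IsVelocity.exists_diffeomorph [CompactSpace M] [ConnectedSpace M] (ha : IsVelocity Ω H a)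
    (hM : IsToricKaehler Ω o) (hH : ContMDiff 𝓘(ℝ, CSpace n) 𝓘(ℝ, ℝ) 3 H)
    (hψ : IsOpenOrbitPotential Ω o ψ) (hd : IsMoserData ψ h α)
    (haα : ∀ ζ : CSpace n, a (logParam o ζ) = α (reL ζ)) {s s' : ℝ}
    (hs : 0 ≤ s) (hss : s < s') (hq : ∀ x v, 0 ≤ shiftForm ψ α s' x v v) :
    ∃ Φ : M ≃ₘ^1⟮𝓘(ℝ, CSpace n), 𝓘(ℝ, CSpace n)⟯ M, ⇑Φ = moserMap a s := by
  have hα : Differentiable ℝ α := fun x => (hd.hasFDerivAt_velocity x).differentiableAt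
  have hstr := fun z => ha.exists_equiv_hasStrictFDerivAt hM hH hα haα (s := s) z fun v =>
    ha.injective_sub_shear hM hH hψ hd haα hs hss hq z (mem_chart_target _ z)
  have hopen : IsOpenMap (moserMap (M := M) a s) :=
    isOpenMap_of_chart (ha.continuous_moserMap hM s) hstr
  refine exists_diffeomorph_of_chart
    ⟨hM.moserMap_injective haα hopen (hd.shift_injective hs hss hq), ?_⟩
    (ha.contMDiff_moserMap hM hH hα haα s) hstr
  rw [← range_eq_univ]
  exact IsClopen.eq_univ ⟨(isCompact_range (ha.continuous_moserMap hM s)).isClosed,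
    hopen.isOpen_range⟩ ⟨_, mem_range_self o⟩

theorem IsVelocity.sub_shear_injective_of_diffeomorph (ha : IsVelocity Ω H a)
    (hM : IsToricKaehler Ω o) (hH : ContMDiff 𝓘(ℝ, CSpace n) 𝓘(ℝ, ℝ) 3 H)
    (hα : Differentiable ℝ α) (haα : ∀ ζ : CSpace n, a (logParam o ζ) = α (reL ζ)) {s : ℝ}
    {Φ : M ≃ₘ^1⟮𝓘(ℝ, CSpace n), 𝓘(ℝ, CSpace n)⟯ M} (hΦ : ⇑Φ = moserMap a s) (z : M)
    {y : CSpace n} (hy : y ∈ (ch n z).target) {v : CSpace n}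
    (hv : v - s • shear Ω H a z y v = 0) : v = 0 := by
  set p := (ch n z).symm y with hp
  have hgp := mem_chart_source (CSpace n) (moserMap a s p)
  have h1 := (ha.hasStrictFDerivAt_moserMap hM hH hα haα s z (moserMap a s p) hy
    hgp).1.hasFDerivAt
  have hsp : Φ.symm (moserMap a s p) = p := by rw [← hΦ]; exact Φ.symm_apply_apply p
  have h2 : DifferentiableAt ℝ (ch n z ∘ Φ.symm ∘ (ch n (moserMap a s p)).symm)
      ((ch n (moserMap a s p) ∘ moserMap a s ∘ (ch n z).symm) y) := by
    rw [← mdifferentiableAt_iff_differentiableAt]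
    have e1 : (ch n (moserMap a s p)).symm
      ((ch n (moserMap a s p) ∘ moserMap a s ∘ (ch n z).symm) y) = moserMap a s p :=
        (ch n (moserMap a s p)).left_inv hgp
    refine MDifferentiableAt.comp (I' := 𝓘(ℝ, CSpace n)) _ ?_
      (MDifferentiableAt.comp (I' := 𝓘(ℝ, CSpace n)) _
        (Φ.symm.contMDiff.mdifferentiable (by simp) _) ?_)
    · refine (chart_mdifferentiable z).mdifferentiableAt ?_
      simp only [Function.comp] at e1 ⊢
      rw [e1, hsp]
      exact (ch n z).map_target hy
    · exact (chart_mdifferentiable (moserMap a s p)).mdifferentiableAt_symm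
        ((ch n (moserMap a s p)).map_source hgp)
  have h3 := h2.hasFDerivAt.comp y h1
  have h4 : (ch n z ∘ Φ.symm ∘ (ch n (moserMap a s p)).symm) ∘
      (ch n (moserMap a s p) ∘ moserMap a s ∘ (ch n z).symm) =ᶠ[𝓝 y] id := by
    filter_upwards [ha.eventually_moserMap_mem hM s z (moserMap a s p) hy hgp] with y' hy'
    simp only [Function.comp]
    rw [(ch n (moserMap a s p)).left_inv hy'.2, ← hΦ, Φ.symm_apply_apply,
      (ch n z).right_inv hy'.1, id]
  have h5 := (h3.congr_of_eventuallyEq h4.symm).unique (hasFDerivAt_id y)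
  have h6 := congrArg (fun L => L v) h5
  simp only [ContinuousLinearMap.comp_apply, ContinuousLinearMap.id_apply, moserFDeriv_apply,
    hv, map_zero] at h6
  exact h6.symm

/-- Semidefiniteness comes from the open orbit by density. A null vector v pairs to zero with every
w, and the choice w = (1 - sN)v gives the Kähler norm of (1 - sN)v, so this vector vanishes. -/
theorem IsVelocity.moserForm_pos (ha : IsVelocity Ω H a) (hM : IsToricKaehler Ω o)
    (hH : ContMDiff 𝓘(ℝ, CSpace n) 𝓘(ℝ, ℝ) 3 H) (hψ : IsOpenOrbitPotential Ω o ψ)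
    (hd : IsMoserData ψ h α) (haα : ∀ ζ : CSpace n, a (logParam o ζ) = α (reL ζ)) {s : ℝ}
    (hq : ∀ x v, 0 ≤ shiftForm ψ α s x v v) (z : M) {y : CSpace n} (hy : y ∈ (ch n z).target)
    (hinj : ∀ v, v - s • shear Ω H a z y v = 0 → v = 0) {v : CSpace n} (hv : v ≠ 0) :
    0 < moserForm Ω H a s z y v v := by
  have hnn : ∀ v, 0 ≤ moserForm Ω H a s z y v v := by
    intro v
    refine hM.nonneg_of_orbitChart (g := fun y => moserForm Ω H a s z y v v)
      (ha.continuousOn_moserForm hM hH z s v v) (fun y hy => ?_) hy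
    obtain ⟨ζ, hζ, rfl⟩ := exists_logParam_of_mem_orbitChart hy
    obtain ⟨p, rfl⟩ := hM.exists_fund_eq z hζ v
    rw [ha.moserForm_fund hM hH hψ (fun x => (hd.hasFDerivAt_velocity x).differentiableAt) haα s z hζ]
    refine add_nonneg (hq _ _) ?_
    rcases eq_or_ne (imL p) 0 with h0 | h0
    · rw [h0, inner_zero_right]
    · exact (hd.hess_pos _ _ h0).le
  refine lt_of_le_of_ne (hnn v) fun h0 => hv (hinj v ?_)
  have key : ∀ w, moserForm Ω H a s z y v w = 0 := by
    intro w
    refine eq_zero_of_forall_nonneg_quadratic (c := moserForm Ω H a s z y w w) fun t => ?_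
    have h1 := hnn (v + t • w)
    rw [moserForm_add_smul, ← h0, ha.moserForm_symm hM hH hψ hd haα s z hy w v] at h1
    linarith
  by_contra h1
  exact (hM.kaehler.formChart_pos z hy h1).ne' (key (v - s • shear Ω H a z y v))

/-- Positive definiteness is an open condition in s and the point jointly, by compactness of unit
spheres; compactness of M makes it uniform. On the noncompact ℝⁿ alone this would fail, hence the
passage through M. -/
theorem IsVelocity.eventually_shiftForm_nonneg [CompactSpace M] (ha : IsVelocity Ω H a)
    (hM : IsToricKaehler Ω o) (hH : ContMDiff 𝓘(ℝ, CSpace n) 𝓘(ℝ, ℝ) 3 H)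
    (hψ : IsOpenOrbitPotential Ω o ψ) (hd : IsMoserData ψ h α)
    (haα : ∀ ζ : CSpace n, a (logParam o ζ) = α (reL ζ)) {s : ℝ}
    (hpos : ∀ (z : M) (v : CSpace n), v ≠ 0 → 0 < moserForm Ω H a s z (ch n z z) v v) :
    ∀ᶠ s' in 𝓝 s, ∀ x v, 0 ≤ shiftForm ψ α s' x v v := by
  have hα : Differentiable ℝ α := fun x => (hd.hasFDerivAt_velocity x).differentiableAt
  have key : ∀ᶠ s' in 𝓝 s, ∀ p ∈ (univ : Set M), ∀ ζ : CSpace n, logParam o ζ = p →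
      ∀ v, 0 ≤ shiftForm ψ α s' (reL ζ) v v := by
    refine isCompact_univ.eventually_forall_of_forall_eventually fun z _ => ?_
    have h1 : ∀ᶠ q : ℝ × CSpace n in 𝓝 (s, ch n z z), ∀ v ∈ Metric.sphere (0 : CSpace n) 1,
        0 < moserForm Ω H a q.1 z q.2 v v := by
      refine (isCompact_sphere _ _).eventually_forall_of_forall_eventually fun v hv => ?_
      have h2 : v ≠ 0 := fun h => by simp [h] at hv
      have h3 : ContinuousAt (fun p : (ℝ × CSpace n) × CSpace n =>
          moserForm Ω H a p.1.1 z p.1.2 p.2 p.2) ((s, ch n z z), v) :=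
        ContinuousAt.comp (f := fun p : (ℝ × CSpace n) × CSpace n => (p.1, (p.2, p.2)))
          (x := ((s, ch n z z), v)) (ha.continuousAt_moserForm hM hH z s (mem_chart_target _ z) v v) (by fun_prop)
      exact h3.eventually (lt_mem_nhds (hpos z v h2))
    have hz := mem_chart_source (CSpace n) z
    have h2 : ContinuousAt (fun q : ℝ × M => (q.1, ch n z q.2)) (s, z) :=
      continuousAt_fst.prodMk (ContinuousAt.comp (f := fun q : ℝ × M => q.2)
        ((ch n z).continuousAt hz) continuousAt_snd)
    have h3 : ∀ᶠ q : ℝ × M in 𝓝 (s, z), q.2 ∈ (ch n z).source :=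
      continuousAt_snd.eventually ((ch n z).open_source.mem_nhds hz)
    filter_upwards [h2.eventually h1, h3]
    rintro ⟨s', p⟩ h4 hp ζ rfl v
    have h5 : ∀ u, 0 ≤ moserForm Ω H a s' z (ch n z (logParam o ζ)) u u := by
      intro u
      rcases eq_or_ne u 0 with rfl | hu
      · rw [moserForm, smul_zero, map_zero]
      · have h6 := h4 (‖u‖⁻¹ • u) (by simp [norm_smul, hu])
        rw [moserForm_smul_smul] at h6
        exact (pos_of_mul_pos_right h6 (sq_nonneg _)).le
    have h6 := h5 (fund n z (ch n z (logParam o ζ)) (rc v))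
    rwa [ha.moserForm_fund hM hH hψ hα haα s' z hp, reL_rc, imL_rc, inner_zero_right,
      add_zero] at h6
  filter_upwards [key] with s' h1 x v
  have := h1 (logParam o (rc x)) (mem_univ _) (rc x) rfl v
  rwa [reL_rc] at this

theorem IsVelocity.eventually_shiftForm_nonneg_of_diffeomorph [CompactSpace M]
    (ha : IsVelocity Ω H a) (hM : IsToricKaehler Ω o)
    (hH : ContMDiff 𝓘(ℝ, CSpace n) 𝓘(ℝ, ℝ) 3 H) (hψ : IsOpenOrbitPotential Ω o ψ)
    (hd : IsMoserData ψ h α) (haα : ∀ ζ : CSpace n, a (logParam o ζ) = α (reL ζ))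
    (hh : ∀ x, h x = H (logParam o (rc x))) {s : ℝ} (hs : 0 ≤ s)
    {Φ : M ≃ₘ^1⟮𝓘(ℝ, CSpace n), 𝓘(ℝ, CSpace n)⟯ M} (hΦ : ⇑Φ = moserMap a s) :
    ∀ᶠ s' in 𝓝 s, ∀ x v, 0 ≤ shiftForm ψ α s' x v v := by
  have hα : Differentiable ℝ α := fun x => (hd.hasFDerivAt_velocity x).differentiableAt
  have hinj : ∀ (z : M) {y : CSpace n}, y ∈ (ch n z).target → ∀ v,
      v - s • shear Ω H a z y v = 0 → v = 0 := fun z y hy v hv =>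
    ha.sub_shear_injective_of_diffeomorph hM hH hα haα hΦ z hy hv
  have hinj' : ∀ x v, v - s • fderiv ℝ α x v = 0 → v = 0 := by
    intro x v hv
    have hζ := mem_chart_source (CSpace n) (logParam o (rc x))
    have h1 := ha.shear_fund hM hH hα haα _ hζ (rc v)
    rw [reL_rc, reL_rc] at h1
    have h2 := hinj _ ((ch n (logParam o (rc x))).map_source hζ) _ (by
      rw [h1, ← ContinuousLinearMap.map_smul_of_tower, ← map_smul rc, ← map_sub, ← map_sub, hv, map_zero, map_zero])
    have h3 : rc v = 0 :=
      hM.fund_injective _ hζ (logParam_mem_orbit o _) (h2.trans (map_zero _).symm)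
    rw [← reL_rc v, h3, map_zero]
  obtain ⟨A, hA⟩ := isCompact_univ.exists_bound_of_continuousOn ha.continuous.continuousOn
  obtain ⟨G, hG⟩ := hψ.exists_gradient_bound hM
  obtain ⟨C, hC⟩ := isCompact_univ.exists_bound_of_continuousOn hH.continuous.continuousOn
  have hq := hd.shiftForm_pos (A := A) (G := G) (C := C) hs
    (fun x => by
      have := hA (logParam o (rc x)) (mem_univ _)
      rwa [haα, reL_rc] at this) hG
    (fun x => by rw [hh]; exact hC _ (mem_univ _)) hinj'
  -- Positivity on ℝⁿ is used only as semidefiniteness, which reaches the boundary of the open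
  -- orbit; there the invertibility of the derivative of f_s restores definiteness.
  refine ha.eventually_shiftForm_nonneg hM hH hψ hd haα fun z v hv => ?_
  refine ha.moserForm_pos hM hH hψ hd haα (fun x v => ?_) z (mem_chart_target _ z)
    (hinj z (mem_chart_target _ z)) hv
  rcases eq_or_ne v 0 with rfl | h0
  · simp [shiftForm]
  · exact (hq x v h0).le

theorem IsMoserData.ofReal_lt_convexLifespan_iff (hd : IsMoserData ψ h α) {s : ℝ} (hs : 0 ≤ s) :
    ENNReal.ofReal s < convexLifespan ψ h ↔
      ∃ s', s < s' ∧ ∀ x v, 0 ≤ shiftForm ψ α s' x v v := by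
  rw [convexLifespan, lt_sSup_iff]
  constructor
  · rintro ⟨_, ⟨s', ⟨hs', hc⟩, rfl⟩, hlt⟩
    exact ⟨s', (ENNReal.ofReal_lt_ofReal_iff hs').1 hlt, (hd.convexOn_dual_iff s').1 hc⟩
  · rintro ⟨s', hss, hq⟩
    exact ⟨_, ⟨s', ⟨hs.trans_lt hss, (hd.convexOn_dual_iff s').2 hq⟩, rfl⟩,
      (ENNReal.ofReal_lt_ofReal_iff (hs.trans_lt hss)).2 hss⟩

theorem IsOpenOrbitPotential.isMoserData (hψ : IsOpenOrbitPotential Ω o ψ)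
    (hM : IsToricKaehler Ω o) (hH : ContMDiff 𝓘(ℝ, CSpace n) 𝓘(ℝ, ℝ) 3 H) :
    IsMoserData ψ (onOpenOrbit o H) (hessianInvGrad ψ (onOpenOrbit o H)) where
  smooth := hψ.smooth.of_le (WithTop.coe_le_coe.2 le_top)
  hess_pos x _ hv := hψ.inner_hess_pos hM x hv
  smooth_right := (hM.contDiff_onOpenOrbit hH).of_le (by norm_num)
  smooth_velocity := hψ.contDiff_hessianInvGrad hM (hM.contDiff_onOpenOrbit hH)
  hess_velocity x := hψ.hess_hessianInvGrad hM _ x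

theorem IsVelocity.exists_diffeomorph_iff [CompactSpace M] [ConnectedSpace M]
    (ha : IsVelocity Ω H a) (hM : IsToricKaehler Ω o)
    (hH : ContMDiff 𝓘(ℝ, CSpace n) 𝓘(ℝ, ℝ) 3 H) (hψ : IsOpenOrbitPotential Ω o ψ)
    (haα : ∀ ζ : CSpace n, a (logParam o ζ) = hessianInvGrad ψ (onOpenOrbit o H) (reL ζ))
    {s : ℝ} (hs : 0 ≤ s) :
    (∃ Φ : M ≃ₘ^1⟮𝓘(ℝ, CSpace n), 𝓘(ℝ, CSpace n)⟯ M, ⇑Φ = moserMap a s) ↔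
      ENNReal.ofReal s < convexLifespan ψ (onOpenOrbit o H) := by
  have hd := hψ.isMoserData hM hH
  rw [hd.ofReal_lt_convexLifespan_iff hs]
  constructor
  · rintro ⟨Φ, hΦ⟩
    have h1 := ha.eventually_shiftForm_nonneg_of_diffeomorph hM hH hψ hd haα (fun x => rfl) hs hΦ
    obtain ⟨s', h2, h3⟩ := ((h1.filter_mono nhdsWithin_le_nhds).and
      (self_mem_nhdsWithin (s := Ioi s))).exists
    exact ⟨s', h3, h2⟩
  · rintro ⟨s', hss, hq⟩
    exact ha.exists_diffeomorph hM hH hψ hd haα hs hss hq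

end Lifespan

end ToricMoser

end

/-! ### The theorem -/

open ToricMoser in
theorem proposition1p8 {n : ℕ} {M : Type*} [TopologicalSpace M] [T2Space M] [CompactSpace M]
    [ConnectedSpace M] [ChartedSpace (CSpace n) M] [IsManifold 𝓘(ℂ, CSpace n) ω M]
    [MulAction (CTorus n) M] (Ω : TwoForm n M) (o : M) (hM : IsToricKaehler Ω o)
    (H : M → ℝ) (hH : ContMDiff 𝓘(ℝ, CSpace n) 𝓘(ℝ, ℝ) 3 H) (hinv : IsTorusInvariant (n := n) H) :
    -- the Cauchy problem is `T`-good for all `T > 0`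
    (∀ T : ℝ, 0 < T → IsTGood Ω H T) ∧
    -- the Hamiltonian orbits extend by affine maps in the logarithmic coordinates of their orbits
    (∀ T : ℝ, 0 < T → ∀ f : ℂ → M → M, IsMoserFamily Ω H T f →
      ∀ z : M, ∃ a : RSpace n, ∀ τ ∈ strip T, f τ z = torusExp (-τ • cvec a 0) • z) ∧
    (∃ ψ : RSpace n → ℝ, IsOpenOrbitPotential Ω o ψ) ∧
    ∀ ψ : RSpace n → ℝ, IsOpenOrbitPotential Ω o ψ →
      ∀ T : ℝ, 0 < T → ∀ f : ℂ → M → M, IsMoserFamily Ω H T f →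
        -- the explicit form of the extensions over the open orbit
        (∀ ζ : CSpace n, ∀ τ ∈ strip T,
          f τ (logParam o ζ) =
            logParam o (ζ - τ • cvec (hessianInvGrad ψ (onOpenOrbit o H) (revec ζ)) 0)) ∧
        -- the Moser maps are diffeomorphisms exactly before the convex lifespan
        (∀ s : ℝ, 0 ≤ s → s ≤ T →
          ((∃ Φ : M ≃ₘ^1⟮𝓘(ℝ, CSpace n), 𝓘(ℝ, CSpace n)⟯ M, ⇑Φ = f s) ↔
            ENNReal.ofReal s < convexLifespan ψ (onOpenOrbit o H))) := by
  have hvel : ∀ ψ : RSpace n → ℝ, IsOpenOrbitPotential Ω o ψ → ∃ a : M → RSpace n,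
      IsVelocity Ω H a ∧
        ∀ ζ : CSpace n, a (logParam o ζ) = hessianInvGrad ψ (onOpenOrbit o H) (reL ζ) := by
    intro ψ hψ
    obtain ⟨a, h1, h2, h3, h4⟩ := hM.exists_velocity hH hinv hψ
    exact ⟨a, ⟨h1, h3, h4⟩, h2⟩
  obtain ⟨ψ₀, hψ₀⟩ := hM.exists_potential
  obtain ⟨a₀, ha₀, haα₀⟩ := hvel ψ₀ hψ₀
  refine ⟨fun T _ => ha₀.isTGood hM hH
    (fun x => ((hψ₀.isMoserData hM hH).hasFDerivAt_velocity x).differentiableAt) haα₀ T,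
    fun T hT f hf z => ⟨a₀ z, ha₀.eq_moserMap hM hH hT hf z⟩, ⟨ψ₀, hψ₀⟩,
    fun ψ hψ T hT f hf => ?_⟩
  obtain ⟨a, ha, haα⟩ := hvel ψ hψ
  refine ⟨fun ζ τ hτ => ?_, fun s hs hsT => ?_⟩
  · rw [ha.eq_moserMap hM hH hT hf _ τ hτ, moserMap_logParam haα]
    rfl
  -- A Moser family is determined only on its strip, which contains s because 0 ≤ s ≤ T.
  · have hfs : f s = moserMap a s := by
      funext z
      exact ha.eq_moserMap hM hH hT hf z s (by simp [strip, hs, hsT])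
    rw [hfs]
    exact ha.exists_diffeomorph_iff hM hH hψ haα hs
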